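/- Let $H\neq 0$ be a complex Hilbert space and let $U$ be a unitary operator on $H$ with simple, continuous and singular spectrum: $U$ has a cyclic vector, and its spectral measures on the unit circle $\mathbb T$ have no atoms and are singular with respect to Lebesgue measure. For $n\ge 1$ let $U^{\odot n}$ be the restriction of $U^{\otimes n}$ to the symmetric tensor power $H^{\odot n}\subset H^{\otimes n}$, and for a unitary operator $V$ put $\mathrm{Exp}(V)=\bigoplus_{n\ge 1}V^{\odot n}$. Two unitary operators are called disjoint if every spectral measure of the one is singular to every spectral measure of the other. Let $\mathcal M(V)\subset\{1,2,\dots,\infty\}$ be the set of spectral multiplicities of $V$, that is, the set of essential values of its multiplicity function with respect to its maximal spectral type. For a sequence $z=(z_m)_{m\ge 1}$ in $\mathbb T$ and a non-empty set $M\subset\{1,2,3,\dots\}$ put $$V=V_{z,M}=\bigoplus_{m\in M}\ \underbrace{(z_mU\oplus\dots\oplus z_mU)}_{m\text{ copies}} .$$ Almost every $z\in\mathbb T^{\mathbb N}$ (with respect to the product of the normalized Lebesgue measures) is such that the operators $z_mU$, $m\ge1$, are pairwise disjoint. Moreover: (a) If $U^{\odot 2}$ has absolutely continuous spectrum, then $\mathcal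 M(\mathrm{Exp}(V_{z,M}))=M\cup\{\infty\}$ for every $z$ such that the operators $z_mU$ are pairwise disjoint, and every non-empty $M\subset\{1,2,3,\dots\}$. (b) If for every $n>1$ the operator $U^{\odot n}$ has homogeneous spectrum of infinite multiplicity, i.e. $\mathcal M(U^{\odot n})=\{\infty\}$, and the operators $U^{\odot n}$, $n\ge 1$, are pairwise disjoint, then for almost every $z\in\mathbb T^{\mathbb N}$ one has $\mathcal M(\mathrm{Exp}(V_{z,M}))=M\cup\{\infty\}$ for all non-empty $M\subset\{1,2,3,\dots\}$ simultaneously. In particular the $z_m$ can be chosen with the $z_mU$ pairwise disjoint and with this property. -/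

import Mathlib

noncomputable section

namespace SpectralMult

open MeasureTheory UniformSpace
open scoped ComplexInnerProductSpace ComplexConjugate TensorProduct InnerProductSpace


/-! ### Spectral notions for unitary operators

A unitary operator on a complex Hilbert space `H` is a linear isometric automorphism
`H ≃ₗᵢ[ℂ] H`; the unit circle is parametrised by `t ∈ ℝ/ℤ`, `t ↦ exp (2πit)`. -/

section Spectral

variable {H : Type*} [NormedAddCommGroup H] [InnerProductSpace ℂ H]
variable {K : Type*} [NormedAddCommGroup K] [InnerProductSpace ℂ K]

/-- `μ` is the spectral measure of the vector `x` with respect to the unitary operator `U`: the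
finite Borel measure on the circle with `∫ exp (2πikt) dμ(t) = ⟪x, U ^ k x⟫` for all `k : ℤ`. -/
def IsSpectralMeasure (U : H ≃ₗᵢ[ℂ] H) (x : H) (μ : Measure UnitAddCircle) : Prop :=
  IsFiniteMeasure μ ∧ ∀ k : ℤ, ∫ t, fourier k t ∂μ = ⟪x, (U ^ k) x⟫_ℂ

/-- Continuous spectrum: spectral measures have no atoms. -/
def HasContinuousSpectrum (U : H ≃ₗᵢ[ℂ] H) : Prop :=
  ∀ (x : H) (μ : Measure UnitAddCircle), IsSpectralMeasure U x μ → ∀ t, μ {t} = 0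

/-- Singular spectrum: spectral measures are singular to Lebesgue measure on the circle. -/
def HasSingularSpectrum (U : H ≃ₗᵢ[ℂ] H) : Prop :=
  ∀ (x : H) (μ : Measure UnitAddCircle), IsSpectralMeasure U x μ → μ ⟂ₘ volume

/-- Absolutely continuous spectrum: spectral measures are absolutely continuous with respect to
Lebesgue measure on the circle. -/
def HasAbsolutelyContinuousSpectrum (U : H ≃ₗᵢ[ℂ] H) : Prop :=
  ∀ (x : H) (μ : Measure UnitAddCircle), IsSpectralMeasure U x μ → μ ≪ volume

/-- Simple spectrum: there is a cyclic vector. -/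
def HasSimpleSpectrum (U : H ≃ₗᵢ[ℂ] H) : Prop :=
  ∃ x : H, (Submodule.span ℂ (Set.range fun k : ℤ => (U ^ k) x)).topologicalClosure = ⊤

/-- Spectral disjointness: every spectral measure of `U` is singular to every spectral measure
of `V`. -/
def SpectrallyDisjoint (U : H ≃ₗᵢ[ℂ] H) (V : K ≃ₗᵢ[ℂ] K) : Prop :=
  ∀ (x : H) (y : K) (μ ν : Measure UnitAddCircle),
    IsSpectralMeasure U x μ → IsSpectralMeasure V y ν → μ ⟂ₘ ν

/-- The set of spectral multiplicities of a unitary operator, i.e. of the essential values of its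
multiplicity function. The value `n ∈ {1, 2, …, ∞}` belongs to it if and only if `U` is, up to
unitary equivalence, the direct sum of exactly `n` copies of the multiplication by
`exp (2πit)` on `L²(μ)`, for some nonzero finite measure `μ`, and of an operator whose spectral
measures are all singular to `μ`: the copies are the cyclic subspaces of the vectors `x i`, which
have the same spectral measure `μ` and are pairwise orthogonal, and the other summand is the
orthogonal complement of these cyclic subspaces. -/
def spectralMultiplicities (U : H ≃ₗᵢ[ℂ] H) : Set ℕ∞ :=
  {n | 1 ≤ n ∧ ∃ (μ : Measure UnitAddCircle) (x : {i : ℕ // (i : ℕ∞) < n} → H),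
    μ ≠ 0 ∧
    (∀ i, IsSpectralMeasure U (x i) μ) ∧
    (∀ i j, i ≠ j → ∀ k : ℤ, ⟪x i, (U ^ k) (x j)⟫_ℂ = 0) ∧
    ∀ y : H, (∀ i, ∀ k : ℤ, ⟪(U ^ k) (x i), y⟫_ℂ = 0) →
      ∀ ν : Measure UnitAddCircle, IsSpectralMeasure U y ν → ν ⟂ₘ μ}

/-- The unitary operator `z U`, for `|z| = 1`. -/
def rotate (z : Circle) (U : H ≃ₗᵢ[ℂ] H) : H ≃ₗᵢ[ℂ] H where
  toLinearEquiv := U.toLinearEquiv.trans (LinearEquiv.smulOfNeZero ℂ H (z : ℂ) z.coe_ne_zero)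
  norm_map' x := by
    change ‖(z : ℂ) • U x‖ = ‖x‖
    rw [norm_smul, Circle.norm_coe, one_mul, U.norm_map]

@[simp] theorem rotate_apply (z : Circle) (U : H ≃ₗᵢ[ℂ] H) (x : H) :
    rotate z U x = (z : ℂ) • U x := rfl

end Spectral

/-! ### Hilbert direct sums of unitary operators -/

section DirectSum

variable {ι : Type*} {E : ι → Type*} [∀ i, NormedAddCommGroup (E i)]
  [∀ i, InnerProductSpace ℂ (E i)]

theorem memlp_map (U : ∀ i, E i ≃ₗᵢ[ℂ] E i) (f : lp E 2) :
    Memℓp (fun i => U i (f i)) 2 := by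
  have hf := lp.memℓp f
  have h : (0 : ℝ) < (2 : ENNReal).toReal := by norm_num
  rw [memℓp_gen_iff h] at hf ⊢
  simpa using hf

/-- The direct sum `⨁ i, U i`, acting coordinatewise on the Hilbert sum of the `E i`. -/
def directSum (U : ∀ i, E i ≃ₗᵢ[ℂ] E i) : lp E 2 ≃ₗᵢ[ℂ] lp E 2 where
  toFun f := ⟨fun i => U i (f i), memlp_map U f⟩
  map_add' f g := by ext i; exact (U i).map_add (f i) (g i)
  map_smul' c f := by ext i; exact (U i).map_smul c (f i)
  invFun f := ⟨fun i => (U i).symm (f i), memlp_map (fun i => (U i).symm) f⟩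
  left_inv f := by ext i; simp
  right_inv f := by ext i; simp
  norm_map' f := by
    have h : (0 : ℝ) < (2 : ENNReal).toReal := by norm_num
    simp [lp.norm_eq_tsum_rpow h]

@[simp] theorem directSum_apply (U : ∀ i, E i ≃ₗᵢ[ℂ] E i) (f : lp E 2) (i : ι) :
    directSum U f i = U i (f i) := rfl

end DirectSum

/-! ### Tensor powers and symmetric tensor powers -/

section Tensor

variable (H : Type*) [NormedAddCommGroup H] [InnerProductSpace ℂ H] (n : ℕ)

/-- The algebraic `n`-th tensor power of `H`, a type synonym that carries the inner product
with `⟪x₁ ⊗ ⋯ ⊗ xₙ, y₁ ⊗ ⋯ ⊗ yₙ⟫ = ∏ ⟪xᵢ, yᵢ⟫`. -/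
def AlgTensorPower : Type _ := ⨂[ℂ] _ : Fin n, H

instance : AddCommGroup (AlgTensorPower H n) :=
  inferInstanceAs (AddCommGroup (⨂[ℂ] _ : Fin n, H))

instance : Module ℂ (AlgTensorPower H n) :=
  inferInstanceAs (Module ℂ (⨂[ℂ] _ : Fin n, H))

variable {H n}

/-- The decomposable tensor `x₁ ⊗ ⋯ ⊗ xₙ`. -/
def pure (x : Fin n → H) : AlgTensorPower H n := PiTensorProduct.tprod ℂ x

/-- The functional `⟪x₁ ⊗ ⋯ ⊗ xₙ, ·⟫`. -/
def pureInner (x : Fin n → H) : AlgTensorPower H n →ₗ[ℂ] ℂ :=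
  PiTensorProduct.lift ((MultilinearMap.mkPiAlgebra ℂ (Fin n) ℂ).compLinearMap
    fun i => innerₛₗ ℂ (x i))

@[simp] theorem pureInner_pure (x y : Fin n → H) :
    pureInner x (pure y) = ∏ i, ⟪x i, y i⟫_ℂ := by
  refine (PiTensorProduct.lift.tprod y).trans ?_
  simp

theorem algTensor_induction {motive : AlgTensorPower H n → Prop} (t : AlgTensorPower H n)
    (smul_pure : ∀ (c : ℂ) (x : Fin n → H), motive (c • pure x))
    (add : ∀ s t, motive s → motive t → motive (s + t)) : motive t :=
  PiTensorProduct.induction_on (motive := motive) t smul_pure add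

theorem pureInner_update_add [DecidableEq (Fin n)] (x : Fin n → H) (i : Fin n) (a b : H)
    (t : AlgTensorPower H n) :
    pureInner (Function.update x i (a + b)) t =
      pureInner (Function.update x i a) t + pureInner (Function.update x i b) t := by
  induction t using algTensor_induction with
  | smul_pure c y =>
    simp only [map_smul, pureInner_pure, smul_eq_mul, ← mul_add]
    congr 1
    simp only [Finset.prod_eq_mul_prod_sdiff_singleton_of_mem (Finset.mem_univ i),
      Function.update_self, inner_add_left, add_mul]
    have key : ∀ c : H, ∏ j ∈ Finset.univ \ {i}, ⟪Function.update x i c j, y j⟫_ℂ =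
        ∏ j ∈ Finset.univ \ {i}, ⟪x j, y j⟫_ℂ := fun c =>
      Finset.prod_congr rfl fun j hj => by
        rw [Function.update_of_ne (by simpa using hj)]
    simp only [key]
  | add s t hs ht => simp only [map_add, hs, ht]; ring

theorem pureInner_update_smul [DecidableEq (Fin n)] (x : Fin n → H) (i : Fin n) (r : ℂ) (a : H)
    (t : AlgTensorPower H n) :
    pureInner (Function.update x i (r • a)) t =
      conj r * pureInner (Function.update x i a) t := by
  induction t using algTensor_induction with
  | smul_pure c y =>
    simp only [map_smul, pureInner_pure, smul_eq_mul]
    simp only [Finset.prod_eq_mul_prod_sdiff_singleton_of_mem (Finset.mem_univ i),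
      Function.update_self, inner_smul_left]
    have key : ∀ c : H, ∏ j ∈ Finset.univ \ {i}, ⟪Function.update x i c j, y j⟫_ℂ =
        ∏ j ∈ Finset.univ \ {i}, ⟪x j, y j⟫_ℂ := fun c =>
      Finset.prod_congr rfl fun j hj => by
        rw [Function.update_of_ne (by simpa using hj)]
    simp only [key]
    ring
  | add s t hs ht => simp only [map_add, hs, ht]; ring

/-- The functional `⟪s, ·⟫` on the algebraic tensor power: it sends `y₁ ⊗ ⋯ ⊗ yₙ` to the
conjugate of `⟪y₁ ⊗ ⋯ ⊗ yₙ, s⟫`. -/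
def innerFunctional (s : AlgTensorPower H n) : AlgTensorPower H n →ₗ[ℂ] ℂ :=
  PiTensorProduct.lift
    { toFun := fun y => conj (pureInner y s)
      map_update_add' := fun y i a b => by rw [pureInner_update_add, map_add]
      map_update_smul' := fun y i c a => by
        rw [pureInner_update_smul, map_mul, Complex.conj_conj, smul_eq_mul] }

@[simp] theorem innerFunctional_pure (s : AlgTensorPower H n) (y : Fin n → H) :
    innerFunctional s (pure y) = conj (pureInner y s) := by
  exact PiTensorProduct.lift.tprod y

instance : Inner ℂ (AlgTensorPower H n) := ⟨fun s t => innerFunctional s t⟩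

theorem algInner_def (s t : AlgTensorPower H n) : ⟪s, t⟫_ℂ = innerFunctional s t := rfl

theorem inner_pure_pure (x y : Fin n → H) :
    ⟪pure x, pure y⟫_ℂ = ∏ i, ⟪x i, y i⟫_ℂ := by
  simp [algInner_def]

theorem algInner_add_left (s s' t : AlgTensorPower H n) :
    ⟪s + s', t⟫_ℂ = ⟪s, t⟫_ℂ + ⟪s', t⟫_ℂ := by
  simp only [algInner_def]
  induction t using algTensor_induction with
  | smul_pure c y => simp [mul_add]
  | add t t' h h' => simp only [map_add, h, h']; ring

theorem algInner_smul_left (s t : AlgTensorPower H n) (r : ℂ) :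
    ⟪r • s, t⟫_ℂ = conj r * ⟪s, t⟫_ℂ := by
  simp only [algInner_def]
  induction t using algTensor_induction with
  | smul_pure c y => simp; ring
  | add t t' h h' => simp only [map_add, h, h']; ring

theorem algInner_conj_symm (s t : AlgTensorPower H n) : conj ⟪t, s⟫_ℂ = ⟪s, t⟫_ℂ := by
  induction t using algTensor_induction with
  | smul_pure c y =>
    rw [algInner_smul_left]
    induction s using algTensor_induction with
    | smul_pure d x => simp [algInner_def]
    | add s s' h h' =>
      rw [algInner_add_left, ← h, ← h']
      simp only [algInner_def, map_add]; simp; ring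
  | add t t' h h' =>
    rw [algInner_add_left, map_add, h, h']
    simp only [algInner_def, map_add]

theorem exists_sum_pure (t : AlgTensorPower H n) :
    ∃ (N : ℕ) (c : Fin N → ℂ) (x : Fin N → Fin n → H), t = ∑ k, c k • pure (x k) := by
  induction t using algTensor_induction with
  | smul_pure c y => exact ⟨1, fun _ => c, fun _ => y, by simp⟩
  | add t t' h h' =>
    obtain ⟨N, c, x, rfl⟩ := h
    obtain ⟨N', c', x', rfl⟩ := h'
    exact ⟨N + N', Fin.append c c', Fin.append x x', by simp [Fin.sum_univ_add]⟩

open scoped ComplexOrder Matrix in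
theorem posSemidef_prod_gram {N : ℕ} (x : Fin N → Fin n → H) (s : Finset (Fin n)) :
    (Matrix.of fun k l => ∏ i ∈ s, ⟪x k i, x l i⟫_ℂ : Matrix (Fin N) (Fin N) ℂ).PosSemidef := by
  induction s using Finset.induction_on with
  | empty =>
    have h := Matrix.posSemidef_gram ℂ (fun _ : Fin N => (1 : ℂ))
    have e : (Matrix.of fun k l => ∏ i ∈ (∅ : Finset (Fin n)), ⟪x k i, x l i⟫_ℂ :
        Matrix (Fin N) (Fin N) ℂ) = Matrix.gram ℂ (fun _ : Fin N => (1 : ℂ)) := by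
      ext k l
      simp [Matrix.gram_apply]
    rw [e]
    exact h
  | insert a s ha ih =>
    have e : (Matrix.of fun k l => ∏ i ∈ insert a s, ⟪x k i, x l i⟫_ℂ :
        Matrix (Fin N) (Fin N) ℂ) = (Matrix.gram ℂ (fun k => x k a)) ⊙
          (Matrix.of fun k l => ∏ i ∈ s, ⟪x k i, x l i⟫_ℂ) := by
      ext k l
      simp [Finset.prod_insert ha, Matrix.gram_apply]
    rw [e]
    exact (Matrix.posSemidef_gram ℂ (fun k => x k a)).hadamard ih

open scoped ComplexOrder in
theorem algInner_self_nonneg (t : AlgTensorPower H n) : 0 ≤ RCLike.re ⟪t, t⟫_ℂ := by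
  obtain ⟨N, c, x, rfl⟩ := exists_sum_pure t
  have h := (Matrix.posSemidef_iff_dotProduct_mulVec.1
    (posSemidef_prod_gram x Finset.univ)).2 c
  have e : ⟪∑ k, c k • pure (x k), ∑ k, c k • pure (x k)⟫_ℂ =
      star c ⬝ᵥ (Matrix.of fun k l => ∏ i, ⟪x k i, x l i⟫_ℂ : Matrix (Fin N) (Fin N) ℂ).mulVec c := by
    have hl : ∀ (t : AlgTensorPower H n),
        ⟪∑ k, c k • pure (x k), t⟫_ℂ = ∑ k, conj (c k) * ⟪pure (x k), t⟫_ℂ := by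
      intro t
      refine (map_sum (AddMonoidHom.mk' (fun s : AlgTensorPower H n => ⟪s, t⟫_ℂ)
        fun a b => algInner_add_left a b t) (fun k => c k • pure (x k)) Finset.univ).trans ?_
      exact Finset.sum_congr rfl fun k _ => algInner_smul_left _ _ _
    rw [hl]
    simp only [dotProduct, Matrix.mulVec, Matrix.of_apply, Pi.star_apply]
    refine Finset.sum_congr rfl fun k _ => ?_
    congr 1
    simp only [algInner_def, map_sum, map_smul, smul_eq_mul]
    refine Finset.sum_congr rfl fun l _ => ?_
    rw [← algInner_def, inner_pure_pure, mul_comm]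
  rw [e]
  exact (Complex.le_def.1 h).1

instance : PreInnerProductSpace.Core ℂ (AlgTensorPower H n) where
  conj_inner_symm := algInner_conj_symm
  re_inner_nonneg := algInner_self_nonneg
  add_left := algInner_add_left
  smul_left := algInner_smul_left

instance : SeminormedAddCommGroup (AlgTensorPower H n) :=
  InnerProductSpace.Core.toSeminormedAddCommGroup (𝕜 := ℂ)

instance : InnerProductSpace ℂ (AlgTensorPower H n) := .ofCore _

variable (H n) in
/-- The Hilbert space tensor power `H^{⊗n}`: the completion of the algebraic one. -/
abbrev TensorPower : Type _ := Completion (AlgTensorPower H n)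

/-- A linear automorphism of the algebraic tensor power that preserves the inner products of
decomposable tensors is isometric. -/
def algIsometry (e : AlgTensorPower H n ≃ₗ[ℂ] AlgTensorPower H n)
    (he : ∀ x y : Fin n → H, ⟪e (pure x), e (pure y)⟫_ℂ = ⟪pure x, pure y⟫_ℂ) :
    AlgTensorPower H n ≃ₗᵢ[ℂ] AlgTensorPower H n where
  toLinearEquiv := e
  norm_map' t := by
    have h : ∀ s t : AlgTensorPower H n, ⟪e s, e t⟫_ℂ = ⟪s, t⟫_ℂ := by
      intro s t
      induction s using algTensor_induction with
      | smul_pure c x =>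
        induction t using algTensor_induction with
        | smul_pure d y => simp [inner_smul_left, inner_smul_right, he]
        | add t t' h h' => simp only [map_add, inner_add_right, h, h']
      | add s s' h h' => simp only [map_add, inner_add_left, h, h']
    rw [@norm_eq_sqrt_re_inner ℂ, @norm_eq_sqrt_re_inner ℂ, h]

/-- The extension of a linear isometric automorphism to the completion. -/
def completionMap {E : Type*} [SeminormedAddCommGroup E] [InnerProductSpace ℂ E]
    (e : E ≃ₗᵢ[ℂ] E) : Completion E ≃ₗᵢ[ℂ] Completion E where
  toFun := Completion.map e
  invFun := Completion.map e.symm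
  map_add' s t := by
    induction s, t using Completion.induction_on₂ with
    | hp =>
      have h : Continuous (Completion.map e) := Completion.continuous_map
      exact isClosed_eq (h.comp continuous_add)
        (Continuous.add (f := fun p : Completion E × Completion E => Completion.map e p.1)
          (h.comp continuous_fst) (h.comp continuous_snd))
    | ih s t =>
      rw [← Completion.coe_add, Completion.map_coe e.isometry.uniformContinuous,
        Completion.map_coe e.isometry.uniformContinuous,
        Completion.map_coe e.isometry.uniformContinuous, e.map_add, Completion.coe_add]
  map_smul' c t := by
    induction t using Completion.induction_on with
    | hp =>
      have h : Continuous (Completion.map e) := Completion.continuous_map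
      exact isClosed_eq (h.comp (continuous_const_smul c))
        (continuous_const_smul (RingHom.id ℂ c) |>.comp h)
    | ih t =>
      rw [← Completion.coe_smul, Completion.map_coe e.isometry.uniformContinuous,
        Completion.map_coe e.isometry.uniformContinuous, e.map_smul, Completion.coe_smul,
        RingHom.id_apply]
  left_inv t := by
    induction t using Completion.induction_on with
    | hp =>
      exact isClosed_eq (Completion.continuous_map.comp Completion.continuous_map) continuous_id
    | ih t =>
      simp [Completion.map_coe e.isometry.uniformContinuous,
        Completion.map_coe e.symm.isometry.uniformContinuous]
  right_inv t := by
    induction t using Completion.induction_on with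
    | hp =>
      exact isClosed_eq (Completion.continuous_map.comp Completion.continuous_map) continuous_id
    | ih t =>
      simp [Completion.map_coe e.isometry.uniformContinuous,
        Completion.map_coe e.symm.isometry.uniformContinuous]
  norm_map' t := by
    induction t using Completion.induction_on with
    | hp => exact isClosed_eq Completion.continuous_map.norm continuous_norm
    | ih t =>
      change ‖Completion.map e (t : Completion E)‖ = _
      rw [Completion.map_coe e.isometry.uniformContinuous, Completion.norm_coe,
        Completion.norm_coe, e.norm_map]

theorem completionMap_coe {E : Type*} [SeminormedAddCommGroup E] [InnerProductSpace ℂ E]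
    (e : E ≃ₗᵢ[ℂ] E) (t : E) : completionMap e (t : Completion E) = (e t : E) :=
  Completion.map_coe e.isometry.uniformContinuous t

/-- `U^{⊗n}` on the algebraic tensor power, as a linear map. -/
def algTensorPowLin (U : H ≃ₗᵢ[ℂ] H) (n : ℕ) : AlgTensorPower H n ≃ₗ[ℂ] AlgTensorPower H n :=
  PiTensorProduct.congr fun _ => U.toLinearEquiv

theorem algTensorPowLin_pure (U : H ≃ₗᵢ[ℂ] H) (x : Fin n → H) :
    algTensorPowLin U n (pure x) = pure fun i => U (x i) :=
  PiTensorProduct.congr_tprod _ x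

/-- `U^{⊗n}` on the algebraic tensor power, `x₁ ⊗ ⋯ ⊗ xₙ ↦ U x₁ ⊗ ⋯ ⊗ U xₙ`. -/
def algTensorPow (U : H ≃ₗᵢ[ℂ] H) (n : ℕ) : AlgTensorPower H n ≃ₗᵢ[ℂ] AlgTensorPower H n :=
  algIsometry (algTensorPowLin U n) fun x y => by
    rw [algTensorPowLin_pure, algTensorPowLin_pure]
    simp [inner_pure_pure]

theorem algTensorPow_pure (U : H ≃ₗᵢ[ℂ] H) (x : Fin n → H) :
    algTensorPow U n (pure x) = pure fun i => U (x i) :=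
  algTensorPowLin_pure U x

/-- The permutation of the tensor factors on the algebraic tensor power, as a linear map. -/
def algPermLin (σ : Equiv.Perm (Fin n)) : AlgTensorPower H n ≃ₗ[ℂ] AlgTensorPower H n :=
  PiTensorProduct.reindex ℂ (fun _ => H) σ

theorem algPermLin_pure (σ : Equiv.Perm (Fin n)) (x : Fin n → H) :
    algPermLin σ (pure x) = pure fun i => x (σ.symm i) :=
  PiTensorProduct.reindex_tprod σ x

/-- The permutation of the tensor factors, `x₁ ⊗ ⋯ ⊗ xₙ ↦ x_{σ⁻¹ 1} ⊗ ⋯ ⊗ x_{σ⁻¹ n}`, on the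
algebraic tensor power. -/
def algPerm (σ : Equiv.Perm (Fin n)) : AlgTensorPower H n ≃ₗᵢ[ℂ] AlgTensorPower H n :=
  algIsometry (algPermLin σ) fun x y => by
    rw [algPermLin_pure, algPermLin_pure, inner_pure_pure, inner_pure_pure]
    exact Equiv.prod_comp σ.symm fun i => ⟪x i, y i⟫_ℂ

theorem algPerm_pure (σ : Equiv.Perm (Fin n)) (x : Fin n → H) :
    algPerm σ (pure x) = pure fun i => x (σ.symm i) :=
  algPermLin_pure σ x

/-- The unitary operator `U^{⊗n}` on `H^{⊗n}`. -/
def tensorPow (U : H ≃ₗᵢ[ℂ] H) (n : ℕ) : TensorPower H n ≃ₗᵢ[ℂ] TensorPower H n :=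
  completionMap (algTensorPow U n)

/-- The action of the permutations of the factors on `H^{⊗n}`. -/
def perm (σ : Equiv.Perm (Fin n)) : TensorPower H n ≃ₗᵢ[ℂ] TensorPower H n :=
  completionMap (algPerm σ)

variable (H n) in
/-- The symmetric tensor power `H^{⊙n}`: the tensors in `H^{⊗n}` that are fixed by all
permutations of the factors. -/
def SymPower : Submodule ℂ (TensorPower H n) where
  carrier := {t | ∀ σ : Equiv.Perm (Fin n), perm σ t = t}
  add_mem' hs ht σ := by rw [map_add, hs σ, ht σ]
  zero_mem' σ := map_zero _
  smul_mem' c t ht σ := by rw [map_smul, ht σ]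

theorem isClosed_symPower : IsClosed (SymPower H n : Set (TensorPower H n)) := by
  have : (SymPower H n : Set (TensorPower H n)) =
      ⋂ σ : Equiv.Perm (Fin n), {t | perm σ t = t} := by
    ext t; simp [SymPower]
  rw [this]
  exact isClosed_iInter fun σ => isClosed_eq (perm σ).continuous continuous_id

instance : CompleteSpace (SymPower H n) :=
  isClosed_symPower.completeSpace_coe

theorem perm_tensorPow (U : H ≃ₗᵢ[ℂ] H) (σ : Equiv.Perm (Fin n)) (t : TensorPower H n) :
    perm σ (tensorPow U n t) = tensorPow U n (perm σ t) := by
  induction t using Completion.induction_on with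
  | hp =>
    exact isClosed_eq ((perm σ).continuous.comp (tensorPow U n).continuous)
      ((tensorPow U n).continuous.comp (perm σ).continuous)
  | ih t =>
    simp only [perm, tensorPow, completionMap_coe]
    congr 1
    induction t using algTensor_induction with
    | smul_pure c x => simp only [map_smul, algPerm_pure, algTensorPow_pure]
    | add s t hs ht => simp only [map_add, hs, ht]

/-- The symmetric tensor power `U^{⊙n}`: the restriction of `U^{⊗n}` to `H^{⊙n}`. -/
def symPow (U : H ≃ₗᵢ[ℂ] H) (n : ℕ) : SymPower H n ≃ₗᵢ[ℂ] SymPower H n where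
  toFun t := ⟨tensorPow U n t, fun σ => by rw [perm_tensorPow, t.2 σ]⟩
  invFun t := ⟨(tensorPow U n).symm t, fun σ => by
    rw [LinearIsometryEquiv.eq_symm_apply, ← perm_tensorPow,
      LinearIsometryEquiv.apply_symm_apply, t.2 σ]⟩
  map_add' s t := by ext; simp
  map_smul' c t := by ext; simp
  left_inv t := by ext; simp
  right_inv t := by ext; simp
  norm_map' t := (tensorPow U n).norm_map t

/-- `Exp U = ⨁_{n ≥ 1} U^{⊙n}`. -/
def Exp (U : H ≃ₗᵢ[ℂ] H) :
    lp (fun n : ℕ+ => SymPower H n) 2 ≃ₗᵢ[ℂ] lp (fun n : ℕ+ => SymPower H n) 2 :=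
  directSum fun n : ℕ+ => symPow U n

/-- The operator `V = ⨁_{m ∈ M} m (z_m U)`, where `m (z_m U)` is the direct sum of `m` copies
of `z_m U`. -/
def sumOfCopies (U : H ≃ₗᵢ[ℂ] H) (z : ℕ+ → Circle) (M : Set ℕ+) :
    lp (fun _ : (Σ m : M, Fin (m : ℕ+)) => H) 2 ≃ₗᵢ[ℂ]
      lp (fun _ : (Σ m : M, Fin (m : ℕ+)) => H) 2 :=
  directSum fun p => rotate (z p.1) U

end Tensor

end SpectralMult

end

noncomputable section

namespace SpectralMult

open MeasureTheory UniformSpace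
open scoped ComplexInnerProductSpace ComplexConjugate TensorProduct InnerProductSpace ENNReal

/-! ### Spectral measures, the `L²` model of a cyclic subspace, and spectral subspaces. -/

section Basics

variable {H : Type*} [NormedAddCommGroup H] [InnerProductSpace ℂ H]
variable {K : Type*} [NormedAddCommGroup K] [InnerProductSpace ℂ K]

/-! ### Powers of unitary operators -/

/-! Let `x` be a cyclic vector of `U` with spectral measure `σ`, and write `z m = exp (2πi θ m)`.
The summand of degree 1 of `Exp V` is `V` itself; it consists of `m` orthogonal cyclic subspaces
with measure `σ` translated by `θ m`, for each `m ∈ M`. The summands of degree `n ≥ 2` are governed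
by the measures `σ^{*n}` translated by sums `θ (q 1) + ⋯ + θ (q n)`.

Three facts therefore suffice (`spectralMultiplicities_exp_sumRotate`): the translates of `σ` by the
`θ m` are mutually singular; they are singular to all measures of higher degree; and every measure
that is not singular to one of higher degree dominates a nonzero measure carried by as many
orthogonal cyclic subspaces as desired. The multiplicity is then `m` on the translate by `θ m` and
infinite elsewhere. The criterion `spectralMultiplicities_eq` derives this without a multiplicity
function, by comparing the sizes of orthogonal families of equal spectral measure
(`IsCopies.card_le`) and by taking maximal families (`exists_maximal_copies`).

In case (a) the measures of higher degree are absolutely continuous, hence singular to the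
translates of `σ`. Let `τ` be one translate of `σ`. The common zero set of the densities of
`τ^{*n}`, for `n` large, is invariant under translation by `τ`-almost every point. As `τ` has no
atoms, some such point has infinite order, and ergodicity of its translation makes the zero set null
(`exists_convPow_not_mutuallySingular`). Any nonzero absolutely continuous measure thus dominates
one that lies below many powers `τ^{*n}` at once, and different degrees of `Exp V` are orthogonal.

In case (b) the combination `∑ θ (q i) - θ m` is uniformly distributed for random `θ`, and almost
every translate of a finite measure is singular to a given singular one
(`ae_translate_mutuallySingular`); this separates degree 1 from the higher degrees. The copies come
from the infinite multiplicity of `U^{⊙n}`, transported into `Exp V` by symmetrized embeddings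
(`symEmb`). -/

theorem eq_zpow_apply_of_succ (U : H ≃ₗᵢ[ℂ] H) (a : ℤ → H) (ha : ∀ k, a (k + 1) = U (a k))
    (k : ℤ) : a k = (U ^ k) (a 0) := by
  induction k using Int.induction_on with
  | zero => simp
  | succ n ih => rw [ha, ih, add_comm, zpow_add, zpow_one]; rfl
  | pred n ih =>
    apply U.injective
    rw [← ha, sub_add_cancel, ih, sub_eq_neg_add, zpow_add, zpow_neg_one]
    exact (U.apply_symm_apply _).symm

theorem zpow_add_apply (U : H ≃ₗᵢ[ℂ] H) (k l : ℤ) (x : H) :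
    (U ^ (k + l)) x = (U ^ k) ((U ^ l) x) := by
  rw [zpow_add]; rfl

theorem semiconj_zpow {U : H ≃ₗᵢ[ℂ] H} {V : K ≃ₗᵢ[ℂ] K} {φ : H → K}
    (h : ∀ x, φ (U x) = V (φ x)) (k : ℤ) (x : H) : φ ((U ^ k) x) = (V ^ k) (φ x) := by
  refine (eq_zpow_apply_of_succ V (fun k => φ ((U ^ k) x)) (fun k => ?_) k).trans (by simp)
  rw [add_comm, zpow_add_apply, zpow_one, h]

theorem inner_zpow_left (U : H ≃ₗᵢ[ℂ] H) (k : ℤ) (x y : H) :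
    ⟪(U ^ k) x, y⟫_ℂ = ⟪x, (U ^ (-k)) y⟫_ℂ := by
  rw [← (U ^ k).inner_map_map x, ← zpow_add_apply, add_neg_cancel, zpow_zero]; rfl

theorem inner_zpow_zpow (U : H ≃ₗᵢ[ℂ] H) (k l : ℤ) (x y : H) :
    ⟪(U ^ k) x, (U ^ l) y⟫_ℂ = ⟪x, (U ^ (l - k)) y⟫_ℂ := by
  rw [inner_zpow_left, ← zpow_add_apply, neg_add_eq_sub]

/-! ### Isometries from Gram matrices -/

theorem norm_linearCombination_eq_of_gram {ι : Type*} {e : ι → H} {f : ι → K}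
    (h : ∀ i j, ⟪e i, e j⟫_ℂ = ⟪f i, f j⟫_ℂ) (c : ι →₀ ℂ) :
    ‖Finsupp.linearCombination ℂ f c‖ = ‖Finsupp.linearCombination ℂ e c‖ := by
  rw [@norm_eq_sqrt_re_inner ℂ, @norm_eq_sqrt_re_inner ℂ]
  congr 2
  simp only [Finsupp.linearCombination_apply, Finsupp.sum, inner_sum, sum_inner, inner_smul_left,
    inner_smul_right, h]

/-- The Gram matrix determines the norm of every finite combination, so `∑ cᵢ eᵢ ↦ ∑ cᵢ fᵢ` extends
isometrically from a dense subspace. Both the `L²` models and the embeddings of tensor powers are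
built this way. -/
theorem exists_linearIsometry_of_gram [CompleteSpace K] {ι : Type*} {e : ι → H} {f : ι → K}
    (he : (Submodule.span ℂ (Set.range e)).topologicalClosure = ⊤)
    (h : ∀ i j, ⟪e i, e j⟫_ℂ = ⟪f i, f j⟫_ℂ) :
    ∃ W : H →ₗᵢ[ℂ] K, ∀ i, W (e i) = f i := by
  have hd : DenseRange (Finsupp.linearCombination ℂ e) := by
    have h1 : (Set.range (Finsupp.linearCombination ℂ e)) =
        (Submodule.span ℂ (Set.range e) : Set H) := by
      rw [← Finsupp.range_linearCombination]; rfl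
    rw [DenseRange, h1]
    exact Submodule.dense_iff_topologicalClosure_eq_top.2 he
  have hn := norm_linearCombination_eq_of_gram h
  let T := (Finsupp.linearCombination ℂ f).extendOfNorm (Finsupp.linearCombination ℂ e)
  have hT : ∀ c, T (Finsupp.linearCombination ℂ e c) = Finsupp.linearCombination ℂ f c :=
    fun c => LinearMap.extendOfNorm_eq hd ⟨1, fun x => by rw [one_mul, hn]⟩ c
  refine ⟨⟨T, fun x => ?_⟩, fun i => ?_⟩
  · change ‖T x‖ = ‖x‖
    induction x using hd.induction_on with
    | hp => exact isClosed_eq T.continuous.norm continuous_norm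
    | ih c => rw [hT, hn]
  · simpa using hT (Finsupp.single i 1)

/-! ### Uniqueness of spectral measures -/

/-- Trigonometric polynomials are uniformly dense in the continuous functions, and these determine a
finite measure. -/
theorem measure_ext_of_fourier {μ ν : Measure UnitAddCircle} [IsFiniteMeasure μ]
    [IsFiniteMeasure ν] (h : ∀ k : ℤ, ∫ t, fourier k t ∂μ = ∫ t, fourier k t ∂ν) : μ = ν := by
  have key : ∀ f : C(UnitAddCircle, ℂ), ∫ t, f t ∂μ = ∫ t, f t ∂ν := by
    intro f
    have hint : ∀ (ρ : Measure UnitAddCircle) [IsFiniteMeasure ρ] (g : C(UnitAddCircle, ℂ)),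
        Integrable g ρ := fun ρ _ g =>
      g.continuous.integrable_of_hasCompactSupport (HasCompactSupport.of_compactSpace g)
    have hc : ∀ (ρ : Measure UnitAddCircle) [IsFiniteMeasure ρ],
        Continuous fun g : C(UnitAddCircle, ℂ) => ∫ t, g t ∂ρ := by
      intro ρ _
      refine (ContinuousLinearMap.continuous (LinearMap.mkContinuous
        ({ toFun := fun g : C(UnitAddCircle, ℂ) => ∫ t, g t ∂ρ
           map_add' := fun g g' => integral_add (hint ρ g) (hint ρ g')
           map_smul' := fun c g => integral_smul c g } : C(UnitAddCircle, ℂ) →ₗ[ℂ] ℂ) (ρ.real Set.univ) fun g => ?_))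
      rw [mul_comm]
      exact norm_integral_le_of_norm_le_const (Filter.Eventually.of_forall g.norm_coe_le_norm)
    have hf : f ∈ (Submodule.span ℂ (Set.range (fourier (T := 1)))).topologicalClosure := by
      rw [span_fourier_closure_eq_top]; trivial
    have hcl : IsClosed {g : C(UnitAddCircle, ℂ) | ∫ t, g t ∂μ = ∫ t, g t ∂ν} :=
      isClosed_eq (hc μ) (hc ν)
    refine closure_minimal (fun g hg => ?_) hcl hf
    induction hg using Submodule.span_induction with
    | mem g hg => obtain ⟨k, rfl⟩ := hg; exact h k
    | zero => simp
    | add g g' _ _ h1 h2 =>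
      have := congrArg₂ (· + ·) h1 h2
      simp only [← integral_add (hint μ g) (hint μ g'), ← integral_add (hint ν g) (hint ν g')]
        at this
      exact this
    | smul c g _ h1 =>
      simp only [Set.mem_ofPred_eq, ContinuousMap.smul_apply, smul_eq_mul, integral_const_mul] at h1 ⊢
      rw [h1]
  refine ext_of_forall_integral_eq_of_IsFiniteMeasure fun f => ?_
  have := key ⟨fun t => ((f t : ℝ) : ℂ), by fun_prop⟩
  simp only [ContinuousMap.coe_mk, integral_complex_ofReal] at this
  exact_mod_cast this

theorem IsSpectralMeasure.unique {U : H ≃ₗᵢ[ℂ] H} {x : H} {μ ν : Measure UnitAddCircle}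
    (hμ : IsSpectralMeasure U x μ) (hν : IsSpectralMeasure U x ν) : μ = ν := by
  have := hμ.1
  have := hν.1
  exact measure_ext_of_fourier fun k => by rw [hμ.2, hν.2]

/-! ### Existence of spectral measures -/

/-- The spectrum of a unitary lies on the circle, so functions on `ℝ/ℤ` can be pulled back to it and
fed into the continuous functional calculus. -/
theorem exists_continuous_calculus [CompleteSpace H] (U : H ≃ₗᵢ[ℂ] H) :
    ∃ Ψ : C(UnitAddCircle, ℂ) →⋆ₐ[ℂ] (H →L[ℂ] H), ∀ (k : ℤ) (x : H),
      Ψ (fourier k) x = (U ^ k) x := by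
  let u : unitary (H →L[ℂ] H) := Unitary.linearIsometryEquiv.symm U
  have hu : ∀ x, (u : H →L[ℂ] H) x = U x := fun x => rfl
  have hn : IsStarNormal (u : H →L[ℂ] H) := inferInstance
  have hs : ∀ z : spectrum ℂ (u : H →L[ℂ] H), (z : ℂ) ∈ Metric.sphere (0 : ℂ) 1 := fun z =>
    Unitary.spectrum_subset_circle u z.2
  let φ : C(spectrum ℂ (u : H →L[ℂ] H), UnitAddCircle) :=
    ⟨fun z => (AddCircle.homeomorphCircle one_ne_zero).symm ⟨z, by
      have := hs z; rwa [Submonoid.unitSphere] ⟩, by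
      refine (AddCircle.homeomorphCircle one_ne_zero).symm.continuous.comp ?_
      exact Continuous.subtype_mk continuous_subtype_val _⟩
  have hφ : ∀ z, ((φ z).toCircle : ℂ) = z := by
    intro z
    have := (AddCircle.homeomorphCircle (T := (1 : ℝ)) one_ne_zero).apply_symm_apply
      ⟨z, by have := hs z; rwa [Submonoid.unitSphere]⟩
    rw [AddCircle.homeomorphCircle_apply] at this
    exact congrArg Subtype.val this
  let Ψ : C(UnitAddCircle, ℂ) →⋆ₐ[ℂ] (H →L[ℂ] H) :=
    (cfcHom hn).comp (ContinuousMap.compStarAlgHom' ℂ ℂ φ)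
  have h1 : Ψ (fourier 1) = u := by
    have : (ContinuousMap.compStarAlgHom' ℂ ℂ φ) (fourier 1) =
        (ContinuousMap.id ℂ).restrict (spectrum ℂ (u : H →L[ℂ] H)) := by
      ext z
      simp [hφ]
    exact (congrArg (cfcHom hn) this).trans (cfcHom_id hn)
  refine ⟨Ψ, fun k x => ?_⟩
  have h0 : Ψ (fourier 0) x = x := by
    have : (fourier 0 : C(UnitAddCircle, ℂ)) = 1 := by ext; simp
    rw [this, map_one]; rfl
  have := eq_zpow_apply_of_succ U (fun k => Ψ (fourier k) x) (fun k => ?_) k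
  · simpa only [h0] using this
  · have : (fourier (k + 1) : C(UnitAddCircle, ℂ)) = fourier 1 * fourier k := by
      ext t
      rw [add_comm]
      exact fourier_add
    simp only [this, map_mul, h1]
    rfl

/-- Riesz–Markov applied to the functional `f ↦ ⟪x, Ψ f x⟫` on real continuous functions. -/
theorem exists_isSpectralMeasure [CompleteSpace H] (U : H ≃ₗᵢ[ℂ] H) (x : H) :
    ∃ μ, IsSpectralMeasure U x μ := by
  obtain ⟨Ψ, hΨ⟩ := exists_continuous_calculus U
  let c : C(UnitAddCircle, ℝ) → C(UnitAddCircle, ℂ) := fun f => ⟨fun t => (f t : ℂ), by fun_prop⟩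
  have hc : ∀ f g, c (f * g) = c f * c g := fun f g => by ext; simp [c]
  have hcs : ∀ f, star (c f) = c f := fun f => by ext; simp [c]
  have hsa : ∀ f y z, ⟪Ψ (c f) y, z⟫_ℂ = ⟪y, Ψ (c f) z⟫_ℂ := by
    intro f y z
    conv_rhs => rw [← hcs f, map_star, ContinuousLinearMap.star_eq_adjoint]
    rw [ContinuousLinearMap.adjoint_inner_right]
  let L : CompactlySupportedContinuousMap UnitAddCircle ℝ →ₗ[ℝ] ℝ :=
    { toFun := fun f => (⟪x, Ψ (c f.toContinuousMap) x⟫_ℂ).re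
      map_add' := fun f g => by
        have : c (f + g).toContinuousMap = c f.toContinuousMap + c g.toContinuousMap := by
          ext; simp [c]
        rw [this, map_add, add_apply, inner_add_right, Complex.add_re]
      map_smul' := fun a f => by
        have : c (a • f).toContinuousMap = (a : ℂ) • c f.toContinuousMap := by
          ext; simp [c]
        rw [this, map_smul, smul_apply, inner_smul_right]
        simp }
  have hL : ∀ f, 0 ≤ f → 0 ≤ L f := by
    intro f hf
    -- With `f = g²` and `Ψ g` self-adjoint, the functional takes the value `‖Ψ g x‖² ≥ 0`.
    let g : C(UnitAddCircle, ℝ) := ⟨fun t => Real.sqrt (f t), by fun_prop⟩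
    have hg : f.toContinuousMap = g * g := by
      ext t
      exact (Real.mul_self_sqrt (hf t)).symm
    change 0 ≤ (⟪x, Ψ (c f.toContinuousMap) x⟫_ℂ).re
    rw [hg, hc, map_mul, mul_apply_eq_comp, ← hsa]
    exact inner_self_nonneg (𝕜 := ℂ)
  let Λ := PositiveLinearMap.mk₀ L hL
  let μ := RealRMK.rieszMeasure Λ
  have hfin : IsFiniteMeasure μ := by
    refine ⟨?_⟩
    exact isCompact_univ.measure_lt_top
  have hint : ∀ f : C(UnitAddCircle, ℝ), ((∫ t, f t ∂μ : ℝ) : ℂ) = ⟪x, Ψ (c f) x⟫_ℂ := by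
    intro f
    have h1 := RealRMK.integral_rieszMeasure Λ
      (CompactlySupportedContinuousMap.continuousMapEquiv f)
    have h2 : ∫ t, f t ∂μ = (⟪x, Ψ (c f) x⟫_ℂ).re := h1
    rw [h2]
    have h3 : conj ⟪x, Ψ (c f) x⟫_ℂ = ⟪x, Ψ (c f) x⟫_ℂ := by rw [inner_conj_symm, hsa]
    exact Complex.conj_eq_iff_re.1 h3
  refine ⟨μ, hfin, fun k => ?_⟩
  have hci : Integrable (fun t => fourier k t) μ :=
    (fourier k).continuous.integrable_of_hasCompactSupport (HasCompactSupport.of_compactSpace _)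
  let fr : C(UnitAddCircle, ℝ) := ⟨fun t => (fourier k t).re, by fun_prop⟩
  let fi : C(UnitAddCircle, ℝ) := ⟨fun t => (fourier k t).im, by fun_prop⟩
  have hk : fourier k = c fr + Complex.I • c fi := by
    ext t
    simp only [c, fr, fi, ContinuousMap.add_apply, ContinuousMap.smul_apply, ContinuousMap.coe_mk,
      smul_eq_mul]
    rw [mul_comm]
    exact (Complex.re_add_im _).symm
  rw [← hΨ, hk, map_add, map_smul, add_apply, smul_apply,
    inner_add_right, inner_smul_right, ← hint, ← hint, ← hk, ← integral_re_add_im hci, mul_comm]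
  rfl

end Basics

instance haveLebesgueDecomposition_circle (μ ρ : Measure UnitAddCircle) [IsFiniteMeasure μ]
    [IsFiniteMeasure ρ] : ρ.HaveLebesgueDecomposition μ :=
  Measure.haveLebesgueDecomposition_of_sigmaFinite ρ μ

section CyclicModel

variable {H : Type*} [NormedAddCommGroup H] [InnerProductSpace ℂ H]
variable {μ : Measure UnitAddCircle}

/-! ### The model `L²(μ)` of a cyclic subspace -/

theorem norm_fourier_apply (k : ℤ) (t : UnitAddCircle) : ‖fourier k t‖ = 1 := Circle.norm_coe _

theorem memLp_fourier_mul (k : ℤ) (f : Lp ℂ 2 μ) : MemLp (fun t => fourier k t * f t) 2 μ := by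
  refine (Lp.memLp f).of_le ((fourier k).continuous.aestronglyMeasurable.mul
    (Lp.aestronglyMeasurable f)) (Filter.Eventually.of_forall fun t => ?_)
  rw [norm_mul, norm_fourier_apply, one_mul]

variable [IsFiniteMeasure μ]

variable (μ) in
/-- The character `fourier k` as an element of `L²(μ)`. -/
def charLp (k : ℤ) : Lp ℂ 2 μ := ContinuousMap.toLp 2 μ ℂ (fourier k)

theorem coeFn_charLp (k : ℤ) : charLp μ k =ᵐ[μ] fourier k := ContinuousMap.coeFn_toLp μ _

theorem span_charLp_closure :
    (Submodule.span ℂ (Set.range (charLp μ))).topologicalClosure = ⊤ := by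
  have h1 : Set.range (charLp μ) =
      (ContinuousMap.toLp 2 μ ℂ : C(UnitAddCircle, ℂ) →L[ℂ] Lp ℂ 2 μ) ''
        Set.range (fourier (T := 1)) := by
    rw [← Set.range_comp]; rfl
  have h2 := (ContinuousMap.toLp_denseRange ℂ μ (p := 2) ℂ (by simp)).topologicalClosure_map_submodule
    (s := Submodule.span ℂ (Set.range (fourier (T := 1)))) span_fourier_closure_eq_top
  rw [h1]
  rwa [Submodule.map_span] at h2

variable (μ) in
/-- Multiplication by the character `fourier k` on `L²(μ)`. -/
def mulChar (k : ℤ) : Lp ℂ 2 μ →ₗᵢ[ℂ] Lp ℂ 2 μ where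
  toFun f := (memLp_fourier_mul k f).toLp
  map_add' f g := by
    ext
    filter_upwards [(memLp_fourier_mul k (f + g)).coeFn_toLp, (memLp_fourier_mul k f).coeFn_toLp,
      (memLp_fourier_mul k g).coeFn_toLp, Lp.coeFn_add f g, Lp.coeFn_add
      ((memLp_fourier_mul k f).toLp) ((memLp_fourier_mul k g).toLp)] with t h1 h2 h3 h4 h5
    rw [h1, h5, Pi.add_apply, h2, h3, h4, Pi.add_apply, mul_add]
  map_smul' c f := by
    ext
    filter_upwards [(memLp_fourier_mul k (c • f)).coeFn_toLp, (memLp_fourier_mul k f).coeFn_toLp,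
      Lp.coeFn_smul c f, Lp.coeFn_smul c ((memLp_fourier_mul k f).toLp)] with t h1 h2 h4 h5
    rw [h1, RingHom.id_apply, h5, Pi.smul_apply, h2, h4, Pi.smul_apply, smul_eq_mul, smul_eq_mul,
      mul_left_comm]
  norm_map' f := by
    change ‖(memLp_fourier_mul k f).toLp‖ = ‖f‖
    rw [Lp.norm_toLp, Lp.norm_def]
    congr 1
    exact eLpNorm_congr_norm_ae (Filter.Eventually.of_forall fun t => by
      rw [norm_mul, norm_fourier_apply, one_mul])

theorem coeFn_mulChar (k : ℤ) (f : Lp ℂ 2 μ) : mulChar μ k f =ᵐ[μ] fun t => fourier k t * f t :=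
  (memLp_fourier_mul k f).coeFn_toLp

theorem mulChar_charLp (k l : ℤ) : mulChar μ k (charLp μ l) = charLp μ (k + l) := by
  ext
  filter_upwards [coeFn_mulChar k (charLp μ l), coeFn_charLp (μ := μ) l,
    coeFn_charLp (μ := μ) (k + l)] with t h1 h2 h3
  rw [h1, h2, h3, fourier_add]

theorem inner_charLp (k : ℤ) (f : Lp ℂ 2 μ) :
    ⟪charLp μ k, f⟫_ℂ = ∫ t, fourier (-k) t * f t ∂μ := by
  rw [L2.inner_def]
  refine integral_congr_ae ?_
  filter_upwards [coeFn_charLp (μ := μ) k] with t h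
  rw [h, RCLike.inner_apply, fourier_neg, mul_comm]

theorem inner_charLp_charLp (k l : ℤ) :
    ⟪charLp μ k, charLp μ l⟫_ℂ = ∫ t, fourier (l - k) t ∂μ := by
  rw [inner_charLp]
  refine integral_congr_ae ?_
  filter_upwards [coeFn_charLp (μ := μ) l] with t h
  rw [h, ← fourier_add, neg_add_eq_sub]

theorem charLp_ext {f g : Lp ℂ 2 μ} (h : ∀ k, ⟪charLp μ k, f⟫_ℂ = ⟪charLp μ k, g⟫_ℂ) : f = g := by
  rw [← sub_eq_zero, ← inner_self_eq_zero (𝕜 := ℂ)]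
  have hm : f - g ∈ (Submodule.span ℂ (Set.range (charLp μ))).topologicalClosure := by
    rw [span_charLp_closure]; trivial
  have hcl : IsClosed {p : Lp ℂ 2 μ | ⟪p, f - g⟫_ℂ = 0} :=
    isClosed_eq (by fun_prop) continuous_const
  refine closure_minimal (fun p hp => ?_) hcl hm
  induction hp using Submodule.span_induction with
  | mem p hp => obtain ⟨k, rfl⟩ := hp; simp [inner_sub_right, h]
  | zero => simp
  | add p q _ _ h1 h2 => simp_all [inner_add_left]
  | smul c p _ h1 => simp_all [inner_smul_left]

/-- The cyclic subspace generated by `x`. -/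
def cyclicSubspace (U : H ≃ₗᵢ[ℂ] H) (x : H) : Submodule ℂ H :=
  (Submodule.span ℂ (Set.range fun k : ℤ => (U ^ k) x)).topologicalClosure

theorem mem_cyclicSubspace (U : H ≃ₗᵢ[ℂ] H) (x : H) (k : ℤ) : (U ^ k) x ∈ cyclicSubspace U x :=
  Submodule.le_topologicalClosure _ (Submodule.subset_span ⟨k, rfl⟩)

/-- A closed subspace that contains the orbit of `x` contains its cyclic subspace. -/
theorem cyclicSubspace_le {U : H ≃ₗᵢ[ℂ] H} {x : H} {S : Submodule ℂ H} (hS : IsClosed (S : Set H))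
    (h : ∀ k : ℤ, (U ^ k) x ∈ S) : cyclicSubspace U x ≤ S :=
  Submodule.topologicalClosure_minimal _ (Submodule.span_le.2 (by rintro _ ⟨k, rfl⟩; exact h k)) hS

/-- Orthogonality of the orbits passes to closed spans, one argument at a time. This keeps families
orthogonal when each vector is replaced by another one of its cyclic subspace. -/
theorem inner_eq_zero_of_mem_cyclicSubspace {U : H ≃ₗᵢ[ℂ] H} {x y x' y' : H}
    (h : ∀ k : ℤ, ⟪x, (U ^ k) y⟫_ℂ = 0) (hx : x' ∈ cyclicSubspace U x)
    (hy : y' ∈ cyclicSubspace U y) (k : ℤ) : ⟪x', (U ^ k) y'⟫_ℂ = 0 := by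
  have h1 : ∀ l : ℤ, ∀ z ∈ cyclicSubspace U y, ⟪(U ^ l) x, z⟫_ℂ = 0 := fun l z hz =>
    cyclicSubspace_le (S := LinearMap.ker (innerSL ℂ ((U ^ l) x)).toLinearMap)
      (innerSL ℂ ((U ^ l) x)).isClosed_ker
      (fun m => by simp [inner_zpow_zpow, h]) hz
  have h2 : ∀ l : ℤ, ∀ z ∈ cyclicSubspace U x, ⟪(U ^ l) y', z⟫_ℂ = 0 := fun l z hz =>
    cyclicSubspace_le (S := LinearMap.ker (innerSL ℂ ((U ^ l) y')).toLinearMap)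
      (innerSL ℂ ((U ^ l) y')).isClosed_ker
      (fun m => by
        simp only [LinearMap.mem_ker, ContinuousLinearMap.coe_coe, innerSL_apply_apply]
        rw [inner_zpow_zpow, ← inner_conj_symm, h1 _ _ hy, map_zero]) hz
  rw [← inner_conj_symm, h2 k x' hx, map_zero]

/-- The characters in `L²(μ)` and the orbit of `x` have the same Gram matrix, with entries the
Fourier coefficients of `μ`. -/
theorem exists_cyclic_model [CompleteSpace H] {U : H ≃ₗᵢ[ℂ] H} {x : H}
    (h : IsSpectralMeasure U x μ) :
    ∃ W : Lp ℂ 2 μ →ₗᵢ[ℂ] H, (∀ k, W (charLp μ k) = (U ^ k) x) ∧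
      (∀ k f, W (mulChar μ k f) = (U ^ k) (W f)) ∧ ∀ f, W f ∈ cyclicSubspace U x := by
  obtain ⟨W, hW⟩ := exists_linearIsometry_of_gram (e := charLp μ) (f := fun k : ℤ => (U ^ k) x)
    span_charLp_closure (fun k l => by rw [inner_charLp_charLp, inner_zpow_zpow, h.2])
  refine ⟨W, hW, fun k f => ?_, fun f => ?_⟩
  · have hm : f ∈ (Submodule.span ℂ (Set.range (charLp μ))).topologicalClosure := by
      rw [span_charLp_closure]; trivial
    have hcl : IsClosed {f : Lp ℂ 2 μ | W (mulChar μ k f) = (U ^ k) (W f)} :=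
      isClosed_eq (W.continuous.comp (mulChar μ k).continuous)
        ((U ^ k).continuous.comp W.continuous)
    refine closure_minimal (fun p hp => ?_) hcl hm
    induction hp using Submodule.span_induction with
    | mem p hp =>
      obtain ⟨l, rfl⟩ := hp
      rw [Set.mem_ofPred_eq, mulChar_charLp, hW, hW, zpow_add_apply]
    | zero => simp
    | add p q _ _ h1 h2 => simp_all
    | smul c p _ h1 => simp_all
  · have hm : f ∈ (Submodule.span ℂ (Set.range (charLp μ))).topologicalClosure := by
      rw [span_charLp_closure]; trivial
    have hcl : IsClosed {f : Lp ℂ 2 μ | W f ∈ cyclicSubspace U x} :=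
      (Submodule.isClosed_topologicalClosure _).preimage W.continuous
    refine closure_minimal (fun p hp => ?_) hcl hm
    induction hp using Submodule.span_induction with
    | mem p hp =>
      obtain ⟨l, rfl⟩ := hp
      rw [Set.mem_ofPred_eq, hW]
      exact mem_cyclicSubspace U x l
    | zero => simp
    | add p q _ _ h1 h2 =>
      rw [Set.mem_ofPred_eq, map_add]
      exact Submodule.add_mem _ h1 h2
    | smul c p _ h1 =>
      rw [Set.mem_ofPred_eq, map_smul]
      exact Submodule.smul_mem _ c h1

/-- In other words, `W f` has spectral measure `|f|² μ`. -/
theorem inner_cyclic_model {U : H ≃ₗᵢ[ℂ] H} {W : Lp ℂ 2 μ →ₗᵢ[ℂ] H}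
    (hW : ∀ k f, W (mulChar μ k f) = (U ^ k) (W f)) (k : ℤ) (f : Lp ℂ 2 μ) :
    ⟪W f, (U ^ k) (W f)⟫_ℂ = ∫ t, (‖f t‖ ^ 2 : ℝ) • fourier k t ∂μ := by
  rw [← hW, W.inner_map_map, L2.inner_def]
  refine integral_congr_ae ?_
  filter_upwards [coeFn_mulChar k f] with t h
  rw [h, RCLike.inner_apply, mul_assoc, RCLike.mul_conj, mul_comm, Complex.real_smul]
  push_cast
  rfl

/-- Every finite measure that is absolutely continuous with respect to the spectral measure of `x`
is the spectral measure of a vector in the cyclic subspace of `x`. -/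
theorem exists_isSpectralMeasure_of_absolutelyContinuous [CompleteSpace H] {U : H ≃ₗᵢ[ℂ] H} {x : H}
    (h : IsSpectralMeasure U x μ) {ρ : Measure UnitAddCircle} [IsFiniteMeasure ρ] (hρ : ρ ≪ μ) :
    ∃ x' ∈ cyclicSubspace U x, IsSpectralMeasure U x' ρ := by
  obtain ⟨W, -, hW, hWx⟩ := exists_cyclic_model h
  have hm : Measurable (ρ.rnDeriv μ) := Measure.measurable_rnDeriv ρ μ
  have hlt : ∀ᵐ t ∂μ, ρ.rnDeriv μ t < ∞ := Measure.rnDeriv_lt_top ρ μ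
  -- The square root of the density of `ρ`, so that `|g|² μ = ρ`; it is square integrable because
  -- `ρ` is finite.
  let g : UnitAddCircle → ℂ := fun t => (Real.sqrt (ρ.rnDeriv μ t).toReal : ℂ)
  have hg : Measurable g := by
    exact Complex.measurable_ofReal.comp (Real.continuous_sqrt.measurable.comp hm.ennreal_toReal)
  have hgn : ∀ t, ‖g t‖ ^ 2 = (ρ.rnDeriv μ t).toReal := fun t => by
    simp only [g, Complex.norm_real, Real.norm_eq_abs, sq_abs]
    exact Real.sq_sqrt ENNReal.toReal_nonneg
  have hgm : MemLp g 2 μ := by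
    rw [memLp_two_iff_integrable_sq_norm hg.aestronglyMeasurable]
    simp only [hgn]
    exact Measure.integrable_toReal_rnDeriv
  refine ⟨W hgm.toLp, hWx _, inferInstance, fun k => ?_⟩
  rw [inner_cyclic_model hW]
  have h1 : ∫ t, (‖hgm.toLp g t‖ ^ 2 : ℝ) • fourier k t ∂μ =
      ∫ t, (ρ.rnDeriv μ t).toReal • fourier k t ∂μ := by
    refine integral_congr_ae ?_
    filter_upwards [hgm.coeFn_toLp] with t ht
    rw [ht, hgn]
  rw [h1]
  have h2 : μ.withDensity (ρ.rnDeriv μ) = ρ := Measure.withDensity_rnDeriv_eq ρ μ hρ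
  conv_lhs => rw [← h2]
  exact integral_withDensity_eq_integral_toReal_smul hm hlt _

/-- Spectral truncation of a vector to a measurable set. -/
theorem exists_truncation [CompleteSpace H] {U : H ≃ₗᵢ[ℂ] H} {x : H}
    (h : IsSpectralMeasure U x μ) {A : Set UnitAddCircle} (hA : MeasurableSet A) :
    ∃ x' ∈ cyclicSubspace U x, IsSpectralMeasure U x' (μ.restrict A) ∧
      IsSpectralMeasure U (x - x') (μ.restrict Aᶜ) := by
  obtain ⟨W, hWe, hW, hWx⟩ := exists_cyclic_model h
  have key : ∀ {B : Set UnitAddCircle} (hB : MeasurableSet B),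
      IsSpectralMeasure U (W (indicatorConstLp 2 hB (measure_ne_top μ B) 1)) (μ.restrict B) := by
    intro B hB
    refine ⟨inferInstance, fun k => ?_⟩
    rw [inner_cyclic_model hW, ← integral_indicator hB]
    refine integral_congr_ae ?_
    filter_upwards [indicatorConstLp_coeFn (p := 2) (hs := hB) (hμs := measure_ne_top μ B)
      (c := (1 : ℂ))] with t ht
    rw [ht]
    by_cases hb : t ∈ B <;> simp [hb]
  refine ⟨_, hWx _, key hA, ?_⟩
  have h0 : x = W (charLp μ 0) := by rw [hWe, zpow_zero]; rfl
  have h1 : x - W (indicatorConstLp 2 hA (measure_ne_top μ A) 1) =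
      W (indicatorConstLp 2 hA.compl (measure_ne_top μ Aᶜ) 1) := by
    conv_lhs => rw [h0, ← map_sub]
    congr 1
    ext
    filter_upwards [indicatorConstLp_coeFn (p := 2) (hs := hA) (hμs := measure_ne_top μ A)
      (c := (1 : ℂ)), indicatorConstLp_coeFn (p := 2) (hs := hA.compl)
      (hμs := measure_ne_top μ Aᶜ) (c := (1 : ℂ)), coeFn_charLp (μ := μ) 0, Lp.coeFn_sub
      (charLp μ 0) (indicatorConstLp 2 hA (measure_ne_top μ A) (1 : ℂ))] with t h1 h2 h3 h4
    rw [h4, Pi.sub_apply, h1, h2, h3, fourier_zero]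
    by_cases hb : t ∈ A <;> simp [hb]
  rw [h1]
  exact key hA.compl

end CyclicModel

section SpectralSubspaces

variable {H : Type*} [NormedAddCommGroup H] [InnerProductSpace ℂ H]

theorem integrable_fourier (μ : Measure UnitAddCircle) [IsFiniteMeasure μ] (k : ℤ) :
    Integrable (fun t => fourier k t) μ :=
  (fourier k).continuous.integrable_of_hasCompactSupport (HasCompactSupport.of_compactSpace _)

/-! ### Operations on spectral measures -/

theorem IsSpectralMeasure.zpow {U : H ≃ₗᵢ[ℂ] H} {x : H} {μ : Measure UnitAddCircle}
    (h : IsSpectralMeasure U x μ) (l : ℤ) : IsSpectralMeasure U ((U ^ l) x) μ := by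
  refine ⟨h.1, fun k => ?_⟩
  rw [h.2, inner_zpow_left, ← zpow_add_apply, ← zpow_add_apply]
  congr 3
  ring

theorem IsSpectralMeasure.smul {U : H ≃ₗᵢ[ℂ] H} {x : H} {μ : Measure UnitAddCircle}
    (h : IsSpectralMeasure U x μ) (c : ℂ) :
    IsSpectralMeasure U (c • x) (ENNReal.ofReal (‖c‖ ^ 2) • μ) := by
  have := h.1
  refine ⟨μ.smul_finite ENNReal.ofReal_ne_top, fun k => ?_⟩
  rw [integral_smul_measure, h.2, map_smul, inner_smul_left, inner_smul_right,
    ENNReal.toReal_ofReal (by positivity), ← mul_assoc, RCLike.conj_mul, Complex.real_smul]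
  push_cast
  rfl

theorem IsSpectralMeasure.add {U : H ≃ₗᵢ[ℂ] H} {x y : H} {μ ν : Measure UnitAddCircle}
    (hx : IsSpectralMeasure U x μ) (hy : IsSpectralMeasure U y ν)
    (h : ∀ k : ℤ, ⟪x, (U ^ k) y⟫_ℂ = 0) : IsSpectralMeasure U (x + y) (μ + ν) := by
  have := hx.1
  have := hy.1
  refine ⟨inferInstance, fun k => ?_⟩
  have h' : ⟪y, (U ^ k) x⟫_ℂ = 0 := by
    rw [← inner_conj_symm, inner_zpow_left, h, map_zero]
  rw [integral_add_measure (integrable_fourier _ _) (integrable_fourier _ _), hx.2, hy.2, map_add,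
    inner_add_left, inner_add_right, inner_add_right, h, h']
  ring

theorem IsSpectralMeasure.measure_univ {U : H ≃ₗᵢ[ℂ] H} {x : H} {μ : Measure UnitAddCircle}
    (h : IsSpectralMeasure U x μ) : μ Set.univ = ENNReal.ofReal (‖x‖ ^ 2) := by
  have := h.1
  have h0 := h.2 0
  simp only [fourier_zero, integral_const, zpow_zero] at h0
  change _ = ⟪x, x⟫_ℂ at h0
  rw [inner_self_eq_norm_sq_to_K] at h0
  have h1 : μ.real Set.univ = ‖x‖ ^ 2 := by
    have : ((μ.real Set.univ : ℝ) : ℂ) = ((‖x‖ ^ 2 : ℝ) : ℂ) := by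
      simpa using h0
    exact_mod_cast this
  rw [← h1, ofReal_measureReal]

theorem IsSpectralMeasure.eq_zero_iff {U : H ≃ₗᵢ[ℂ] H} {x : H} {μ : Measure UnitAddCircle}
    (h : IsSpectralMeasure U x μ) : μ = 0 ↔ x = 0 := by
  rw [← Measure.measure_univ_eq_zero, h.measure_univ]
  simp

variable [CompleteSpace H]

/-- The spectral measure of `x` with respect to `U`. -/
def spectralMeasure (U : H ≃ₗᵢ[ℂ] H) (x : H) : Measure UnitAddCircle :=
  (exists_isSpectralMeasure U x).choose

theorem isSpectralMeasure_spectralMeasure (U : H ≃ₗᵢ[ℂ] H) (x : H) :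
    IsSpectralMeasure U x (spectralMeasure U x) := (exists_isSpectralMeasure U x).choose_spec

instance (U : H ≃ₗᵢ[ℂ] H) (x : H) : IsFiniteMeasure (spectralMeasure U x) :=
  (isSpectralMeasure_spectralMeasure U x).1

theorem IsSpectralMeasure.eq {U : H ≃ₗᵢ[ℂ] H} {x : H} {μ : Measure UnitAddCircle}
    (h : IsSpectralMeasure U x μ) : spectralMeasure U x = μ :=
  (isSpectralMeasure_spectralMeasure U x).unique h

variable (U : H ≃ₗᵢ[ℂ] H)

theorem spectralMeasure_zpow (k : ℤ) (x : H) :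
    spectralMeasure U ((U ^ k) x) = spectralMeasure U x :=
  ((isSpectralMeasure_spectralMeasure U x).zpow k).eq

theorem spectralMeasure_smul (c : ℂ) (x : H) :
    spectralMeasure U (c • x) = ENNReal.ofReal (‖c‖ ^ 2) • spectralMeasure U x :=
  ((isSpectralMeasure_spectralMeasure U x).smul c).eq

theorem spectralMeasure_zero : spectralMeasure U (0 : H) = 0 :=
  (isSpectralMeasure_spectralMeasure U 0).eq_zero_iff.2 rfl

/-- In the sum of the spectral measures of `x + y` and `r x - r⁻¹ y` the cross terms cancel, which
leaves exactly the right-hand side. The free weight `r` matters for the orthogonality of vectors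
with singular measures; elsewhere `r = 1` is enough. -/
theorem spectralMeasure_add_le (x y : H) {r : ℝ} (hr : 0 < r) :
    spectralMeasure U (x + y) ≤ ENNReal.ofReal (1 + r ^ 2) • spectralMeasure U x +
      ENNReal.ofReal (1 + r⁻¹ ^ 2) • spectralMeasure U y := by
  have h1 := (spectralMeasure U x).smul_finite (c := ENNReal.ofReal (1 + r ^ 2))
    ENNReal.ofReal_ne_top
  have h2 := (spectralMeasure U y).smul_finite (c := ENNReal.ofReal (1 + r⁻¹ ^ 2))
    ENNReal.ofReal_ne_top
  have key : spectralMeasure U (x + y) + spectralMeasure U ((r : ℂ) • x - (r⁻¹ : ℂ) • y) =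
      ENNReal.ofReal (1 + r ^ 2) • spectralMeasure U x +
        ENNReal.ofReal (1 + r⁻¹ ^ 2) • spectralMeasure U y := by
    refine measure_ext_of_fourier fun k => ?_
    rw [integral_add_measure (integrable_fourier _ _) (integrable_fourier _ _),
      integral_add_measure (integrable_fourier _ _) (integrable_fourier _ _),
      integral_smul_measure, integral_smul_measure]
    simp only [(isSpectralMeasure_spectralMeasure U _).2, map_add, map_sub, map_smul,
      inner_add_left, inner_add_right, inner_sub_left, inner_sub_right, inner_smul_left,
      inner_smul_right, map_inv₀, Complex.conj_ofReal]
    rw [ENNReal.toReal_ofReal (by positivity), ENNReal.toReal_ofReal (by positivity),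
      Complex.real_smul, Complex.real_smul]
    have : (r : ℂ) ≠ 0 := by exact_mod_cast hr.ne'
    push_cast
    field_simp
    ring
  rw [← key]
  exact Measure.le_add_right le_rfl

theorem spectralMeasure_add_le_two (x y : H) :
    spectralMeasure U (x + y) ≤ (2 : ℝ≥0∞) • spectralMeasure U x +
      (2 : ℝ≥0∞) • spectralMeasure U y := by
  have := spectralMeasure_add_le U x y one_pos
  norm_num at this
  exact this

/-! ### Spectral subspaces -/

/-- The vectors whose spectral measure vanishes on `B`. -/
def nullSubspace (B : Set UnitAddCircle) : Submodule ℂ H where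
  carrier := {x | spectralMeasure U x B = 0}
  add_mem' {x y} hx hy := by
    have := spectralMeasure_add_le_two U x y B
    simp_all
  zero_mem' := by simp [spectralMeasure_zero]
  smul_mem' c x hx := by
    simp only [Set.mem_ofPred_eq] at hx ⊢
    simp [spectralMeasure_smul, hx]

theorem mem_nullSubspace {B : Set UnitAddCircle} {x : H} :
    x ∈ nullSubspace U B ↔ spectralMeasure U x B = 0 := Iff.rfl

/-- For `y` in the subspace, the measure of `B` for `x = (x - y) + y` is at most twice that for `x -
y`, hence at most `2 ‖x - y‖²`. -/
theorem isClosed_nullSubspace (B : Set UnitAddCircle) :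
    IsClosed (nullSubspace U B : Set H) := by
  refine isClosed_of_closure_subset fun x hx => ?_
  rw [SetLike.mem_coe, mem_nullSubspace]
  by_contra h0
  have hpos : 0 < (spectralMeasure U x B).toReal :=
    ENNReal.toReal_pos h0 (measure_ne_top _ _)
  obtain ⟨y, hy, hxy⟩ := Metric.mem_closure_iff.1 hx (Real.sqrt ((spectralMeasure U x B).toReal / 4))
    (by positivity)
  have h1 := spectralMeasure_add_le_two U (x - y) y B
  have hy' : spectralMeasure U y B = 0 := hy
  simp only [sub_add_cancel, Measure.coe_add, Measure.coe_smul, Pi.add_apply, Pi.smul_apply, hy',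
    smul_eq_mul, mul_zero, add_zero] at h1
  have h2 : spectralMeasure U (x - y) B ≤ ENNReal.ofReal (‖x - y‖ ^ 2) := by
    rw [← (isSpectralMeasure_spectralMeasure U (x - y)).measure_univ]
    exact measure_mono (Set.subset_univ _)
  have h3 : (spectralMeasure U x B).toReal ≤ 2 * ‖x - y‖ ^ 2 := by
    refine ENNReal.toReal_le_of_le_ofReal (by positivity) (h1.trans ?_)
    rw [ENNReal.ofReal_mul (by norm_num), ENNReal.ofReal_ofNat]
    gcongr
  have h4 : ‖x - y‖ ^ 2 < (spectralMeasure U x B).toReal / 4 := by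
    rw [dist_eq_norm] at hxy
    exact (Real.lt_sqrt (norm_nonneg _)).1 hxy
  linarith

/-- The vectors whose spectral measure is singular to `μ`. -/
def singularSubspace (μ : Measure UnitAddCircle) : Submodule ℂ H where
  carrier := {x | spectralMeasure U x ⟂ₘ μ}
  add_mem' {x y} hx hy :=
    ((hx.smul 2).add_left (hy.smul 2)).mono (spectralMeasure_add_le_two U x y) le_rfl
  zero_mem' := by simp [spectralMeasure_zero]
  smul_mem' c x hx := by
    simp only [Set.mem_ofPred_eq, spectralMeasure_smul] at hx ⊢
    exact hx.smul _

theorem mem_singularSubspace {μ : Measure UnitAddCircle} {x : H} :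
    x ∈ singularSubspace U μ ↔ spectralMeasure U x ⟂ₘ μ := Iff.rfl

/-- If `A n` separates the measure of the `n`-th approximant from `μ`, then `⋂ n, A n` is null for
all approximants and hence for the limit, while its complement is still `μ`-null as a countable
union. -/
theorem isClosed_singularSubspace (μ : Measure UnitAddCircle) :
    IsClosed (singularSubspace U μ : Set H) := by
  refine isClosed_of_closure_subset fun x hx => ?_
  obtain ⟨y, hy, hyx⟩ := mem_closure_iff_seq_limit.1 hx
  choose A hA h1 h2 using fun n => (hy n : spectralMeasure U (y n) ⟂ₘ μ)
  have hx' : x ∈ nullSubspace U (⋂ n, A n) := by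
    refine (isClosed_nullSubspace U _).mem_of_tendsto hyx (Filter.Eventually.of_forall fun n => ?_)
    exact measure_mono_null (Set.iInter_subset _ n) (h1 n)
  refine ⟨⋂ n, A n, MeasurableSet.iInter hA, hx', ?_⟩
  rw [Set.compl_iInter]
  exact measure_iUnion_null h2

/-- The vectors whose spectral measure is absolutely continuous with respect to `μ`. -/
def absolutelyContinuousSubspace (μ : Measure UnitAddCircle) : Submodule ℂ H :=
  ⨅ (B : Set UnitAddCircle) (_ : μ B = 0), nullSubspace U B

theorem mem_absolutelyContinuousSubspace {μ : Measure UnitAddCircle} {x : H} :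
    x ∈ absolutelyContinuousSubspace U μ ↔ spectralMeasure U x ≪ μ := by
  simp only [absolutelyContinuousSubspace, Submodule.mem_iInf, mem_nullSubspace]
  rfl

theorem isClosed_absolutelyContinuousSubspace (μ : Measure UnitAddCircle) :
    IsClosed (absolutelyContinuousSubspace U μ : Set H) := by
  simp only [absolutelyContinuousSubspace, Submodule.coe_iInf]
  exact isClosed_iInter fun B => isClosed_iInter fun _ => isClosed_nullSubspace U B

variable {U}

theorem spectralMeasure_absolutelyContinuous_of_mem {x y : H} (h : y ∈ cyclicSubspace U x) :
    spectralMeasure U y ≪ spectralMeasure U x := by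
  rw [← mem_absolutelyContinuousSubspace]
  refine cyclicSubspace_le (isClosed_absolutelyContinuousSubspace U _) (fun k => ?_) h
  rw [mem_absolutelyContinuousSubspace, spectralMeasure_zpow]

/-- Vectors with mutually singular spectral measures are orthogonal. -/
theorem inner_eq_zero_of_mutuallySingular {x y : H}
    (h : spectralMeasure U x ⟂ₘ spectralMeasure U y) : ⟪x, y⟫_ℂ = 0 := by
  -- On each of the two sets carrying the measures only one term of the weighted inequality
  -- survives. The weight `r` on one set and `r⁻¹` on the other turn both coefficients into `1 +
  -- r²`, and `r → 0` then removes the excess.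
  have key : ∀ c : ℂ, ∀ r : ℝ, 0 < r →
      ‖x + c • y‖ ^ 2 ≤ (1 + r ^ 2) * (‖x‖ ^ 2 + ‖c • y‖ ^ 2) := by
    intro c r hr
    have hc : spectralMeasure U x ⟂ₘ spectralMeasure U (c • y) := by
      rw [spectralMeasure_smul]
      exact (h.symm.smul _).symm
    obtain ⟨A, hA, h1, h2⟩ := hc
    have e1 := spectralMeasure_add_le U x (c • y) hr Aᶜ
    have e2 := spectralMeasure_add_le U x (c • y) (inv_pos.2 hr) A
    simp only [Measure.coe_add, Measure.coe_smul, Pi.add_apply, Pi.smul_apply, h1, h2,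
      smul_eq_mul, mul_zero, add_zero, zero_add, inv_inv] at e1 e2
    have e3 := (isSpectralMeasure_spectralMeasure U (x + c • y)).measure_univ
    have e4 : ENNReal.ofReal (‖x + c • y‖ ^ 2) ≤
        ENNReal.ofReal ((1 + r ^ 2) * (‖x‖ ^ 2 + ‖c • y‖ ^ 2)) := by
      rw [← e3, ← measure_add_measure_compl hA, mul_add, ENNReal.ofReal_add (by positivity)
        (by positivity), ENNReal.ofReal_mul (by positivity), ENNReal.ofReal_mul (by positivity),
        ← (isSpectralMeasure_spectralMeasure U x).measure_univ,
        ← (isSpectralMeasure_spectralMeasure U (c • y)).measure_univ, add_comm]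
      gcongr
      · exact e1.trans (by gcongr; exact Set.subset_univ _)
      · exact e2.trans (by gcongr; exact Set.subset_univ _)
    exact (ENNReal.ofReal_le_ofReal_iff (by positivity)).1 e4
  have key2 : ∀ c : ℂ, ‖x + c • y‖ ^ 2 ≤ ‖x‖ ^ 2 + ‖c • y‖ ^ 2 := by
    intro c
    have ht : Filter.Tendsto (fun r : ℝ => (1 + r ^ 2) * (‖x‖ ^ 2 + ‖c • y‖ ^ 2))
        (nhdsWithin 0 (Set.Ioi 0)) (nhds ((1 + 0 ^ 2) * (‖x‖ ^ 2 + ‖c • y‖ ^ 2))) :=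
      (Continuous.tendsto (by fun_prop) 0).mono_left nhdsWithin_le_nhds
    have := ge_of_tendsto ht (Filter.mem_of_superset self_mem_nhdsWithin fun r hr => key c r hr)
    linarith
  -- This scalar makes the cross term of `‖x + c • y‖²` equal to `2 |⟪x, y⟫|²`.
  have h1 := key2 (conj ⟪x, y⟫_ℂ)
  rw [@norm_add_sq ℂ, inner_smul_right, RCLike.conj_mul, ← RCLike.ofReal_pow, RCLike.ofReal_re] at h1
  have h2 : ‖⟪x, y⟫_ℂ‖ ^ 2 ≤ 0 := by linarith
  exact norm_eq_zero.1 (pow_eq_zero_iff two_ne_zero |>.1 (le_antisymm h2 (sq_nonneg _)))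

theorem inner_zpow_eq_zero_of_mutuallySingular {x y : H}
    (h : spectralMeasure U x ⟂ₘ spectralMeasure U y) (k : ℤ) : ⟪x, (U ^ k) y⟫_ℂ = 0 :=
  inner_eq_zero_of_mutuallySingular (U := U) (by rwa [spectralMeasure_zpow])

end SpectralSubspaces

/-! ### Multiplicity theory through orthogonal families with a common spectral measure. -/

section Multiplicity

variable {H : Type*} [NormedAddCommGroup H] [InnerProductSpace ℂ H]
variable {ι κ : Type*}

/-! ### Families of equivalent cyclic subspaces -/

/-- The vectors `x i` have pairwise orthogonal cyclic subspaces and the same spectral measure. -/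
def IsCopies (U : H ≃ₗᵢ[ℂ] H) (μ : Measure UnitAddCircle) (x : ι → H) : Prop :=
  (∀ i, IsSpectralMeasure U (x i) μ) ∧ ∀ i j, i ≠ j → ∀ k : ℤ, ⟪x i, (U ^ k) (x j)⟫_ℂ = 0

/-- The vectors orthogonal to the cyclic subspaces of the `x i`. -/
def residual (U : H ≃ₗᵢ[ℂ] H) (x : ι → H) : Submodule ℂ H :=
  ⨅ (i : ι) (k : ℤ), LinearMap.ker (innerSL ℂ ((U ^ k) (x i))).toLinearMap

theorem mem_residual {U : H ≃ₗᵢ[ℂ] H} {x : ι → H} {y : H} :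
    y ∈ residual U x ↔ ∀ i, ∀ k : ℤ, ⟪(U ^ k) (x i), y⟫_ℂ = 0 := by
  simp [residual, Submodule.mem_iInf]

theorem isClosed_residual (U : H ≃ₗᵢ[ℂ] H) (x : ι → H) : IsClosed (residual U x : Set H) := by
  simp only [residual, Submodule.coe_iInf]
  exact isClosed_iInter fun i => isClosed_iInter fun k => (innerSL ℂ ((U ^ k) (x i))).isClosed_ker

theorem cyclicSubspace_le_residual {U : H ≃ₗᵢ[ℂ] H} {x : ι → H} {y : H} (hy : y ∈ residual U x) :
    cyclicSubspace U y ≤ residual U x := by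
  refine cyclicSubspace_le (isClosed_residual U x) fun k => mem_residual.2 fun i l => ?_
  rw [inner_zpow_zpow, ← neg_sub, ← inner_zpow_left]
  exact mem_residual.1 hy i _

/-- The orthogonal complement of the cyclic subspaces of the `x i` is singular to `μ`. -/
def Exhausts (U : H ≃ₗᵢ[ℂ] H) (μ : Measure UnitAddCircle) (x : ι → H) : Prop :=
  ∀ y ∈ residual U x, ∀ ν, IsSpectralMeasure U y ν → ν ⟂ₘ μ

theorem mem_spectralMultiplicities {U : H ≃ₗᵢ[ℂ] H} {n : ℕ∞} :
    n ∈ spectralMultiplicities U ↔ 1 ≤ n ∧ ∃ (μ : Measure UnitAddCircle)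
      (x : {i : ℕ // (i : ℕ∞) < n} → H), μ ≠ 0 ∧ IsCopies U μ x ∧ Exhausts U μ x := by
  refine and_congr_right fun _ => exists_congr fun μ => exists_congr fun x => ?_
  simp only [IsCopies, Exhausts, mem_residual, and_assoc]

theorem IsCopies.comp {U : H ≃ₗᵢ[ℂ] H} {μ : Measure UnitAddCircle} {x : ι → H}
    (h : IsCopies U μ x) (e : κ → ι) (he : Function.Injective e) : IsCopies U μ (x ∘ e) :=
  ⟨fun _ => h.1 _, fun _ _ hij k => h.2 _ _ (he.ne hij) k⟩

theorem Exhausts.comp {U : H ≃ₗᵢ[ℂ] H} {μ : Measure UnitAddCircle} {x : ι → H}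
    (h : Exhausts U μ x) (e : κ → ι) (he : Function.Surjective e) : Exhausts U μ (x ∘ e) :=
  fun y hy => h y (mem_residual.2 fun i k => by
    obtain ⟨j, rfl⟩ := he i
    exact mem_residual.1 hy j k)

theorem mem_spectralMultiplicities_of_equiv {U : H ≃ₗᵢ[ℂ] H} {μ : Measure UnitAddCircle} {n : ℕ∞}
    (hn : 1 ≤ n) (e : {i : ℕ // (i : ℕ∞) < n} ≃ ι) {x : ι → H} (hμ : μ ≠ 0) (hx : IsCopies U μ x)
    (hx' : Exhausts U μ x) : n ∈ spectralMultiplicities U :=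
  mem_spectralMultiplicities.2
    ⟨hn, μ, x ∘ e, hμ, hx.comp e e.injective, hx'.comp e e.surjective⟩

/-! ### Comparison of the numbers of copies -/

/-- `∑ V j (V j)*` is the orthogonal projection onto the sum of the orthogonal ranges; the second
claim is Pythagoras. -/
theorem norm_sub_sum_adjoint {E F : Type*} [NormedAddCommGroup E] [InnerProductSpace ℂ E]
    [CompleteSpace E] [NormedAddCommGroup F] [InnerProductSpace ℂ F] [CompleteSpace F] [Fintype κ]
    (V : κ → F →ₗᵢ[ℂ] E) (hV : ∀ i j, i ≠ j → ∀ f g, ⟪V i f, V j g⟫_ℂ = 0) (z : E) :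
    (∀ l f, ⟪V l f, z - ∑ j, V j ((V j).toContinuousLinearMap.adjoint z)⟫_ℂ = 0) ∧
    ‖z - ∑ j, V j ((V j).toContinuousLinearMap.adjoint z)‖ ^ 2 +
      ∑ j, ‖(V j).toContinuousLinearMap.adjoint z‖ ^ 2 = ‖z‖ ^ 2 := by
  classical
  set p := ∑ j, V j ((V j).toContinuousLinearMap.adjoint z) with hp
  have h1 : ∀ l f, ⟪V l f, z - p⟫_ℂ = 0 := by
    intro l f
    rw [inner_sub_right, hp, inner_sum, Finset.sum_eq_single l, (V l).inner_map_map,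
      ContinuousLinearMap.adjoint_inner_right]
    · exact sub_self _
    · exact fun j _ hj => hV l j hj.symm _ _
    · simp
  refine ⟨h1, ?_⟩
  have h2 : ⟪p, z - p⟫_ℂ = 0 := by
    rw [hp, sum_inner]
    exact Finset.sum_eq_zero fun j _ => h1 j _
  have h3 : ⟪p, z⟫_ℂ = ((∑ j, ‖(V j).toContinuousLinearMap.adjoint z‖ ^ 2 : ℝ) : ℂ) := by
    rw [hp, sum_inner]
    push_cast
    refine Finset.sum_congr rfl fun j _ => ?_
    have : ⟪V j ((V j).toContinuousLinearMap.adjoint z), z⟫_ℂ =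
      ⟪(V j).toContinuousLinearMap.adjoint z, (V j).toContinuousLinearMap.adjoint z⟫_ℂ :=
      (ContinuousLinearMap.adjoint_inner_right (V j).toContinuousLinearMap _ z).symm
    rw [this, inner_self_eq_norm_sq_to_K]
    rfl
  have h4 : ⟪p, p⟫_ℂ = ⟪p, z⟫_ℂ := by
    rw [inner_sub_right, sub_eq_zero] at h2
    exact h2.symm
  have h5 : ‖p‖ ^ 2 = ∑ j, ‖(V j).toContinuousLinearMap.adjoint z‖ ^ 2 := by
    rw [h3, inner_self_eq_norm_sq_to_K] at h4
    exact Complex.ofReal_injective ((Complex.ofReal_pow _ _).trans h4)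
  have h6 := norm_add_sq (𝕜 := ℂ) p (z - p)
  rw [h2, add_sub_cancel] at h6
  simp only [map_zero, mul_zero, add_zero] at h6
  rw [h6, ← h5, add_comm]

variable [CompleteSpace H] {U : H ≃ₗᵢ[ℂ] H} {μ : Measure UnitAddCircle}

/-- The functions `W* y` and `V* x` in `L²(μ)` are complex conjugates of each other, as their
Fourier coefficients show. This symmetry permits the double count in `IsCopies.card_le`. -/
theorem norm_adjoint_model_eq [IsFiniteMeasure μ] {x y : H} {W V : Lp ℂ 2 μ →ₗᵢ[ℂ] H}
    (hW : ∀ k, W (charLp μ k) = (U ^ k) x) (hV : ∀ k, V (charLp μ k) = (U ^ k) y) :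
    ‖W.toContinuousLinearMap.adjoint y‖ = ‖V.toContinuousLinearMap.adjoint x‖ := by
  have : star (W.toContinuousLinearMap.adjoint y) = V.toContinuousLinearMap.adjoint x := by
    refine charLp_ext fun k => ?_
    rw [ContinuousLinearMap.adjoint_inner_right]
    change _ = ⟪V (charLp μ k), x⟫_ℂ
    rw [hV]
    have h1 : ⟪charLp μ (-k), W.toContinuousLinearMap.adjoint y⟫_ℂ = ⟪(U ^ (-k)) x, y⟫_ℂ := by
      rw [ContinuousLinearMap.adjoint_inner_right]
      exact congrArg (fun z => ⟪z, y⟫_ℂ) (hW (-k))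
    rw [inner_zpow_left, ← inner_conj_symm y, ← h1, inner_charLp, inner_charLp, ← integral_conj]
    refine integral_congr_ae ?_
    filter_upwards [Lp.coeFn_star (W.toContinuousLinearMap.adjoint y)] with t ht
    rw [ht, map_mul, fourier_neg, fourier_neg, fourier_neg, Complex.conj_conj]
    rfl
  rw [← this, Lp.norm_def, Lp.norm_def]
  congr 1
  refine eLpNorm_congr_norm_ae ?_
  filter_upwards [Lp.coeFn_star (W.toContinuousLinearMap.adjoint y)] with t ht
  rw [ht, Pi.star_apply, norm_star]

/-- A family of copies cannot be larger than a finite exhausting one. -/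
theorem IsCopies.card_le [Fintype ι] [Fintype κ] (hμ : μ ≠ 0) {x : ι → H} (hx : IsCopies U μ x)
    (hx' : Exhausts U μ x) {y : κ → H} (hy : IsCopies U μ y) :
    Fintype.card κ ≤ Fintype.card ι := by
  rcases isEmpty_or_nonempty κ with hκ | ⟨⟨j₀⟩⟩
  · simp
  have := (hy.1 j₀).1
  choose W hWe _ hWx using fun i => exists_cyclic_model (hx.1 i)
  choose V hVe _ hVy using fun j => exists_cyclic_model (hy.1 j)
  have hWo : ∀ i j, i ≠ j → ∀ f g, ⟪W i f, W j g⟫_ℂ = 0 := fun i j hij f g => by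
    simpa using inner_eq_zero_of_mem_cyclicSubspace (hx.2 i j hij) (hWx i f) (hWx j g) 0
  have hVo : ∀ i j, i ≠ j → ∀ f g, ⟪V i f, V j g⟫_ℂ = 0 := fun i j hij f g => by
    simpa using inner_eq_zero_of_mem_cyclicSubspace (hy.2 i j hij) (hVy i f) (hVy j g) 0
  have hnorm : ∀ z, IsSpectralMeasure U z μ → ‖z‖ ^ 2 = μ.real Set.univ := fun z hz => by
    rw [measureReal_def, hz.measure_univ, ENNReal.toReal_ofReal (by positivity)]
  -- The residue `r` of `y j` is singular to `μ`, hence orthogonal to `y j`; it is also orthogonal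
  -- to the projection of `y j`, hence to itself. So `r = 0` and Parseval's equality holds, whereas
  -- the family `y` in `h2` gives only Bessel's inequality.
  have h1 : ∀ j, ∑ i, ‖(W i).toContinuousLinearMap.adjoint (y j)‖ ^ 2 = μ.real Set.univ := by
    intro j
    obtain ⟨hr, hs⟩ := norm_sub_sum_adjoint W hWo (y j)
    set r := y j - ∑ i, W i ((W i).toContinuousLinearMap.adjoint (y j)) with hrdef
    have hres : r ∈ residual U x := mem_residual.2 fun i k => by rw [← hWe]; exact hr i _
    have hsing : spectralMeasure U r ⟂ₘ spectralMeasure U (y j) := by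
      rw [(hy.1 j).eq]
      exact hx' r hres _ (isSpectralMeasure_spectralMeasure U r)
    have h0 : ⟪r, r⟫_ℂ = 0 := by
      conv_lhs => rw [hrdef, inner_sub_left, sum_inner, ← hrdef]
      rw [Finset.sum_eq_zero fun i _ => hr i _, sub_zero, ← inner_conj_symm,
        inner_eq_zero_of_mutuallySingular hsing, map_zero]
    rw [inner_self_eq_zero.1 h0, hnorm _ (hy.1 j)] at hs
    simpa using hs
  have h2 : ∀ i, ∑ j, ‖(V j).toContinuousLinearMap.adjoint (x i)‖ ^ 2 ≤ μ.real Set.univ := by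
    intro i
    have hs := (norm_sub_sum_adjoint V hVo (x i)).2
    rw [hnorm _ (hx.1 i)] at hs
    nlinarith [sq_nonneg ‖x i - ∑ j, V j ((V j).toContinuousLinearMap.adjoint (x i))‖]
  have h3 : (Fintype.card κ : ℝ) * μ.real Set.univ ≤ Fintype.card ι * μ.real Set.univ := by
    calc (Fintype.card κ : ℝ) * μ.real Set.univ
        = ∑ j, ∑ i, ‖(W i).toContinuousLinearMap.adjoint (y j)‖ ^ 2 := by simp [h1]
      _ = ∑ i, ∑ j, ‖(V j).toContinuousLinearMap.adjoint (x i)‖ ^ 2 := by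
        rw [Finset.sum_comm]
        refine Finset.sum_congr rfl fun i _ => Finset.sum_congr rfl fun j _ => ?_
        rw [norm_adjoint_model_eq (hWe i) (hVe j)]
      _ ≤ ∑ _i : ι, μ.real Set.univ := Finset.sum_le_sum fun i _ => h2 i
      _ = _ := by simp
  have hpos : 0 < μ.real Set.univ :=
    ENNReal.toReal_pos (by rwa [Ne, Measure.measure_univ_eq_zero]) (measure_ne_top _ _)
  exact_mod_cast le_of_mul_le_mul_right h3 hpos

/-! ### Passing to smaller measures -/

theorem IsCopies.of_absolutelyContinuous {x : ι → H} (hx : IsCopies U μ x)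
    {ρ : Measure UnitAddCircle} [IsFiniteMeasure ρ] (h : ρ ≪ μ) :
    ∃ x' : ι → H, IsCopies U ρ x' := by
  have key : ∀ i, ∃ x' ∈ cyclicSubspace U (x i), IsSpectralMeasure U x' ρ := fun i => by
    have := (hx.1 i).1
    exact exists_isSpectralMeasure_of_absolutelyContinuous (hx.1 i) h
  choose x' hm hx' using key
  exact ⟨x', hx', fun i j hij k =>
    inner_eq_zero_of_mem_cyclicSubspace (hx.2 i j hij) (hm i) (hm j) k⟩

theorem mutuallySingular_restrict_compl {μ ν : Measure UnitAddCircle} {A : Set UnitAddCircle}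
    (hA : MeasurableSet A) : μ.restrict Aᶜ ⟂ₘ ν.restrict A :=
  ⟨A, hA, by simp [hA], by simp [hA]⟩

/-- `C` is the set where the density of `ν` with respect to `μ` does not vanish. For measures that
are not mutually singular this provides a nonzero piece of `μ` below `ν`. -/
theorem exists_restrict_absolutelyContinuous (ν μ : Measure UnitAddCircle) [IsFiniteMeasure ν]
    [IsFiniteMeasure μ] : ∃ C, MeasurableSet C ∧ μ.restrict C ≪ ν ∧ (μ C = 0 → ν ⟂ₘ μ) := by
  have hm := Measure.measurable_rnDeriv ν μ
  have hC : MeasurableSet {t | ν.rnDeriv μ t ≠ 0} := (measurableSet_eq_fun hm measurable_const).compl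
  refine ⟨{t | ν.rnDeriv μ t ≠ 0}, hC, ?_, fun h => ?_⟩
  · refine Measure.AbsolutelyContinuous.mk fun B hB h0 => ?_
    rw [Measure.restrict_apply hB, Set.inter_comm, ← withDensity_apply_eq_zero hm]
    exact Measure.absolutelyContinuous_of_le (Measure.withDensity_rnDeriv_le ν μ) h0
  · exact Measure.rnDeriv_eq_zero ν μ |>.1 h

/-- The truncations to `A` of an exhausting family. -/
theorem exists_truncation_family [IsFiniteMeasure μ] {x : ι → H} (hx : IsCopies U μ x)
    {A : Set UnitAddCircle} (hA : MeasurableSet A) :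
    ∃ x' : ι → H, IsCopies U (μ.restrict A) x' ∧ ∀ y ∈ residual U x', ∃ y' ∈ residual U x,
      IsSpectralMeasure U y' ((spectralMeasure U y).restrict A) := by
  choose x' hm hx' hx'' using fun i => exists_truncation (hx.1 i) hA
  refine ⟨x', ⟨hx', fun i j hij k =>
    inner_eq_zero_of_mem_cyclicSubspace (hx.2 i j hij) (hm i) (hm j) k⟩, fun y hy => ?_⟩
  obtain ⟨y', -, hy', hy''⟩ := exists_truncation (isSpectralMeasure_spectralMeasure U y) hA
  refine ⟨y', mem_residual.2 fun i k => ?_, hy'⟩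
  -- Vectors with measures on `A` and on `Aᶜ` are orthogonal, so the products of `x i` with `y'`, of
  -- `x' i` with `y'`, and of `x' i` with `y` all agree along the orbit; the last one vanishes.
  have h1 : ⟪x' i, (U ^ (-k)) (y - y')⟫_ℂ = 0 := by
    apply inner_zpow_eq_zero_of_mutuallySingular
    rw [(hx' i).eq, hy''.eq]
    exact (mutuallySingular_restrict_compl hA).symm
  have h2 : ⟪x i - x' i, (U ^ (-k)) y'⟫_ℂ = 0 := by
    apply inner_zpow_eq_zero_of_mutuallySingular
    rw [(hx'' i).eq, hy'.eq]
    exact mutuallySingular_restrict_compl hA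
  have h3 := mem_residual.1 hy i k
  rw [inner_zpow_left] at h3 ⊢
  rw [map_sub, inner_sub_right, h3, zero_sub, neg_eq_zero] at h1
  rwa [inner_sub_left, h1, sub_zero] at h2

theorem exists_exhausts_restrict [IsFiniteMeasure μ] {x : ι → H} (hx : IsCopies U μ x)
    (hx' : Exhausts U μ x) {A : Set UnitAddCircle} (hA : MeasurableSet A) :
    ∃ x' : ι → H, IsCopies U (μ.restrict A) x' ∧ Exhausts U (μ.restrict A) x' := by
  obtain ⟨x', h1, h2⟩ := exists_truncation_family hx hA
  refine ⟨x', h1, fun y hy ν hν => ?_⟩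
  obtain ⟨y', hy', hy''⟩ := h2 y hy
  rw [hν.eq] at hy''
  have h3 := (hx' y' hy' _ hy'').mono le_rfl (Measure.restrict_le_self (s := A))
  rw [← Measure.restrict_add_restrict_compl (μ := ν) hA]
  exact h3.add_left (mutuallySingular_restrict_compl hA)

end Multiplicity

section Exhaustion

variable {H : Type*} [NormedAddCommGroup H] [InnerProductSpace ℂ H]
variable {ι : Type*} {U : H ≃ₗᵢ[ℂ] H} {μ : Measure UnitAddCircle}

/-! ### Cardinality of families of copies -/

/-- The vectors are orthogonal and of the same norm `ε > 0`, so balls of radius `ε / 2` around them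
are disjoint open sets of a separable space. -/
theorem IsCopies.countable [TopologicalSpace.SeparableSpace H] (hμ : μ ≠ 0) {S : Set H}
    (h : IsCopies U μ (Subtype.val : S → H)) : S.Countable := by
  have hpos : ∀ i : S, (i : H) ≠ 0 := fun i h0 => hμ ((h.1 i).eq_zero_iff.2 h0)
  have hn : ∀ i : S, ‖(i : H)‖ ^ 2 = μ.real Set.univ := fun i => by
    rw [measureReal_def, (h.1 i).measure_univ, ENNReal.toReal_ofReal (by positivity)]
  rcases S.eq_empty_or_nonempty with rfl | ⟨s, hs⟩
  · exact Set.countable_empty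
  set ε := ‖s‖ with hε
  have hε0 : 0 < ε := norm_pos_iff.2 (hpos ⟨s, hs⟩)
  refine Set.PairwiseDisjoint.countable_of_isOpen (s := fun y : H => Metric.ball y (ε / 2))
    (fun i hi j hj hij => ?_) (fun i _ => Metric.isOpen_ball)
    (fun i _ => ⟨i, Metric.mem_ball_self (by positivity)⟩)
  refine Metric.ball_disjoint_ball ?_
  have h1 := norm_sub_sq (𝕜 := ℂ) i j
  have h2 : ⟪i, j⟫_ℂ = 0 := by
    simpa using h.2 ⟨i, hi⟩ ⟨j, hj⟩ (fun e => hij (congrArg Subtype.val e)) 0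
  have h3 : ‖i‖ ^ 2 = ε ^ 2 := (hn ⟨i, hi⟩).trans (hn ⟨s, hs⟩).symm
  rw [h2, h3] at h1
  simp only [map_zero, mul_zero, sub_zero] at h1
  rw [dist_eq_norm, add_halves]
  exact le_of_sq_le_sq (by nlinarith [sq_nonneg ‖j‖]) (norm_nonneg _)

theorem mem_spectralMultiplicities_card [Finite ι] [Nonempty ι] {x : ι → H} (hμ : μ ≠ 0)
    (hx : IsCopies U μ x) (hx' : Exhausts U μ x) :
    ((Nat.card ι : ℕ) : ℕ∞) ∈ spectralMultiplicities U := by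
  have e : {i : ℕ // (i : ℕ∞) < (Nat.card ι : ℕ)} ≃ ι :=
    ((Equiv.subtypeEquivRight fun i => by exact Nat.cast_lt).trans Fin.equivSubtype.symm).trans
      (Finite.equivFin ι).symm
  refine mem_spectralMultiplicities_of_equiv ?_ e hμ hx hx'
  exact_mod_cast Nat.card_pos

theorem top_mem_spectralMultiplicities [Countable ι] [Infinite ι] {x : ι → H} (hμ : μ ≠ 0)
    (hx : IsCopies U μ x) (hx' : Exhausts U μ x) : ⊤ ∈ spectralMultiplicities U := by
  obtain ⟨e⟩ : Nonempty (ℕ ≃ ι) := nonempty_equiv_of_countable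
  exact mem_spectralMultiplicities_of_equiv le_top
    ((Equiv.subtypeUnivEquiv fun i => ENat.natCast_lt_top i).trans e) hμ hx hx'

/-! ### Exhausting a measure by copies -/

theorem mutuallySingular_restrict_of_disjoint {μ ν : Measure UnitAddCircle}
    {A B : Set UnitAddCircle} (hA : MeasurableSet A) (h : Disjoint A B) :
    μ.restrict A ⟂ₘ ν.restrict B :=
  ⟨Aᶜ, hA.compl, by simp [hA], by simp [Measure.restrict_apply hA, h.inter_eq]⟩

variable [CompleteSpace H]

theorem summable_of_orthogonal {d : ℕ → H} (hd : ∀ m n, m ≠ n → ⟪d m, d n⟫_ℂ = 0)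
    (hs : Summable fun n => ‖d n‖ ^ 2) : Summable d := by
  have hV : OrthogonalFamily ℂ (fun n => (ℂ ∙ d n : Submodule ℂ H))
      (fun n => (ℂ ∙ d n : Submodule ℂ H).subtypeₗᵢ) := by
    intro m n hmn v w
    obtain ⟨a, ha⟩ := Submodule.mem_span_singleton.1 v.2
    obtain ⟨b, hb⟩ := Submodule.mem_span_singleton.1 w.2
    change ⟪(v : H), (w : H)⟫_ℂ = 0
    rw [← ha, ← hb, inner_smul_left, inner_smul_right, hd m n hmn, mul_zero, mul_zero]
  exact (hV.summable_iff_norm_sq_summable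
    (fun n => ⟨d n, Submodule.mem_span_singleton_self _⟩)).2 hs

/-- Vectors with measures on disjoint sets are orthogonal, and their squared norms `μ (D n)` are
summable. Their sum has the required Fourier coefficients by passage to the limit. -/
theorem exists_isSpectralMeasure_iUnion [IsFiniteMeasure μ] {S : Submodule ℂ H}
    (hS : IsClosed (S : Set H)) {D : ℕ → Set UnitAddCircle} (hD : ∀ n, MeasurableSet (D n))
    (hdisj : Pairwise fun m n => Disjoint (D m) (D n))
    (h : ∀ n, ∃ r ∈ S, IsSpectralMeasure U r (μ.restrict (D n))) :
    ∃ r ∈ S, IsSpectralMeasure U r (μ.restrict (⋃ n, D n)) := by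
  choose d hdS hd using h
  have hort : ∀ m n, m ≠ n → ∀ k : ℤ, ⟪d m, (U ^ k) (d n)⟫_ℂ = 0 := by
    intro m n hmn k
    apply inner_zpow_eq_zero_of_mutuallySingular
    rw [(hd m).eq, (hd n).eq]
    exact mutuallySingular_restrict_of_disjoint (hD m) (hdisj hmn)
  have hnorm : ∀ n, ‖d n‖ ^ 2 = μ.real (D n) := fun n => by
    have := (hd n).measure_univ
    rw [Measure.restrict_apply_univ] at this
    rw [measureReal_def, this, ENNReal.toReal_ofReal (by positivity)]
  have hsum : Summable d := by
    refine summable_of_orthogonal (fun m n hmn => by simpa using hort m n hmn 0) ?_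
    simp only [hnorm]
    refine ENNReal.summable_toReal ?_
    rw [← measure_iUnion hdisj hD]
    exact measure_ne_top _ _
  refine ⟨∑' n, d n, ?_, inferInstance, fun k => ?_⟩
  · exact hS.mem_of_tendsto hsum.hasSum.tendsto_sum_nat
      (Filter.Eventually.of_forall fun n => S.sum_mem fun i _ => hdS i)
  have h1 := (hasSum_integral_iUnion hD hdisj
    ((integrable_fourier μ k).integrableOn (s := ⋃ n, D n))).tendsto_sum_nat
  have h2 := hsum.hasSum.tendsto_sum_nat
  have h3 := h2.inner (((U ^ k).continuous.tendsto _).comp h2) (𝕜 := ℂ)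
  refine tendsto_nhds_unique (h1.congr fun n => ?_) h3
  simp only [Function.comp_apply, map_sum, sum_inner, inner_sum]
  refine Finset.sum_congr rfl fun i hi => ?_
  rw [(hd i).2, Finset.sum_eq_single i]
  · exact fun j _ hj => hort j i hj k
  · exact fun h => absurd hi h

/-- Either another copy of `μ` fits into the complement of the given copies, or the truncations of
the given copies to some set of positive measure are exhausting. -/
theorem IsCopies.exists_exhausts_or_exists [IsFiniteMeasure μ] {x : ι → H} (hx : IsCopies U μ x) :
    (∃ A, MeasurableSet A ∧ μ A ≠ 0 ∧
      ∃ x' : ι → H, IsCopies U (μ.restrict A) x' ∧ Exhausts U (μ.restrict A) x') ∨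
    ∃ y ∈ residual U x, IsSpectralMeasure U y μ := by
  set R := residual U x with hR
  have hRc := isClosed_residual U x
  -- The sets over which the complement of the given copies contains a further copy of `μ`. The
  -- union `B` of a maximizing sequence of such sets is again one of them and has the largest
  -- possible measure.
  let P : Set UnitAddCircle → Prop := fun A =>
    MeasurableSet A ∧ ∃ r ∈ R, IsSpectralMeasure U r (μ.restrict A)
  have hmono : ∀ A B, P A → MeasurableSet B → B ⊆ A → P B := by
    rintro A B ⟨hA, r, hr, hrA⟩ hB hBA
    obtain ⟨r', hr', hr'', -⟩ := exists_truncation hrA hB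
    rw [Measure.restrict_restrict hB, Set.inter_eq_left.2 hBA] at hr''
    exact ⟨hB, r', cyclicSubspace_le_residual hr hr', hr''⟩
  have hdisj : ∀ A B, P A → P B → Disjoint A B → P (A ∪ B) := by
    rintro A B ⟨hA, r, hr, hrA⟩ ⟨hB, s, hs, hsB⟩ hAB
    refine ⟨hA.union hB, r + s, R.add_mem hr hs, ?_⟩
    rw [Measure.restrict_union hAB hB]
    refine hrA.add hsB fun k => inner_zpow_eq_zero_of_mutuallySingular ?_ k
    rw [hrA.eq, hsB.eq]
    exact mutuallySingular_restrict_of_disjoint hA hAB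
  have hne : {c | ∃ A, P A ∧ μ A = c}.Nonempty :=
    ⟨0, ∅, ⟨MeasurableSet.empty, 0, R.zero_mem, by
      rw [Measure.restrict_empty, ← spectralMeasure_zero U]
      exact isSpectralMeasure_spectralMeasure U 0⟩, measure_empty⟩
  obtain ⟨u, -, hu, huA⟩ := exists_seq_tendsto_sSup hne (OrderTop.bddAbove _)
  choose A hA hAu using huA
  set B := ⋃ n, A n with hB
  have hPB : P B := by
    refine ⟨MeasurableSet.iUnion fun n => (hA n).1, ?_⟩
    -- Made disjoint, the sets still satisfy `P`, which passes to measurable subsets; the vectors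
    -- belonging to them can then be added up.
    rw [hB, ← iUnion_disjointed]
    have hD : ∀ n, P (disjointed A n) := fun n =>
      hmono _ _ (hA n) (MeasurableSet.disjointed (fun n => (hA n).1) n) (disjointed_subset A n)
    exact exists_isSpectralMeasure_iUnion hRc (fun n => (hD n).1) (disjoint_disjointed A)
      fun n => (hD n).2
  have hmax : ∀ C, P C → μ C ≤ μ B := fun C hC => by
    refine (le_sSup (show μ C ∈ {c | ∃ A, P A ∧ μ A = c} from ⟨C, hC, rfl⟩)).trans ?_
    refine le_of_tendsto' hu fun n => ?_
    rw [← hAu n]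
    exact measure_mono (Set.subset_iUnion A n)
  by_cases h0 : μ Bᶜ = 0
  · right
    obtain ⟨-, r, hr, hr'⟩ := hPB
    rw [Measure.restrict_eq_self_of_ae_mem (s := B) (mem_ae_iff.2 h0)] at hr'
    exact ⟨r, hr, hr'⟩
  left
  have hBc := hPB.1.compl
  obtain ⟨x', h1, h2⟩ := exists_truncation_family hx hBc
  refine ⟨Bᶜ, hBc, h0, x', h1, fun y hy ν hν => ?_⟩
  obtain ⟨y', hy', hy''⟩ := h2 y hy
  have := hν.1
  rw [hν.eq] at hy''
  rw [← Measure.restrict_add_restrict_compl (μ := ν) hBc]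
  refine Measure.MutuallySingular.add_left ?_ (mutuallySingular_restrict_compl hBc)
  -- If `ν` were not singular to `μ` on `Bᶜ`, a further copy over a non-null set `C ∩ Bᶜ` could be
  -- added to the one over `B`, against the maximality of `μ B`.
  obtain ⟨C, hC, hC1, hC2⟩ := exists_restrict_absolutelyContinuous (ν.restrict Bᶜ) (μ.restrict Bᶜ)
  refine hC2 ?_
  rw [Measure.restrict_restrict hC] at hC1
  rw [Measure.restrict_apply hC]
  obtain ⟨r, hr, hr'⟩ := exists_isSpectralMeasure_of_absolutelyContinuous hy'' hC1
  have hPC : P (B ∪ C ∩ Bᶜ) := hdisj _ _ hPB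
    ⟨hC.inter hBc, r, cyclicSubspace_le_residual hy' hr, hr'⟩
    (Set.disjoint_left.2 fun t ht ht' => ht'.2 ht)
  have h3 := hmax _ hPC
  rw [measure_union (Set.disjoint_left.2 fun t ht ht' => ht'.2 ht) (hC.inter hBc)] at h3
  by_contra h4
  exact absurd h3 (not_le.2 (ENNReal.lt_add_right (measure_ne_top _ _) h4))

/-- A maximal family of copies of the cyclic subspace of `x` is exhausting on some set of positive
measure. -/
theorem exists_maximal_copies {x : H} (hx0 : x ≠ 0) (hx : IsSpectralMeasure U x μ) :
    ∃ S : Set H, x ∈ S ∧ IsCopies U μ (Subtype.val : S → H) ∧ ∃ A, MeasurableSet A ∧ μ A ≠ 0 ∧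
      ∃ x' : S → H, IsCopies U (μ.restrict A) x' ∧ Exhausts U (μ.restrict A) x' := by
  have := hx.1
  have hμ : μ ≠ 0 := fun h => hx0 (hx.eq_zero_iff.1 h)
  let F : Set (Set H) := {S | IsCopies U μ (Subtype.val : S → H)}
  obtain ⟨S, hxS, hS⟩ := zorn_subset_nonempty F (fun c hc hch hne => by
    refine ⟨⋃₀ c, ⟨fun i => ?_, fun i j hij k => ?_⟩, fun s hs => Set.subset_sUnion_of_mem hs⟩
    · obtain ⟨s, hs, his⟩ := i.2
      exact (hc hs).1 ⟨i, his⟩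
    · obtain ⟨s, hs, his⟩ := i.2
      obtain ⟨t, ht, hjt⟩ := j.2
      have hij' : (i : H) ≠ j := fun h => hij (Subtype.ext h)
      rcases hch.total hs ht with hst | hts
      · exact (hc ht).2 ⟨i, hst his⟩ ⟨j, hjt⟩ (fun h => hij' (Subtype.mk.inj h)) k
      · exact (hc hs).2 ⟨i, his⟩ ⟨j, hts hjt⟩ (fun h => hij' (Subtype.mk.inj h)) k)
    {x} (show IsCopies U μ (Subtype.val : ({x} : Set H) → H) from
      ⟨fun i => by rw [i.2]; exact hx, fun i j hij => (hij (Subsingleton.elim i j)).elim⟩)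
  refine ⟨S, hxS rfl, hS.prop, ?_⟩
  rcases hS.prop.exists_exhausts_or_exists with h | ⟨y, hy, hy'⟩
  · exact h
  -- A further copy `y` could be adjoined to `S`, so `y ∈ S` by maximality; but then `y` is
  -- orthogonal to itself.
  exfalso
  have hy2 := mem_residual.1 hy
  have hins : insert y S ∈ F := by
    refine ⟨fun ⟨i, hi⟩ => ?_, fun ⟨i, hi⟩ ⟨j, hj⟩ hij k => ?_⟩
    · rcases hi with rfl | hi
      · exact hy'
      · exact hS.prop.1 ⟨i, hi⟩
    · have hij' : i ≠ j := fun h => hij (Subtype.ext h)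
      rcases hi with rfl | hi <;> rcases hj with rfl | hj
      · exact (hij' rfl).elim
      · change ⟪i, (U ^ k) j⟫_ℂ = 0
        rw [← inner_conj_symm, hy2 ⟨j, hj⟩ k, map_zero]
      · change ⟪i, (U ^ k) j⟫_ℂ = 0
        have := hy2 ⟨i, hi⟩ (-k)
        rwa [inner_zpow_left, neg_neg] at this
      · exact hS.prop.2 ⟨i, hi⟩ ⟨j, hj⟩ (fun h => hij' (congrArg Subtype.val h)) k
  have hyS : y ∈ S := hS.le_of_ge hins (Set.subset_insert y S) (Set.mem_insert y S)
  have h0 := hy2 ⟨y, hyS⟩ 0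
  rw [zpow_zero] at h0
  exact hμ (hy'.eq_zero_iff.2 (inner_self_eq_zero.1 h0))

end Exhaustion

section Criterion

variable {H : Type*} [NormedAddCommGroup H] [InnerProductSpace ℂ H] [CompleteSpace H]
variable {ι κ : Type*} {U : H ≃ₗᵢ[ℂ] H} {μ : Measure UnitAddCircle}

/-! ### A criterion for the set of spectral multiplicities -/

/-- Both families are moved to a common nonzero piece `μ.restrict C ≪ ρ`, where `IsCopies.card_le`
applies. -/
theorem IsCopies.card_le_of_not_mutuallySingular [IsFiniteMeasure μ] [Fintype ι] [Fintype κ]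
    {x : ι → H} (hx : IsCopies U μ x) (hx' : Exhausts U μ x) {ρ : Measure UnitAddCircle}
    [IsFiniteMeasure ρ] {y : κ → H} (hy : IsCopies U ρ y) (h : ¬ ρ ⟂ₘ μ) :
    Fintype.card κ ≤ Fintype.card ι := by
  obtain ⟨C, hC, hC1, hC2⟩ := exists_restrict_absolutelyContinuous ρ μ
  obtain ⟨x₁, hx₁, hx₁'⟩ := exists_exhausts_restrict hx hx' hC
  obtain ⟨y₁, hy₁⟩ := hy.of_absolutelyContinuous hC1
  refine hx₁.card_le (fun h0 => h (hC2 ?_)) hx₁' hy₁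
  rwa [Measure.restrict_eq_zero] at h0

/-- Write `y = s + t` with `s` singular to `μ a` and `t` orthogonal to all such vectors. Then `t` is
orthogonal to the `v ⟨a, b⟩`, because `y` and `s` are, and to the other `v ⟨a', b⟩`, because these
are singular to `μ a`. So `t` is residual, hence itself singular to `μ a`, hence zero. -/
theorem exhausts_of_residual {α : Type*} {β : α → Type*} {v : (Σ a, β a) → H}
    {μ : α → Measure UnitAddCircle} (hv : ∀ a, IsCopies U (μ a) fun b => v ⟨a, b⟩)
    (hpair : Pairwise fun a a' => μ a ⟂ₘ μ a')
    (hres : ∀ y ∈ residual U v, ∀ a, spectralMeasure U y ⟂ₘ μ a) (a : α) :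
    Exhausts U (μ a) fun b => v ⟨a, b⟩ := by
  intro y hy ν hν
  rw [← hν.eq, ← mem_singularSubspace]
  set S := singularSubspace U (μ a) with hS
  have : CompleteSpace S := (isClosed_singularSubspace U (μ a)).completeSpace_coe
  obtain ⟨s, hs, t, ht, rfl⟩ := S.exists_add_mem_mem_orthogonal y
  have ht' : t ∈ residual U v := by
    refine mem_residual.2 fun ⟨a', b⟩ k => ?_
    by_cases haa : a' = a
    · subst haa
      have h1 := mem_residual.1 hy b k
      rw [inner_add_right] at h1
      have h2 : ⟪(U ^ k) (v ⟨a', b⟩), s⟫_ℂ = 0 := by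
        rw [inner_zpow_left]
        apply inner_zpow_eq_zero_of_mutuallySingular
        rw [((hv a').1 b).eq]
        exact (hs : spectralMeasure U s ⟂ₘ μ a').symm
      rwa [h2, zero_add] at h1
    · refine S.inner_right_of_mem_orthogonal ?_ ht
      rw [hS, mem_singularSubspace, spectralMeasure_zpow, ((hv a').1 b).eq]
      exact hpair haa
  have h0 : t = 0 :=
    inner_self_eq_zero.1 (S.inner_right_of_mem_orthogonal (hres t ht' a) ht)
  rwa [h0, add_zero]

/-- The families `v ⟨m, ·⟩` give multiplicity exactly `m` on `μ m`, and `hcop` says that no finite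
multiplicity occurs on the orthogonal complement of all of them. -/
theorem spectralMultiplicities_eq [TopologicalSpace.SeparableSpace H] {M : Set ℕ+}
    {v : (Σ m : M, Fin (m : ℕ+)) → H} {μ : M → Measure UnitAddCircle} (hμ : ∀ m, μ m ≠ 0)
    (hv : ∀ m, IsCopies U (μ m) fun j => v ⟨m, j⟩)
    (hpair : Pairwise fun m m' => μ m ⟂ₘ μ m')
    (hres : ∀ y ∈ residual U v, ∀ m, spectralMeasure U y ⟂ₘ μ m)
    (hcop : ∀ y ∈ residual U v, y ≠ 0 → ∀ L : ℕ, ∃ ρ : Measure UnitAddCircle, ρ ≠ 0 ∧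
      IsFiniteMeasure ρ ∧ ρ ≪ spectralMeasure U y ∧ ∃ x : Fin L → H, IsCopies U ρ x)
    (hne : ∃ y ∈ residual U v, y ≠ 0) :
    spectralMultiplicities U = (fun m : ℕ+ => ((m : ℕ) : ℕ∞)) '' M ∪ {⊤} := by
  have hex := exhausts_of_residual hv hpair hres
  have hfin : ∀ m : M, IsFiniteMeasure (μ m) := fun m => ((hv m).1 ⟨0, m.1.pos⟩).1
  -- A finite exhausting family singular to every `μ m` would consist of residual vectors, and
  -- `hcop` would produce one more copy than `IsCopies.card_le` allows.
  have key : ∀ {κ : Type} [Fintype κ] [Nonempty κ] {ρ : Measure UnitAddCircle} {x : κ → H},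
      ρ ≠ 0 → IsCopies U ρ x → Exhausts U ρ x → ∃ m, ¬ μ m ⟂ₘ ρ := by
    intro κ _ ⟨i⟩ ρ x hρ hx hx'
    by_contra! hsing
    have := (hx.1 i).1
    have hi : x i ∈ residual U v := by
      refine mem_residual.2 fun ⟨m, j⟩ k => ?_
      rw [inner_zpow_left]
      apply inner_zpow_eq_zero_of_mutuallySingular
      rw [((hv m).1 j).eq, (hx.1 i).eq]
      exact hsing m
    obtain ⟨τ, hτ, hτf, hτρ, y, hy⟩ := hcop (x i) hi (fun h => hρ ((hx.1 i).eq_zero_iff.2 h))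
      (Fintype.card κ + 1)
    rw [(hx.1 i).eq] at hτρ
    have := hx.card_le_of_not_mutuallySingular hx' hy fun h =>
      hτ (Measure.eq_zero_of_absolutelyContinuous_of_mutuallySingular hτρ h)
    simp at this
  refine Set.Subset.antisymm (fun n hn => ?_) ?_
  · obtain ⟨hn1, ρ, x, hρ, hx, hx'⟩ := mem_spectralMultiplicities.1 hn
    induction n using ENat.recTopCoe with
    | top => exact Or.inr rfl
    | coe n =>
      left
      have e : Fin n ≃ {i : ℕ // (i : ℕ∞) < n} :=
        Fin.equivSubtype.trans (Equiv.subtypeEquivRight fun i => by exact Nat.cast_lt.symm)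
      have : Nonempty (Fin n) := ⟨⟨0, by exact_mod_cast hn1⟩⟩
      have hy := hx.comp e e.injective
      have hy' := hx'.comp e e.surjective
      have := (hy.1 (Classical.arbitrary _)).1
      obtain ⟨m, hm⟩ := key hρ hy hy'
      -- Both families are exhausting and their measures overlap, so neither can be larger than the
      -- other.
      have h1 := hy.card_le_of_not_mutuallySingular hy' (hv m) hm
      have h2 := (hv m).card_le_of_not_mutuallySingular (hex m) hy fun h => hm h.symm
      simp only [Fintype.card_fin] at h1 h2
      exact ⟨m, m.2, by simp [le_antisymm h1 h2]⟩
  · rintro n (⟨m, hm, rfl⟩ | rfl)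
    · have : Nonempty (Fin m) := ⟨⟨0, m.pos⟩⟩
      simpa using mem_spectralMultiplicities_card (hμ ⟨m, hm⟩) (hv ⟨m, hm⟩) (hex ⟨m, hm⟩)
    · obtain ⟨y, hy, hy0⟩ := hne
      have hys := isSpectralMeasure_spectralMeasure U y
      -- A maximal family grown from a residual vector has measure singular to all `μ m`, so `key`
      -- excludes that it is finite.
      obtain ⟨S, hyS, hS, A, hA, hA0, x', hx', hx''⟩ := exists_maximal_copies hy0 hys
      have hν : spectralMeasure U y ≠ 0 := fun h => hy0 (hys.eq_zero_iff.1 h)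
      have hν' : (spectralMeasure U y).restrict A ≠ 0 := by rwa [Ne, Measure.restrict_eq_zero]
      have : Countable S := hS.countable hν
      have : Infinite S := by
        by_contra hf
        have : Finite S := not_infinite_iff_finite.1 hf
        have : Nonempty S := ⟨⟨y, hyS⟩⟩
        let e := (Finite.equivFin S).symm
        have : Nonempty (Fin (Nat.card S)) := ⟨e.symm ⟨y, hyS⟩⟩
        obtain ⟨m, hm⟩ := key hν' (hx'.comp e e.injective) (hx''.comp e e.surjective)
        exact hm ((hres y hy m).symm.mono le_rfl Measure.restrict_le_self)
      exact top_mem_spectralMultiplicities hν' hx' hx''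

end Criterion

/-! ### Measures on the circle: convolution powers, ergodicity, random translates. -/

section Convolution

/-! ### Translates and convolution powers of measures on the circle -/

instance isProbabilityMeasure_circle : IsProbabilityMeasure (volume : Measure UnitAddCircle) :=
  ⟨UnitAddCircle.measure_univ⟩

/-- The translate of a measure. -/
def translate (s : UnitAddCircle) (μ : Measure UnitAddCircle) : Measure UnitAddCircle :=
  μ.map (s + ·)

instance (s : UnitAddCircle) (μ : Measure UnitAddCircle) [IsFiniteMeasure μ] :
    IsFiniteMeasure (translate s μ) := Measure.isFiniteMeasure_map _ _

/-- The convolution powers of a measure. -/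
def convPow (μ : Measure UnitAddCircle) : ℕ → Measure UnitAddCircle
  | 0 => Measure.dirac 0
  | n + 1 => μ ∗ convPow μ n

variable {μ ν : Measure UnitAddCircle}

theorem fourier_apply_add (k : ℤ) (s t : UnitAddCircle) :
    fourier k (s + t) = fourier k s * fourier k t := by
  simp only [fourier_apply, smul_add, AddCircle.toCircle_add, Circle.coe_mul]

theorem integral_fourier_translate (s : UnitAddCircle) (k : ℤ) :
    ∫ t, fourier k t ∂(translate s μ) = fourier k s * ∫ t, fourier k t ∂μ := by
  rw [translate, integral_map (by fun_prop) (by fun_prop), ← integral_const_mul]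
  simp only [fourier_apply_add]

variable [IsFiniteMeasure μ]

instance (n : ℕ) : IsFiniteMeasure (convPow μ n) := by
  induction n with
  | zero => exact inferInstanceAs (IsFiniteMeasure (Measure.dirac 0))
  | succ n ih => exact inferInstanceAs (IsFiniteMeasure (μ ∗ convPow μ n))

theorem integral_fourier_convPow (k : ℤ) (n : ℕ) :
    ∫ t, fourier k t ∂(convPow μ n) = (∫ t, fourier k t ∂μ) ^ n := by
  induction n with
  | zero => simp [convPow]
  | succ n ih =>
    rw [convPow, integral_conv (integrable_fourier _ k), pow_succ]
    simp only [fourier_apply_add, integral_const_mul, integral_mul_const, ih]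
    ring

theorem convPow_one : convPow μ 1 = μ :=
  measure_ext_of_fourier fun k => by rw [integral_fourier_convPow, pow_one]

theorem translate_convPow (s : UnitAddCircle) (n : ℕ) :
    convPow (translate s μ) n = translate (n • s) (convPow μ n) :=
  measure_ext_of_fourier fun k => by
    rw [integral_fourier_convPow, integral_fourier_translate, integral_fourier_translate,
      integral_fourier_convPow, mul_pow]
    congr 1
    simp only [fourier_apply]
    rw [smul_comm, AddCircle.toCircle_nsmul, Circle.coe_pow]

theorem convPow_ne_zero (h : μ ≠ 0) (n : ℕ) : convPow μ n ≠ 0 := by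
  intro h0
  have h1 := integral_fourier_convPow (μ := μ) 0 n
  rw [h0] at h1
  simp only [fourier_zero, integral_const] at h1
  have h2 : μ.real Set.univ ≠ 0 := by
    rw [Ne, measureReal_eq_zero_iff]
    rwa [Measure.measure_univ_eq_zero]
  have h3 := pow_ne_zero n h2
  apply h3
  simpa using h1.symm

theorem translate_absolutelyContinuous {s : UnitAddCircle} (h : ν ≪ volume) :
    translate s ν ≪ volume := by
  have := h.map (measurable_const_add s)
  rwa [map_add_left_eq_self (volume : Measure UnitAddCircle) s] at this

theorem convPow_absolutelyContinuous (h : convPow μ 2 ≪ volume) {n : ℕ} (hn : 2 ≤ n) :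
    convPow μ n ≪ volume := by
  induction n, hn using Nat.le_induction with
  | base => exact h
  | succ n _ ih => exact Measure.conv_absolutelyContinuous ih

theorem MutuallySingular.translate {α β : Measure UnitAddCircle} (h : α ⟂ₘ β) (s : UnitAddCircle) :
    SpectralMult.translate s α ⟂ₘ SpectralMult.translate s β := by
  obtain ⟨A, hA, h1, h2⟩ := h
  have e : ∀ B : Set UnitAddCircle, (fun t => s + t) ⁻¹' ((fun t => -s + t) ⁻¹' B) = B := by
    intro B; ext t; simp
  have hA' : MeasurableSet ((fun t => -s + t) ⁻¹' A) := measurable_const_add (-s) hA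
  refine ⟨_, hA', ?_, ?_⟩
  · rw [SpectralMult.translate, Measure.map_apply (by fun_prop) hA', e, h1]
  · rw [SpectralMult.translate, Measure.map_apply (by fun_prop) hA'.compl, Set.preimage_compl, e, h2]

/-! ### Supports of convolution powers -/

theorem countable_finite_order : {t : UnitAddCircle | addOrderOf t ≠ 0}.Countable := by
  have : {t : UnitAddCircle | addOrderOf t ≠ 0} =
      ⋃ n : ℕ, {t : UnitAddCircle | addOrderOf t = n + 1} := by
    ext t
    simp only [Set.mem_ofPred_eq, Set.mem_iUnion]
    exact ⟨fun h => ⟨addOrderOf t - 1, by omega⟩, fun ⟨n, hn⟩ => by omega⟩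
  rw [this]
  exact Set.countable_iUnion fun n =>
    (AddCircle.finite_setOfPred_addOrderOf_eq 1 n.succ_pos).countable

/-- If `μ` has no atoms and its convolution square is absolutely continuous, then the densities of
the convolution powers of `μ` have no common zeros from any index on. -/
theorem exists_convPow_not_mutuallySingular (hμ : μ ≠ 0) (hatom : ∀ t, μ {t} = 0)
    (hac : convPow μ 2 ≪ volume) (hν : ν ≪ volume) (hν0 : ν ≠ 0) (N : ℕ) :
    ∃ n, 2 ≤ n ∧ N ≤ n ∧ ¬ convPow μ n ⟂ₘ ν := by
  by_contra! hsing
  have hacn : ∀ n, 2 ≤ n → convPow μ n ≪ volume := fun n hn => convPow_absolutelyContinuous hac hn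
  let f : ℕ → UnitAddCircle → ℝ≥0∞ := fun n => (convPow μ n).rnDeriv volume
  have hf : ∀ n, Measurable (f n) := fun n => Measure.measurable_rnDeriv _ _
  have hfz : ∀ n, 2 ≤ n → ∀ B, convPow μ n B = 0 ↔ volume ({t | f n t ≠ 0} ∩ B) = 0 := by
    intro n hn B
    rw [← withDensity_apply_eq_zero (hf n), Measure.withDensity_rnDeriv_eq _ _ (hacn n hn)]
  -- The common zero set of the densities; by `hE0` and `hEmax` it is, up to Lebesgue-null sets, the
  -- largest set that is null for all these powers.
  let E : Set UnitAddCircle := {t | ∀ n, 2 ≤ n → N ≤ n → f n t = 0}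
  have hE : MeasurableSet E := by
    have : E = ⋂ (n : ℕ) (_ : 2 ≤ n) (_ : N ≤ n), {t | f n t = 0} := by ext; simp [E]
    rw [this]
    exact MeasurableSet.iInter fun n => MeasurableSet.iInter fun _ => MeasurableSet.iInter fun _ =>
      measurableSet_eq_fun (hf n) measurable_const
  have hE0 : ∀ n, 2 ≤ n → N ≤ n → convPow μ n E = 0 := by
    intro n hn hN
    rw [hfz n hn]
    convert measure_empty (μ := (volume : Measure UnitAddCircle))
    ext t
    simp only [Set.mem_inter_iff, Set.mem_ofPred_eq, Set.mem_empty_iff_false, iff_false, not_and]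
    exact fun h1 h2 => h1 (h2 n hn hN)
  have hEmax : ∀ B, (∀ n, 2 ≤ n → N ≤ n → convPow μ n B = 0) → volume (B \ E) = 0 := by
    intro B hB
    have : B \ E ⊆ ⋃ (n : ℕ) (_ : 2 ≤ n) (_ : N ≤ n), {t | f n t ≠ 0} ∩ B := by
      rintro t ⟨htB, htE⟩
      simp only [E, Set.mem_ofPred_eq, not_forall] at htE
      obtain ⟨n, h2, hN, ht⟩ := htE
      simp only [Set.mem_iUnion]
      exact ⟨n, h2, hN, ht, htB⟩
    refine measure_mono_null this ?_
    simp only [measure_iUnion_null_iff]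
    exact fun n h2 hN => (hfz n h2 B).1 (hB n h2 hN)
  -- Since `E` is null for `μ ∗ μ^{*n}`, its translate by `μ`-almost every `t` is null for `μ^{*n}`,
  -- for all these `n` at once, and so is almost contained in `E`.
  have hinv : ∀ᵐ t ∂μ, volume (((t + ·) ⁻¹' E) \ E) = 0 := by
    have : ∀ n, 2 ≤ n → N ≤ n → ∀ᵐ t ∂μ, convPow μ n ((t + ·) ⁻¹' E) = 0 := by
      intro n h2 hN
      have h0 := hE0 (n + 1) (by omega) (by omega)
      rw [convPow, ← lintegral_indicator_one hE, Measure.lintegral_conv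
        (measurable_one.indicator hE)] at h0
      have h1 : ∀ t, ∫⁻ s, E.indicator 1 (t + s) ∂(convPow μ n) =
          convPow μ n ((t + ·) ⁻¹' E) := fun t => by
        rw [← lintegral_indicator_one (measurable_const_add t hE)]
        rfl
      simp only [h1] at h0
      refine (lintegral_eq_zero_iff ?_).1 h0
      exact measurable_measure_prodMk_left (measurable_add hE)
    have h1 : ∀ᵐ t ∂μ, ∀ n, 2 ≤ n → N ≤ n → convPow μ n ((t + ·) ⁻¹' E) = 0 := by
      simp only [ae_all_iff]
      exact this
    filter_upwards [h1] with t ht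
    exact hEmax _ ht
  -- Torsion points are countable and `μ` has no atoms. Translation by a point of infinite order is
  -- ergodic, so `E` is null or of full measure.
  have hord : ∀ᵐ t ∂μ, addOrderOf t = 0 := by
    rw [ae_iff]
    have : NullSingletonClass μ := ⟨hatom⟩
    exact Set.Countable.measure_zero countable_finite_order μ
  have : (ae μ).NeBot := ae_neBot.2 hμ
  obtain ⟨t, ht1, ht2⟩ := (hinv.and hord).exists
  have herg : Ergodic (t + ·) (volume : Measure UnitAddCircle) := AddCircle.ergodic_add_left.2 ht2
  rcases herg.ae_empty_or_univ_of_preimage_ae_le hE.nullMeasurableSet (ae_le_set.2 ht1) with h | h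
  · rw [ae_eq_empty] at h
    -- If `E` is null, so is the intersection of the sets `A n`, which are null for `μ^{*n}` and
    -- carry `ν`; hence `ν = 0`. If `E` has full measure, the powers vanish.
    choose A hA hA1 hA2 using fun n (hn : 2 ≤ n ∧ N ≤ n) => hsing n hn.1 hn.2
    have h1 : volume ((⋂ (n) (hn : 2 ≤ n ∧ N ≤ n), A n hn) \ E) = 0 := by
      refine hEmax _ fun n h2 hN => measure_mono_null ?_ (hA1 n ⟨h2, hN⟩)
      exact Set.iInter₂_subset n ⟨h2, hN⟩
    have h2 : volume (⋂ (n) (hn : 2 ≤ n ∧ N ≤ n), A n hn) = 0 :=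
      measure_mono_null (Set.subset_sdiff_union _ E) (measure_union_null h1 h)
    apply hν0
    rw [← Measure.measure_univ_eq_zero, ← Set.union_compl_self (⋂ (n) (hn : 2 ≤ n ∧ N ≤ n), A n hn)]
    refine measure_union_null (hν h2) ?_
    simp only [Set.compl_iInter, measure_iUnion_null_iff]
    exact fun n hn => hA2 n hn
  · rw [ae_eq_univ] at h
    have h2 : 2 ≤ max 2 N := le_max_left _ _
    refine convPow_ne_zero hμ (max 2 N) ?_
    rw [← Measure.measure_univ_eq_zero, ← Set.union_compl_self E]
    exact measure_union_null (hE0 _ h2 (le_max_right _ _)) (hacn _ h2 h)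

/-- By induction on `L`: `ν` is cut down to a part dominated by one power, and the bound `N` is
raised to `n + 1` so that later exponents are new. -/
theorem exists_finset_convPow (hμ : μ ≠ 0) (hatom : ∀ t, μ {t} = 0) (hac : convPow μ 2 ≪ volume)
    (L : ℕ) : ∀ (ν : Measure UnitAddCircle) [IsFiniteMeasure ν], ν ≪ volume → ν ≠ 0 → ∀ N : ℕ,
    ∃ (ρ : Measure UnitAddCircle) (S : Finset ℕ), ρ ≠ 0 ∧ IsFiniteMeasure ρ ∧ ρ ≪ ν ∧
      S.card = L ∧ ∀ n ∈ S, 2 ≤ n ∧ N ≤ n ∧ ρ ≪ convPow μ n := by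
  induction L with
  | zero => exact fun ν _ hν hν0 N => ⟨ν, ∅, hν0, inferInstance, .rfl, rfl, by simp⟩
  | succ L ih =>
    intro ν _ hν hν0 N
    obtain ⟨n, h2, hN, hn⟩ := exists_convPow_not_mutuallySingular hμ hatom hac hν hν0 N
    obtain ⟨C, hC, hC1, hC2⟩ := exists_restrict_absolutelyContinuous (convPow μ n) ν
    have hle : ν.restrict C ≪ ν := Measure.restrict_le_self.absolutelyContinuous
    obtain ⟨ρ, S, hρ, hρf, hρν, hS, hSn⟩ := ih (ν.restrict C) (hle.trans hν)
      (fun h => hn (hC2 (Measure.restrict_eq_zero.1 h))) (n + 1)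
    refine ⟨ρ, insert n S, hρ, hρf, hρν.trans hle, ?_, fun m hm => ?_⟩
    · rw [Finset.card_insert_of_notMem, hS]
      intro hnS
      have := (hSn n hnS).2.1
      omega
    · rcases Finset.mem_insert.1 hm with rfl | hm
      · exact ⟨h2, hN, hρν.trans hC1⟩
      · exact ⟨(hSn m hm).1, by have := (hSn m hm).2.1; omega, (hSn m hm).2.2⟩

/-! ### Random translates -/

/-- The convolution of Lebesgue measure with `α` is absolutely continuous, so it does not charge the
null set that carries `β`. By Fubini its mass there is the average of the masses given by the
translates of `α`. -/
theorem ae_translate_mutuallySingular (α : Measure UnitAddCircle) [IsFiniteMeasure α]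
    {β : Measure UnitAddCircle} (hβ : β ⟂ₘ volume) :
    ∀ᵐ w ∂(volume : Measure UnitAddCircle), translate w α ⟂ₘ β := by
  obtain ⟨A, hA, h1, h2⟩ := hβ
  have h0 : ((volume : Measure UnitAddCircle) ∗ α) Aᶜ = 0 := by
    rw [Measure.conv_comm]
    exact Measure.conv_absolutelyContinuous .rfl h2
  rw [← lintegral_indicator_one hA.compl, Measure.lintegral_conv
    (measurable_one.indicator hA.compl)] at h0
  have h3 : ∀ t, ∫⁻ s, Aᶜ.indicator 1 (t + s) ∂α = translate t α Aᶜ := fun t => by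
    rw [translate, Measure.map_apply (measurable_const_add t) hA.compl,
      ← lintegral_indicator_one (measurable_const_add t hA.compl)]
    rfl
  have h4 : Measurable fun t => translate t α Aᶜ := by
    have : (fun t => translate t α Aᶜ) =
        fun t => α (Prod.mk t ⁻¹' ((fun p : UnitAddCircle × UnitAddCircle => p.1 + p.2) ⁻¹' Aᶜ)) :=
      funext fun t => by rw [translate, Measure.map_apply (measurable_const_add t) hA.compl]; rfl
    rw [this]
    exact measurable_measure_prodMk_left (measurable_add hA.compl)
  simp only [h3] at h0
  filter_upwards [(lintegral_eq_zero_iff h4).1 h0] with t ht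
  exact ⟨Aᶜ, hA.compl, ht, by rwa [compl_compl]⟩

/-- Shifting the coordinate `q` by `a` shifts `φ` by `c • a`, and by divisibility every point of the
circle is such a multiple. So the image measure is translation invariant, hence a multiple of
Lebesgue measure. -/
theorem ae_infinitePi_of_ae (φ : (ℕ+ → UnitAddCircle) →+ UnitAddCircle) (hφ : Measurable φ)
    (q : ℕ+) (c : ℤ) (hc : c ≠ 0) (hq : ∀ a, φ (Pi.single q a) = c • a)
    {P : UnitAddCircle → Prop} (hP : ∀ᵐ w ∂(volume : Measure UnitAddCircle), P w) :
    ∀ᵐ θ ∂(Measure.infinitePi fun _ : ℕ+ => (volume : Measure UnitAddCircle)), P (φ θ) := by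
  set Θ := Measure.infinitePi fun _ : ℕ+ => (volume : Measure UnitAddCircle) with hΘ
  have hinv : ∀ b : ℕ+ → UnitAddCircle, Θ.map (b + ·) = Θ := by
    intro b
    have := Measure.infinitePi_map_pi (fun _ : ℕ+ => (volume : Measure UnitAddCircle))
      (f := fun i t => b i + t) (fun i => measurable_const_add (b i))
    simp only [map_add_left_eq_self] at this
    exact this
  have hτ : (Θ.map φ).IsAddLeftInvariant := by
    refine ⟨fun s => ?_⟩
    obtain ⟨a, rfl⟩ : ∃ a : UnitAddCircle, c • a = s :=
      ⟨DivisibleBy.div s c, DivisibleBy.div_cancel s hc⟩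
    rw [Measure.map_map (measurable_const_add _) hφ]
    conv_rhs => rw [← hinv (Pi.single q a), Measure.map_map hφ (measurable_const_add _)]
    congr 1
    ext θ
    simp [hq]
  have : IsFiniteMeasure (Θ.map φ) := Measure.isFiniteMeasure_map _ _
  have heq := Measure.isAddLeftInvariant_eq_smul (Θ.map φ) (volume : Measure UnitAddCircle)
  have hac : Θ.map φ ≪ volume := by
    rw [heq]
    exact Measure.smul_absolutelyContinuous
  exact ae_of_ae_map hφ.aemeasurable (hac.ae_le hP)

end Convolution

/-! ### Rotations, Hilbert sums, tensor powers and the summands of `Exp`. -/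

section Transfer

variable {H : Type*} [NormedAddCommGroup H] [InnerProductSpace ℂ H]
variable {K : Type*} [NormedAddCommGroup K] [InnerProductSpace ℂ K]
variable {U : H ≃ₗᵢ[ℂ] H} {V : K ≃ₗᵢ[ℂ] K} {μ : Measure UnitAddCircle}

/-! ### Transfer of spectral measures along intertwining maps -/

theorem IsSpectralMeasure.of_inner_eq {x : H} {y : K} (h : IsSpectralMeasure U x μ)
    (hxy : ∀ k : ℤ, ⟪y, (V ^ k) y⟫_ℂ = ⟪x, (U ^ k) x⟫_ℂ) : IsSpectralMeasure V y μ :=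
  ⟨h.1, fun k => by rw [h.2, hxy]⟩

theorem IsSpectralMeasure.map {φ : H → K} (hφ : ∀ x, φ (U x) = V (φ x))
    (hin : ∀ x y, ⟪φ x, φ y⟫_ℂ = ⟪x, y⟫_ℂ) {x : H} (h : IsSpectralMeasure U x μ) :
    IsSpectralMeasure V (φ x) μ :=
  h.of_inner_eq fun k => by rw [← semiconj_zpow hφ, hin]

/-- The factor `c` is allowed for because `symEmb` is isometric only up to a constant. -/
theorem IsCopies.map {ι : Type*} {φ : H → K} (hφ : ∀ x, φ (U x) = V (φ x)) {c : ℝ} (hc : 0 ≤ c)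
    (hin : ∀ x y, ⟪φ x, φ y⟫_ℂ = (c : ℂ) * ⟪x, y⟫_ℂ) {x : ι → H} (h : IsCopies U μ x) :
    IsCopies V (ENNReal.ofReal c • μ) (φ ∘ x) := by
  refine ⟨fun i => ⟨?_, fun k => ?_⟩, fun i j hij k => ?_⟩
  · have := (h.1 i).1
    exact μ.smul_finite ENNReal.ofReal_ne_top
  · rw [integral_smul_measure, (h.1 i).2, Function.comp_apply, ← semiconj_zpow hφ, hin,
      ENNReal.toReal_ofReal hc, Complex.real_smul]
  · rw [Function.comp_apply, Function.comp_apply, ← semiconj_zpow hφ, hin, h.2 i j hij, mul_zero]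

theorem rotate_zpow_apply (z : Circle) (U : H ≃ₗᵢ[ℂ] H) (k : ℤ) (x : H) :
    ((rotate z U) ^ k) x = ((z : ℂ) ^ k) • (U ^ k) x := by
  have h := eq_zpow_apply_of_succ (rotate z U) (fun k => ((z : ℂ) ^ k) • (U ^ k) x)
    (fun k => ?_) k
  · simpa using h.symm
  · rw [rotate_apply, map_smul, smul_smul, zpow_add₀ z.coe_ne_zero, zpow_one, add_comm k 1,
      zpow_add_apply, zpow_one, mul_comm]

theorem fourier_eq_toCircle_zpow (k : ℤ) (s : UnitAddCircle) :
    fourier k s = (AddCircle.toCircle s : ℂ) ^ k := by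
  rw [fourier_apply, AddCircle.toCircle_zsmul, Circle.coe_zpow]

theorem IsSpectralMeasure.rotate {x : H} (h : IsSpectralMeasure U x μ) (s : UnitAddCircle) :
    IsSpectralMeasure (SpectralMult.rotate (AddCircle.toCircle s) U) x (translate s μ) := by
  have := h.1
  refine ⟨inferInstance, fun k => ?_⟩
  rw [integral_fourier_translate, rotate_zpow_apply, inner_smul_right, h.2,
    fourier_eq_toCircle_zpow]

theorem IsCopies.rotate {ι : Type*} {x : ι → H} (h : IsCopies U μ x) (s : UnitAddCircle) :
    IsCopies (SpectralMult.rotate (AddCircle.toCircle s) U) (translate s μ) x :=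
  ⟨fun i => (h.1 i).rotate s, fun i j hij k => by
    rw [rotate_zpow_apply, inner_smul_right, h.2 i j hij, mul_zero]⟩

end Transfer

section SingleLemmas

variable {ι : Type*} [DecidableEq ι] {E : ι → Type*} [∀ i, NormedAddCommGroup (E i)]
  [∀ i, InnerProductSpace ℂ (E i)]

theorem directSum_single (U : ∀ i, E i ≃ₗᵢ[ℂ] E i) (i : ι) (a : E i) :
    lp.single 2 i (U i a) = directSum U (lp.single 2 i a) := by
  ext j
  rw [directSum_apply]
  by_cases h : j = i
  · subst h; simp
  · simp [Pi.single_eq_of_ne h]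

theorem inner_single_single (i : ι) (a b : E i) :
    ⟪(lp.single 2 i a : lp E 2), lp.single 2 i b⟫_ℂ = ⟪a, b⟫_ℂ := by
  rw [lp.inner_single_left]; simp

theorem inner_single_single_of_ne {i j : ι} (hij : i ≠ j) (a : E i) (b : E j) :
    ⟪(lp.single 2 i a : lp E 2), lp.single 2 j b⟫_ℂ = 0 := by
  rw [lp.inner_single_left]; simp [Pi.single_eq_of_ne hij]

/-- A closed subspace of a Hilbert sum that contains all summands is everything. -/
theorem mem_of_single_mem {S : Submodule ℂ (lp E 2)} (hS : IsClosed (S : Set (lp E 2)))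
    (f : lp E 2) (h : ∀ i, lp.single 2 i (f i) ∈ S) : f ∈ S :=
  hS.mem_of_tendsto (lp.hasSum_single (by simp) f)
    (Filter.Eventually.of_forall fun s => S.sum_mem fun i _ => h i)

theorem separableSpace_lp [Countable ι] [∀ i, TopologicalSpace.SeparableSpace (E i)] :
    TopologicalSpace.SeparableSpace (lp E 2) := by
  have h1 : TopologicalSpace.IsSeparable
      (⋃ i, Set.range fun a : E i => (lp.single 2 i a : lp E 2)) := by
    refine TopologicalSpace.IsSeparable.iUnion fun i => TopologicalSpace.isSeparable_range ?_
    exact (lp.isometry_single i).continuous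
  have h2 := (h1.span (R := ℂ)).closure
  have h3 : (⊤ : Submodule ℂ (lp E 2)) ≤ (Submodule.span ℂ
      (⋃ i, Set.range fun a : E i => (lp.single 2 i a : lp E 2))).topologicalClosure :=
    fun f _ => mem_of_single_mem (Submodule.isClosed_topologicalClosure _) f fun i =>
      Submodule.le_topologicalClosure _ (Submodule.subset_span (Set.mem_iUnion.2 ⟨i, _, rfl⟩))
  rw [← TopologicalSpace.isSeparable_univ_iff]
  exact h2.mono fun f _ => h3 trivial

end SingleLemmas

section TensorLemmas

variable {G : Type*} [NormedAddCommGroup G] [InnerProductSpace ℂ G] {n : ℕ}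

/-! ### Decomposable tensors -/

/-- The decomposable tensor `y₁ ⊗ ⋯ ⊗ yₙ` in the Hilbert space tensor power. -/
def tens (y : Fin n → G) : TensorPower G n := ((pure y : AlgTensorPower G n) : TensorPower G n)

theorem inner_tens_tens (x y : Fin n → G) : ⟪tens x, tens y⟫_ℂ = ∏ i, ⟪x i, y i⟫_ℂ := by
  rw [tens, tens, Completion.inner_coe, inner_pure_pure]

theorem norm_tens (y : Fin n → G) : ‖tens y‖ = ∏ i, ‖y i‖ := by
  have h : ((‖tens y‖ ^ 2 : ℝ) : ℂ) = (((∏ i, ‖y i‖) ^ 2 : ℝ) : ℂ) := by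
    have := inner_tens_tens y y
    simp only [inner_self_eq_norm_sq_to_K] at this
    rw [Finset.prod_pow] at this
    push_cast
    exact_mod_cast this
  exact (sq_eq_sq₀ (norm_nonneg _) (Finset.prod_nonneg fun i _ => norm_nonneg _)).1
    (Complex.ofReal_injective h)

theorem tensorPow_tens (V : G ≃ₗᵢ[ℂ] G) (y : Fin n → G) :
    tensorPow V n (tens y) = tens fun i => V (y i) := by
  rw [tens, tensorPow, completionMap_coe, algTensorPow_pure]; rfl

theorem perm_tens (σ : Equiv.Perm (Fin n)) (y : Fin n → G) :
    perm σ (tens y) = tens fun i => y (σ.symm i) := by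
  rw [tens, perm, completionMap_coe, algPerm_pure]; rfl

theorem tens_smul (c : Fin n → ℂ) (y : Fin n → G) :
    tens (fun i => c i • y i) = (∏ i, c i) • tens y := by
  rw [tens, tens, ← Completion.coe_smul]
  congr 1
  exact (PiTensorProduct.tprod ℂ).map_smul_univ c y

theorem tensorPow_zpow_tens (V : G ≃ₗᵢ[ℂ] G) (k : ℤ) (y : Fin n → G) :
    (tensorPow V n ^ k) (tens y) = tens fun i => (V ^ k) (y i) := by
  have h := eq_zpow_apply_of_succ (tensorPow V n) (fun k => tens fun i => (V ^ k) (y i))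
    (fun k => ?_) k
  · simpa using h.symm
  · rw [tensorPow_tens]
    congr 1
    ext i
    rw [add_comm, zpow_add_apply, zpow_one]

/-- The decomposable tensor as a linear function of one factor. -/
def tensUpdate (y : Fin n → G) (a : Fin n) : G →L[ℂ] TensorPower G n :=
  LinearMap.mkContinuous
    { toFun := fun v => tens (Function.update y a v)
      map_add' := fun v w => by
        rw [tens, tens, tens, ← Completion.coe_add]
        congr 1
        exact (PiTensorProduct.tprod ℂ).map_update_add y a v w
      map_smul' := fun c v => by
        rw [RingHom.id_apply, tens, tens, ← Completion.coe_smul]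
        congr 1
        exact (PiTensorProduct.tprod ℂ).map_update_smul y a c v }
    (∏ i ∈ Finset.univ \ {a}, ‖y i‖) fun v => by
      change ‖tens (Function.update y a v)‖ ≤ _
      rw [norm_tens, Finset.prod_eq_mul_prod_sdiff_singleton_of_mem (Finset.mem_univ a),
        Function.update_self, mul_comm]
      refine le_of_eq (congrArg (· * ‖v‖) (Finset.prod_congr rfl fun j hj => ?_))
      rw [Function.update_of_ne (by simpa using hj)]

theorem tensUpdate_apply (y : Fin n → G) (a : Fin n) (v : G) :
    tensUpdate y a v = tens (Function.update y a v) := rfl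

/-- Decomposable tensors of vectors from a total set are total. -/
theorem eq_top_of_tens_mem {T : Submodule ℂ (TensorPower G n)}
    (hT : IsClosed (T : Set (TensorPower G n))) {B : Set G}
    (hB : ∀ S : Submodule ℂ G, IsClosed (S : Set G) → B ⊆ S → S = ⊤)
    (h : ∀ y : Fin n → G, (∀ i, y i ∈ B) → tens y ∈ T) : T = ⊤ := by
  -- The factors with index in `s` are arbitrary and the others lie in `B`; enlarging `s` frees one
  -- factor at a time, by linearity and continuity in that factor.
  have key : ∀ (s : Finset (Fin n)) (y : Fin n → G), (∀ i ∉ s, y i ∈ B) → tens y ∈ T := by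
    intro s
    induction s using Finset.induction_on with
    | empty => exact fun y hy => h y fun i => hy i (Finset.notMem_empty i)
    | insert a s ha ih =>
      intro y hy
      have hS := hB (T.comap (tensUpdate y a).toLinearMap) (hT.preimage (tensUpdate y a).continuous)
        fun v hv => by
          refine ih (Function.update y a v) fun i hi => ?_
          by_cases hia : i = a
          · subst hia; rwa [Function.update_self]
          · rw [Function.update_of_ne hia]
            exact hy i (by simp [hia, hi])
      have : y a ∈ T.comap (tensUpdate y a).toLinearMap := by rw [hS]; trivial
      rw [Submodule.mem_comap, ContinuousLinearMap.coe_coe, tensUpdate_apply,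
        Function.update_eq_self] at this
      exact this
  refine Submodule.eq_top_iff'.2 fun t => ?_
  induction t using Completion.induction_on with
  | hp => exact hT
  | ih t =>
    induction t using algTensor_induction with
    | smul_pure c y =>
      rw [Completion.coe_smul]
      exact T.smul_mem c (key Finset.univ y fun i hi => absurd (Finset.mem_univ i) hi)
    | add s t hs ht =>
      rw [Completion.coe_add]
      exact T.add_mem hs ht

theorem eq_top_of_forall_tens_mem {T : Submodule ℂ (TensorPower G n)}
    (hT : IsClosed (T : Set (TensorPower G n))) (h : ∀ y : Fin n → G, tens y ∈ T) : T = ⊤ :=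
  eq_top_of_tens_mem hT (B := Set.univ) (fun _ _ hS => eq_top_iff.2 fun _ _ => hS trivial)
    fun y _ => h y

theorem span_tens_closure :
    (Submodule.span ℂ (Set.range (tens : (Fin n → G) → TensorPower G n))).topologicalClosure = ⊤ :=
  eq_top_of_forall_tens_mem (Submodule.isClosed_topologicalClosure _) fun _ =>
    Submodule.le_topologicalClosure _ (Submodule.subset_span ⟨_, rfl⟩)

/-- Continuous linear maps that agree on decomposable tensors are equal. -/
theorem clm_ext_tens {E : Type*} [NormedAddCommGroup E] [NormedSpace ℂ E]
    {f g : TensorPower G n →L[ℂ] E} (h : ∀ y, f (tens y) = g (tens y)) (t : TensorPower G n) :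
    f t = g t := by
  have := eq_top_of_forall_tens_mem (T := LinearMap.ker (f - g).toLinearMap)
    (f - g).isClosed_ker (fun y => by simp [h])
  have ht : t ∈ LinearMap.ker (f - g).toLinearMap := by rw [this]; trivial
  simpa [sub_eq_zero] using ht

/-- The symmetric tensor `y ⊗ ⋯ ⊗ y`. -/
def symTens (n : ℕ) (y : G) : SymPower G n := ⟨tens fun _ => y, fun σ => perm_tens σ _⟩

theorem coe_symPow (V : G ≃ₗᵢ[ℂ] G) (t : SymPower G n) :
    ((symPow V n t : SymPower G n) : TensorPower G n) = tensorPow V n t := rfl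

theorem isSpectralMeasure_coe {V : G ≃ₗᵢ[ℂ] G} {t : SymPower G n} {μ : Measure UnitAddCircle} :
    IsSpectralMeasure (symPow V n) t μ ↔ IsSpectralMeasure (tensorPow V n) (t : TensorPower G n) μ := by
  have h : ∀ k : ℤ, ⟪(t : TensorPower G n), (tensorPow V n ^ k) t⟫_ℂ =
      ⟪t, (symPow V n ^ k) t⟫_ℂ := fun k => by
    rw [← semiconj_zpow (φ := (Subtype.val : SymPower G n → TensorPower G n)) (coe_symPow V)]
    rfl
  exact ⟨fun hμ => hμ.of_inner_eq h, fun hμ => hμ.of_inner_eq fun k => (h k).symm⟩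

/-- Inner products of decomposable tensors are products, so the Fourier coefficients are raised to
the power `n`, as for `convPow`. -/
theorem isSpectralMeasure_symTens {V : G ≃ₗᵢ[ℂ] G} {y : G} {μ : Measure UnitAddCircle}
    (h : IsSpectralMeasure V y μ) : IsSpectralMeasure (symPow V n) (symTens n y) (convPow μ n) := by
  have := h.1
  refine isSpectralMeasure_coe.2 ⟨inferInstance, fun k => ?_⟩
  change _ = ⟪tens fun _ => y, (tensorPow V n ^ k) (tens fun _ => y)⟫_ℂ
  rw [integral_fourier_convPow, tensorPow_zpow_tens, inner_tens_tens, h.2]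
  simp

theorem separableSpace_symPower {B : Set G} (hBc : B.Countable)
    (hB : ∀ S : Submodule ℂ G, IsClosed (S : Set G) → B ⊆ S → S = ⊤) :
    TopologicalSpace.SeparableSpace (SymPower G n) := by
  have : Countable B := hBc
  let e : (Fin n → B) → TensorPower G n := fun y => tens fun i => (y i : G)
  have h1 := ((Set.countable_range e).isSeparable.span (R := ℂ)).closure
  have h2 := eq_top_of_tens_mem (T := (Submodule.span ℂ (Set.range e)).topologicalClosure)
    (Submodule.isClosed_topologicalClosure _) hB fun y hy =>
      Submodule.le_topologicalClosure _ (Submodule.subset_span ⟨fun i => ⟨y i, hy i⟩, rfl⟩)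
  have h3 : TopologicalSpace.IsSeparable (SymPower G n : Set (TensorPower G n)) :=
    h1.mono fun t _ => (eq_top_iff.1 h2) trivial
  exact h3.separableSpace

end TensorLemmas

section SumOfRotations

variable {H : Type*} [NormedAddCommGroup H] [InnerProductSpace ℂ H]
variable {P : Type*} [DecidableEq P] {n : ℕ}

/-! ### Tensor powers of direct sums of rotations -/

/-- The direct sum of the operators `exp (2πi θ p) U`. -/
abbrev sumRotate (U : H ≃ₗᵢ[ℂ] H) (θ : P → UnitAddCircle) :
    lp (fun _ : P => H) 2 ≃ₗᵢ[ℂ] lp (fun _ : P => H) 2 :=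
  directSum fun p => rotate (AddCircle.toCircle (θ p)) U

theorem fourier_sum {ι : Type*} (k : ℤ) (s : Finset ι) (f : ι → UnitAddCircle) :
    fourier k (∑ i ∈ s, f i) = ∏ i ∈ s, fourier k (f i) := by
  classical
  induction s using Finset.induction_on with
  | empty => simp
  | insert a s ha ih =>
    rw [Finset.sum_insert ha, Finset.prod_insert ha, fourier_apply_add, ih]

variable (U : H ≃ₗᵢ[ℂ] H) (θ : P → UnitAddCircle)

theorem isSpectralMeasure_single {x : H} {σ : Measure UnitAddCircle}
    (h : IsSpectralMeasure U x σ) (p : P) :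
    IsSpectralMeasure (sumRotate U θ) (lp.single 2 p x) (translate (θ p) σ) :=
  (h.rotate (θ p)).map (φ := fun a => (lp.single 2 p a : lp (fun _ : P => H) 2))
    (fun a => directSum_single (fun p => rotate (AddCircle.toCircle (θ p)) U) p a) (inner_single_single (E := fun _ : P => H) p)

/-- Each factor contributes a translate of `σ`, whatever the exponent `l i`, since moving a vector
along its orbit preserves its spectral measure. These tensors are total in the tensor power when `x`
is cyclic. -/
theorem isSpectralMeasure_tens_single {x : H} {σ : Measure UnitAddCircle}
    (h : IsSpectralMeasure U x σ) (q : Fin n → P) (l : Fin n → ℤ) :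
    IsSpectralMeasure (tensorPow (sumRotate U θ) n)
      (tens fun i => (sumRotate U θ ^ l i) (lp.single 2 (q i) x))
      (translate (∑ i, θ (q i)) (convPow σ n)) := by
  have := h.1
  refine ⟨inferInstance, fun k => ?_⟩
  rw [integral_fourier_translate, integral_fourier_convPow, tensorPow_zpow_tens, inner_tens_tens,
    fourier_sum, ← Fin.prod_const, ← Finset.prod_mul_distrib]
  refine Finset.prod_congr rfl fun i _ => ?_
  rw [← ((isSpectralMeasure_single U θ h (q i)).zpow (l i)).2, integral_fourier_translate]

theorem eq_top_of_single_mem {x : H} (hx : cyclicSubspace U x = ⊤)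
    (S : Submodule ℂ (lp (fun _ : P => H) 2)) (hS : IsClosed (S : Set (lp (fun _ : P => H) 2)))
    (h : Set.range (fun a : P × ℤ => (sumRotate U θ ^ a.2) (lp.single 2 a.1 x)) ⊆ S) : S = ⊤ := by
  refine Submodule.eq_top_iff'.2 fun f => mem_of_single_mem hS f fun p => ?_
  let L : H →L[ℂ] lp (fun _ : P => H) 2 :=
    lp.singleContinuousLinearMap ℂ (fun _ : P => H) 2 p
  have hle : cyclicSubspace U x ≤ S.comap L.toLinearMap := by
    refine cyclicSubspace_le (hS.preimage L.continuous) fun k => ?_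
    have hk : (sumRotate U θ ^ k) (lp.single 2 p x) ∈ S := h ⟨(p, k), rfl⟩
    rw [← semiconj_zpow (φ := fun a => (lp.single 2 p a : lp (fun _ : P => H) 2))
      (fun a => directSum_single (fun p => rotate (AddCircle.toCircle (θ p)) U) p a),
      rotate_zpow_apply, lp.single_smul] at hk
    exact (S.smul_mem_iff (zpow_ne_zero k (Circle.coe_ne_zero _))).1 hk
  exact hle (by rw [hx]; trivial : f p ∈ cyclicSubspace U x)

/-! ### Embeddings of symmetric tensor powers -/

theorem exists_tensEmb (q : Fin n → P) :
    ∃ J : TensorPower H n →ₗᵢ[ℂ] TensorPower (lp (fun _ : P => H) 2) n,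
      ∀ y : Fin n → H, J (tens y) = tens fun i => lp.single 2 (q i) (y i) :=
  exists_linearIsometry_of_gram span_tens_closure fun x y => by
    simp only [inner_tens_tens, inner_single_single]

/-- The embedding of `H^{⊗n}` given by the embeddings of `H` as summands number `q i`. -/
def tensEmb (q : Fin n → P) : TensorPower H n →ₗᵢ[ℂ] TensorPower (lp (fun _ : P => H) 2) n :=
  (exists_tensEmb q).choose

theorem tensEmb_tens (q : Fin n → P) (y : Fin n → H) :
    tensEmb q (tens y) = tens fun i => lp.single 2 (q i) (y i) :=
  (exists_tensEmb q).choose_spec y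

theorem tensorPow_tensEmb (q : Fin n → P) (t : TensorPower H n) :
    tensorPow (sumRotate U θ) n (tensEmb q t) =
      tensEmb q ((AddCircle.toCircle (∑ i, θ (q i)) : ℂ) • tensorPow U n t) := by
  let f : TensorPower H n →L[ℂ] TensorPower (lp (fun _ : P => H) 2) n :=
    ((tensorPow (sumRotate U θ) n).toContinuousLinearEquiv : _ →L[ℂ] _).comp
      (tensEmb q).toContinuousLinearMap
  let g : TensorPower H n →L[ℂ] TensorPower (lp (fun _ : P => H) 2) n :=
    (AddCircle.toCircle (∑ i, θ (q i)) : ℂ) • (tensEmb q).toContinuousLinearMap.comp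
      ((tensorPow U n).toContinuousLinearEquiv : _ →L[ℂ] _)
  rw [map_smul]
  refine clm_ext_tens (f := f) (g := g) (fun y => ?_) t
  change tensorPow (sumRotate U θ) n (tensEmb q (tens y)) =
    (AddCircle.toCircle (∑ i, θ (q i)) : ℂ) • tensEmb q (tensorPow U n (tens y))
  have h1 : (AddCircle.toCircle (∑ i, θ (q i)) : ℂ) =
      ∏ i, (AddCircle.toCircle (θ (q i)) : ℂ) := by
    simpa using fourier_sum 1 Finset.univ fun i => θ (q i)
  rw [tensEmb_tens, tensorPow_tens, tensorPow_tens, tensEmb_tens, h1, ← tens_smul]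
  congr 1
  ext1 i
  rw [← directSum_single, rotate_apply, lp.single_smul]

theorem perm_tensEmb (σ : Equiv.Perm (Fin n)) (q : Fin n → P) (t : TensorPower H n) :
    perm σ (tensEmb q t) = tensEmb (q ∘ σ.symm) (perm σ t) := by
  let f : TensorPower H n →L[ℂ] TensorPower (lp (fun _ : P => H) 2) n :=
    (perm (H := lp (fun _ : P => H) 2) σ).toLinearIsometry.toContinuousLinearMap.comp
      (tensEmb q).toContinuousLinearMap
  let g : TensorPower H n →L[ℂ] TensorPower (lp (fun _ : P => H) 2) n :=
    (tensEmb (q ∘ σ.symm)).toContinuousLinearMap.comp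
      (perm (H := H) σ).toLinearIsometry.toContinuousLinearMap
  refine clm_ext_tens (f := f) (g := g) (fun y => ?_) t
  change perm σ (tensEmb q (tens y)) = tensEmb (q ∘ σ.symm) (perm σ (tens y))
  rw [tensEmb_tens, perm_tens, perm_tens, tensEmb_tens]
  rfl

theorem inner_tensEmb_of_ne {q q' : Fin n → P} (h : q ≠ q') (t s : TensorPower H n) :
    ⟪tensEmb q t, tensEmb q' s⟫_ℂ = 0 := by
  have h1 : ∀ (x : Fin n → H) (s : TensorPower H n), ⟪tensEmb q (tens x), tensEmb q' s⟫_ℂ = 0 := by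
    intro x s
    refine clm_ext_tens (f := (innerSL ℂ (tensEmb q (tens x))).comp
      (tensEmb q').toContinuousLinearMap) (g := 0) (fun y => ?_) s
    change ⟪tensEmb q (tens x), tensEmb q' (tens y)⟫_ℂ = 0
    rw [tensEmb_tens, tensEmb_tens, inner_tens_tens]
    obtain ⟨i, hi⟩ := Function.ne_iff.1 h
    exact Finset.prod_eq_zero (Finset.mem_univ i) (inner_single_single_of_ne hi _ _)
  rw [← inner_conj_symm]
  have h2 : ⟪tensEmb q' s, tensEmb q t⟫_ℂ = 0 := by
    refine clm_ext_tens (f := (innerSL ℂ (tensEmb q' s)).comp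
      (tensEmb q).toContinuousLinearMap) (g := 0) (fun y => ?_) t
    change ⟪tensEmb q' s, tensEmb q (tens y)⟫_ℂ = 0
    rw [← inner_conj_symm, h1, map_zero]
  rw [h2, map_zero]

/-- The symmetrization of `tensEmb q` on symmetric tensors. -/
def symEmb (q : Fin n → P) (t : SymPower H n) : SymPower (lp (fun _ : P => H) 2) n :=
  ⟨∑ σ : Equiv.Perm (Fin n), tensEmb (q ∘ σ) (t : TensorPower H n), fun τ => by
    rw [map_sum]
    -- A permutation of the factors only reindexes the sum by `σ ↦ σ * τ⁻¹`, because `t` itself is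
    -- symmetric.
    refine Fintype.sum_equiv (Equiv.mulRight τ⁻¹) _ _ fun σ => ?_
    rw [perm_tensEmb, t.2 τ]
    rfl⟩

theorem symPow_symEmb (q : Fin n → P) (t : SymPower H n) :
    symEmb q (rotate (AddCircle.toCircle (∑ i, θ (q i))) (symPow U n) t) =
      symPow (sumRotate U θ) n (symEmb q t) := by
  refine Subtype.ext ?_
  rw [coe_symPow, symEmb, symEmb, map_sum]
  refine Finset.sum_congr rfl fun σ _ => ?_
  rw [tensorPow_tensEmb]
  have : ∑ i, θ ((q ∘ σ) i) = ∑ i, θ (q i) := Equiv.sum_comp σ fun i => θ (q i)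
  rw [this]
  rfl

/-- Embeddings along different index tuples have orthogonal ranges, so `c` counts the pairs of
permutations with `q ∘ σ = q ∘ τ`; the diagonal pairs make it positive. -/
theorem exists_inner_symEmb (q : Fin n → P) :
    ∃ c : ℝ, 0 < c ∧ ∀ t s : SymPower H n, ⟪symEmb q t, symEmb q s⟫_ℂ = (c : ℂ) * ⟪t, s⟫_ℂ := by
  refine ⟨∑ σ : Equiv.Perm (Fin n), ∑ τ : Equiv.Perm (Fin n),
    if q ∘ σ = q ∘ τ then (1 : ℝ) else 0, ?_, fun t s => ?_⟩
  · refine Finset.sum_pos (fun σ _ => ?_) Finset.univ_nonempty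
    refine Finset.sum_pos' (fun τ _ => by split_ifs <;> norm_num) ⟨σ, Finset.mem_univ σ, by simp⟩
  · change ⟪∑ σ : Equiv.Perm (Fin n), tensEmb (q ∘ σ) (t : TensorPower H n),
      ∑ σ : Equiv.Perm (Fin n), tensEmb (q ∘ σ) (s : TensorPower H n)⟫_ℂ = _
    simp only [sum_inner, inner_sum]
    push_cast
    simp only [Finset.sum_mul]
    rw [Finset.sum_comm]
    refine Finset.sum_congr rfl fun σ _ => Finset.sum_congr rfl fun τ _ => ?_
    by_cases h : q ∘ τ = q ∘ σ
    · rw [if_pos h.symm, h, LinearIsometry.inner_map_map]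
      simp
    · rw [if_neg (Ne.symm h), inner_tensEmb_of_ne (Ne.symm h)]
      simp

end SumOfRotations

section ExpSingle

variable {G : Type*} [NormedAddCommGroup G] [InnerProductSpace ℂ G]
variable {V : G ≃ₗᵢ[ℂ] G} {μ : Measure UnitAddCircle}

/-! ### The summands of `Exp V` -/

/-- The inclusion of the `n`-th summand. -/
def expSingle (n : ℕ+) (t : SymPower G n) : lp (fun n : ℕ+ => SymPower G n) 2 := lp.single 2 n t

theorem expSingle_symPow (n : ℕ+) (t : SymPower G n) :
    expSingle n (symPow V n t) = Exp V (expSingle n t) :=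
  directSum_single (fun n : ℕ+ => symPow V n) n t

theorem inner_expSingle (n : ℕ+) (s t : SymPower G n) :
    ⟪expSingle n s, expSingle n t⟫_ℂ = ⟪s, t⟫_ℂ :=
  inner_single_single (E := fun n : ℕ+ => SymPower G n) n s t

theorem inner_expSingle_of_ne {n k : ℕ+} (h : n ≠ k) (s : SymPower G n) (t : SymPower G k) :
    ⟪expSingle n s, expSingle k t⟫_ℂ = 0 :=
  inner_single_single_of_ne (E := fun n : ℕ+ => SymPower G n) h s t

theorem exp_zpow_expSingle (n : ℕ+) (k : ℤ) (t : SymPower G n) :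
    (Exp V ^ k) (expSingle n t) = expSingle n ((symPow V n ^ k) t) :=
  (semiconj_zpow (expSingle_symPow n) k t).symm

theorem inner_expSingle_left (n : ℕ+) (s : SymPower G n)
    (y : lp (fun n : ℕ+ => SymPower G n) 2) : ⟪expSingle n s, y⟫_ℂ = ⟪s, y n⟫_ℂ :=
  lp.inner_single_left (G := fun n : ℕ+ => SymPower G n) n s y

theorem IsSpectralMeasure.expSingle {n : ℕ+} {t : SymPower G n}
    (h : IsSpectralMeasure (symPow V n) t μ) :
    IsSpectralMeasure (Exp V) (SpectralMult.expSingle n t) μ :=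
  h.map (expSingle_symPow n) (inner_expSingle n)

theorem IsCopies.expSingle {n : ℕ+} {ι : Type*} {x : ι → SymPower G n}
    (h : IsCopies (symPow V n) μ x) : IsCopies (Exp V) μ fun i => SpectralMult.expSingle n (x i) :=
  ⟨fun i => (h.1 i).expSingle, fun i j hij k => by
    rw [exp_zpow_expSingle, inner_expSingle, h.2 i j hij]⟩

/-- With one factor every tensor is symmetric. The degree stays a variable so that the coercion of
`(1 : ℕ+)` can be substituted for it. -/
theorem eq_zero_of_inner_symTens_one {B : Set G}
    (hB : ∀ S : Submodule ℂ G, IsClosed (S : Set G) → B ⊆ S → S = ⊤) {n : ℕ} (hn : n = 1)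
    (t : SymPower G n) (h : ∀ b ∈ B, ⟪symTens n b, t⟫_ℂ = 0) : t = 0 := by
  subst hn
  have hT := eq_top_of_tens_mem (T := (ℂ ∙ (t : TensorPower G 1))ᗮ)
    (Submodule.isClosed_orthogonal _) hB fun y hy => by
      have h1 : (tens y : TensorPower G 1) = (symTens 1 (y 0) : SymPower G 1) := by
        change tens y = tens fun _ => y 0
        congr 1
        ext i
        rw [Subsingleton.elim i 0]
      rw [Submodule.mem_orthogonal_singleton_iff_inner_left, h1]
      exact h _ (hy 0)
  have ht : (t : TensorPower G 1) ∈ (ℂ ∙ (t : TensorPower G 1))ᗮ := by rw [hT]; trivial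
  rw [Submodule.mem_orthogonal_singleton_iff_inner_left] at ht
  exact Subtype.ext (inner_self_eq_zero.1 ht)

theorem zpow_symTens (n : ℕ) (k : ℤ) (y : G) :
    (symPow V n ^ k) (symTens n y) = symTens n ((V ^ k) y) := by
  refine Subtype.ext ?_
  rw [semiconj_zpow (φ := (Subtype.val : SymPower G n → TensorPower G n)) (coe_symPow V)]
  exact tensorPow_zpow_tens V k _

theorem inner_symTens (n : ℕ) (x y : G) : ⟪symTens n x, symTens n y⟫_ℂ = ⟪x, y⟫_ℂ ^ n :=
  (inner_tens_tens _ _).trans (by simp)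

/-- The vector `y ⊗ ⋯ ⊗ y` of the `n`-th summand. -/
def expSym (n : ℕ+) (y : G) : lp (fun n : ℕ+ => SymPower G n) 2 := expSingle n (symTens n y)

theorem inner_expSym (n : ℕ+) (x y : G) : ⟪expSym n x, expSym n y⟫_ℂ = ⟪x, y⟫_ℂ ^ (n : ℕ) := by
  rw [expSym, expSym, inner_expSingle, inner_symTens]

theorem exp_zpow_expSym (n : ℕ+) (k : ℤ) (y : G) :
    (Exp V ^ k) (expSym n y) = expSym n ((V ^ k) y) := by
  rw [expSym, exp_zpow_expSingle, zpow_symTens, expSym]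

theorem inner_exp_zpow_expSym (n : ℕ+) (x y : G) (k : ℤ) :
    ⟪expSym n x, (Exp V ^ k) (expSym n y)⟫_ℂ = ⟪x, (V ^ k) y⟫_ℂ ^ (n : ℕ) := by
  rw [exp_zpow_expSym, inner_expSym]

theorem inner_exp_zpow_expSym_of_ne {n k : ℕ+} (h : n ≠ k) (x y : G) (l : ℤ) :
    ⟪(Exp V ^ l) (expSym n x), expSym k y⟫_ℂ = 0 := by
  rw [exp_zpow_expSym, expSym, expSym, inner_expSingle_of_ne h]

theorem inner_expSym_exp_zpow_of_ne {n k : ℕ+} (h : n ≠ k) (x y : G) (l : ℤ) :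
    ⟪expSym n x, (Exp V ^ l) (expSym k y)⟫_ℂ = 0 := by
  rw [exp_zpow_expSym, expSym, expSym, inner_expSingle_of_ne h]

theorem IsSpectralMeasure.expSym {y : G} (h : IsSpectralMeasure V y μ) (n : ℕ+) :
    IsSpectralMeasure (Exp V) (SpectralMult.expSym n y) (convPow μ n) :=
  (isSpectralMeasure_symTens h).expSingle

/-- The generators of the first summand. -/
def expGen {P : Type*} (b : P → G) (p : P) : lp (fun n : ℕ+ => SymPower G n) 2 := expSym 1 (b p)

/-- The orbits of the generators are total in degree 1, so everything residual lives in degrees at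
least 2. -/
theorem apply_one_of_mem_residual {P : Type*} {b : P → G}
    (hB : ∀ S : Submodule ℂ G, IsClosed (S : Set G) →
      Set.range (fun a : P × ℤ => (V ^ a.2) (b a.1)) ⊆ S → S = ⊤)
    {y : lp (fun n : ℕ+ => SymPower G n) 2} (hy : y ∈ residual (Exp V) (expGen b)) : y 1 = 0 := by
  refine eq_zero_of_inner_symTens_one hB PNat.one_coe (y 1) ?_
  rintro _ ⟨⟨p, k⟩, rfl⟩
  have h := mem_residual.1 hy p k
  rwa [expGen, exp_zpow_expSym, expSym, inner_expSingle_left] at h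

theorem expSym_two_mem_residual {P : Type*} (b : P → G) (y : G) :
    expSym 2 y ∈ residual (Exp V) (expGen b) :=
  mem_residual.2 fun _ k => inner_exp_zpow_expSym_of_ne (by decide) _ _ k

theorem expSym_eq_zero_iff {n : ℕ+} {y : G} : expSym n y = 0 ↔ y = 0 := by
  rw [← inner_self_eq_zero (𝕜 := ℂ), inner_expSym, pow_eq_zero_iff n.ne_zero, inner_self_eq_zero]

end ExpSingle

/-! ### The multiplicities of `Exp` of a sum of rotations, and the two cases. -/

section ExpSum

variable {H : Type*} [NormedAddCommGroup H] [InnerProductSpace ℂ H]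
variable {P : Type*} [DecidableEq P] {U : H ≃ₗᵢ[ℂ] H} {θ : P → UnitAddCircle}
variable {x : H} {σ : Measure UnitAddCircle}

/-! ### The operator `Exp (⨁ exp (2πi θ p) U)` -/

theorem inner_sumRotate_zpow_single_of_ne {p p' : P} (h : p ≠ p') (k : ℤ) :
    ⟪(lp.single 2 p x : lp (fun _ : P => H) 2), (sumRotate U θ ^ k) (lp.single 2 p' x)⟫_ℂ = 0 := by
  rw [← semiconj_zpow (φ := fun a => (lp.single 2 p' a : lp (fun _ : P => H) 2))
    (fun a => directSum_single (fun p => rotate (AddCircle.toCircle (θ p)) U) p' a)]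
  exact inner_single_single_of_ne h _ _

theorem isCopies_expGen (h : IsSpectralMeasure U x σ) {ι : Type*} (e : ι → P)
    (he : Function.Injective e) {s : UnitAddCircle} (hs : ∀ i, θ (e i) = s) :
    IsCopies (Exp (sumRotate U θ)) (translate s σ)
      fun i => expGen (fun p => (lp.single 2 p x : lp (fun _ : P => H) 2)) (e i) := by
  have := h.1
  refine ⟨fun i => ?_, fun i j hij k => (inner_exp_zpow_expSym 1 _ _ k).trans ?_⟩
  · have h1 := (isSpectralMeasure_single U θ h (e i)).expSym 1
    rwa [PNat.one_coe, convPow_one, hs] at h1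
  · rw [inner_sumRotate_zpow_single_of_ne (he.ne hij), PNat.one_coe, pow_one]

/-- Being singular to `μ` defines a closed subspace, so it can be checked degree by degree on the
decomposable tensors of orbit vectors. It is applied to the translates of `σ` and also to the
spectral measure of `y` itself. -/
theorem mutuallySingular_of_apply_one_eq_zero (hx : cyclicSubspace U x = ⊤)
    (h : IsSpectralMeasure U x σ) {μ : Measure UnitAddCircle}
    (hμ : ∀ n : ℕ, 2 ≤ n → ∀ q : Fin n → P, translate (∑ i, θ (q i)) (convPow σ n) ⟂ₘ μ)
    {y : lp (fun n : ℕ+ => SymPower (lp (fun _ : P => H) 2) n) 2} (hy : y 1 = 0) :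
    spectralMeasure (Exp (sumRotate U θ)) y ⟂ₘ μ := by
  refine mem_of_single_mem (S := singularSubspace (Exp (sumRotate U θ)) μ)
    (isClosed_singularSubspace _ _) y fun n => ?_
  by_cases hn : n = 1
  · subst hn
    rw [hy]
    rw [lp.single_zero]
    exact Submodule.zero_mem _
  have hn2 : 2 ≤ (n : ℕ) := by
    have := n.pos
    have : (n : ℕ) ≠ 1 := fun h => hn (PNat.coe_eq_one_iff.1 h)
    omega
  have hT := eq_top_of_tens_mem (T := singularSubspace (tensorPow (sumRotate U θ) n) μ)
    (isClosed_singularSubspace _ _) (eq_top_of_single_mem U θ hx) fun z hz => by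
      choose a ha using hz
      have := (isSpectralMeasure_tens_single U θ h (fun i => (a i).1) fun i => (a i).2).eq
      rw [mem_singularSubspace, ← funext ha, this]
      exact hμ n hn2 _
  have ht : (y n : TensorPower (lp (fun _ : P => H) 2) n) ∈
      singularSubspace (tensorPow (sumRotate U θ) n) μ := by rw [hT]; trivial
  rw [mem_singularSubspace] at ht ⊢
  have h1 := isSpectralMeasure_coe.2 (isSpectralMeasure_spectralMeasure
    (tensorPow (sumRotate U θ) n) (y n : TensorPower (lp (fun _ : P => H) 2) n))
  rwa [← h1.expSingle.eq] at ht

theorem separableSpace_exp [Countable P] (hx : cyclicSubspace U x = ⊤) :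
    TopologicalSpace.SeparableSpace (lp (fun n : ℕ+ => SymPower (lp (fun _ : P => H) 2) n) 2) := by
  have (n : ℕ+) : TopologicalSpace.SeparableSpace (SymPower (lp (fun _ : P => H) 2) n) :=
    separableSpace_symPower (Set.countable_range _) (eq_top_of_single_mem U 0 hx)
  exact separableSpace_lp

/-- The spectral multiplicities of `Exp (⨁ exp (2πi θ m) U)`, given the positions of the measures
of the summands and enough copies of the higher ones. -/
theorem spectralMultiplicities_exp_sumRotate {M : Set ℕ+} (hM : M.Nonempty) {θ : ℕ+ → UnitAddCircle}
    (hx : cyclicSubspace U x = ⊤) (hx0 : x ≠ 0) (h : IsSpectralMeasure U x σ)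
    (h1 : Pairwise fun m m' => translate (θ m) σ ⟂ₘ translate (θ m') σ)
    (h2 : ∀ n : ℕ, 2 ≤ n → ∀ (q : Fin n → ℕ+) (m : ℕ+),
      translate (∑ i, θ (q i)) (convPow σ n) ⟂ₘ translate (θ m) σ)
    (h3 : ∀ n : ℕ, 2 ≤ n → ∀ (q : Fin n → Σ m : M, Fin (m : ℕ+)) (ν : Measure UnitAddCircle)
      [IsFiniteMeasure ν], ¬ translate (∑ i, θ (q i).1) (convPow σ n) ⟂ₘ ν →
      ∀ L : ℕ, ∃ ρ : Measure UnitAddCircle, ρ ≠ 0 ∧ IsFiniteMeasure ρ ∧ ρ ≪ ν ∧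
        ∃ x : Fin L → lp (fun n : ℕ+ => SymPower (lp (fun _ : (Σ m : M, Fin (m : ℕ+)) => H) 2) n) 2,
          IsCopies (Exp (sumRotate U fun p : (Σ m : M, Fin (m : ℕ+)) => θ p.1)) ρ x) :
    spectralMultiplicities (Exp (sumRotate U fun p : (Σ m : M, Fin (m : ℕ+)) => θ p.1)) =
      (fun m : ℕ+ => ((m : ℕ) : ℕ∞)) '' M ∪ {⊤} := by
  have := h.1
  have := separableSpace_exp (P := Σ m : M, Fin (m : ℕ+)) hx
  refine spectralMultiplicities_eq (v := expGen fun p => lp.single 2 p x) (μ := fun m => translate (θ m) σ)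
    (fun m h0 => ?_) (fun m => isCopies_expGen h _ sigma_mk_injective fun _ => rfl) (fun m m' hm => ?_)
    (fun y hy m => ?_) (fun y hy hy0 => ?_) ?_
  · exact hx0 ((h.rotate (θ m)).eq_zero_iff.1 h0)
  · exact h1 fun h => hm (Subtype.ext h)
  · exact mutuallySingular_of_apply_one_eq_zero hx h (fun n hn q => h2 n hn (fun i => (q i).1) m)
      (apply_one_of_mem_residual (eq_top_of_single_mem U _ hx) hy)
  -- If `L` copies could not be found below the spectral measure of `y`, then by `h3` that measure
  -- would be singular to all measures of higher degree, hence to itself, and `y` would vanish.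
  · by_contra! hL
    obtain ⟨L, hL⟩ := hL
    have h4 := mutuallySingular_of_apply_one_eq_zero hx h
      (μ := spectralMeasure (Exp (sumRotate U fun p : (Σ m : M, Fin (m : ℕ+)) => θ p.1)) y)
      (θ := fun p : (Σ m : M, Fin (m : ℕ+)) => θ p.1) (fun n hn q => by
        by_contra hs
        obtain ⟨ρ, h0, hf, hρ, z, hz⟩ := h3 n hn q _ hs L
        exact hL ρ h0 hf hρ z hz)
      (apply_one_of_mem_residual (eq_top_of_single_mem U _ hx) hy)
    exact hy0 ((isSpectralMeasure_spectralMeasure _ _).eq_zero_iff.1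
      (Measure.MutuallySingular.self_iff _ |>.1 h4))
  · obtain ⟨m, hm⟩ := hM
    let p : Σ m : M, Fin (m : ℕ+) := ⟨⟨m, hm⟩, ⟨0, m.pos⟩⟩
    refine ⟨expSym 2 (lp.single 2 p x), expSym_two_mem_residual _ _, fun h0 => ?_⟩
    have h5 := inner_single_single (E := fun _ : (Σ m : M, Fin (m : ℕ+)) => H) p x x
    rw [expSym_eq_zero_iff.1 h0, inner_zero_left] at h5
    exact hx0 (inner_self_eq_zero.1 h5.symm)

end ExpSum

section Copies

variable {H : Type*} [NormedAddCommGroup H] [InnerProductSpace ℂ H]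
variable {P : Type*} [DecidableEq P] {U : H ≃ₗᵢ[ℂ] H} {θ : P → UnitAddCircle}
variable {x : H} {σ : Measure UnitAddCircle}

/-! ### Many copies of the higher spectral measures -/

/-- One summand `p` is enough: the tensors `y ⊗ ⋯ ⊗ y` of its generator have the convolution powers
as spectral measures, and different degrees are orthogonal. -/
theorem exists_copies_of_convPow_absolutelyContinuous (p : P) (h : IsSpectralMeasure U x σ)
    (hx0 : x ≠ 0) (hatom : ∀ t, σ {t} = 0) (hac : convPow σ 2 ≪ volume)
    {ω ν : Measure UnitAddCircle} [IsFiniteMeasure ω] [IsFiniteMeasure ν] (hω : ω ≪ volume)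
    (hν : ¬ ω ⟂ₘ ν) (L : ℕ) : ∃ ρ : Measure UnitAddCircle, ρ ≠ 0 ∧ IsFiniteMeasure ρ ∧ ρ ≪ ν ∧
      ∃ z : Fin L → lp (fun n : ℕ+ => SymPower (lp (fun _ : P => H) 2) n) 2,
        IsCopies (Exp (sumRotate U θ)) ρ z := by
  have := h.1
  obtain ⟨C, hC, hCω, hC0⟩ := exists_restrict_absolutelyContinuous ω ν
  have hC1 : ν.restrict C ≠ 0 := fun h0 => hν (hC0 (Measure.restrict_eq_zero.1 h0))
  have hτ := isSpectralMeasure_single U θ h p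
  obtain ⟨ρ, S, hρ0, hρf, hρ, hS, hSn⟩ := exists_finset_convPow (μ := translate (θ p) σ)
    (fun h0 => hx0 ((h.rotate (θ p)).eq_zero_iff.1 h0))
    (fun t => by
      rw [translate, Measure.map_apply (measurable_const_add _) (measurableSet_singleton t)]
      have : (fun y => θ p + y) ⁻¹' {t} = {t - θ p} := by
        ext y
        simp only [Set.mem_preimage, Set.mem_singleton_iff, eq_sub_iff_add_eq, add_comm]
      rw [this, hatom])
    (by rw [translate_convPow]; exact translate_absolutelyContinuous hac)
    L (ν.restrict C) (hCω.trans hω) hC1 0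
  have hz : ∀ n : S, ∃ z ∈ cyclicSubspace (Exp (sumRotate U θ))
      (expSym ⟨n, by have := (hSn n n.2).1; omega⟩ (lp.single 2 p x)),
      IsSpectralMeasure (Exp (sumRotate U θ)) z ρ := fun n =>
    exists_isSpectralMeasure_of_absolutelyContinuous (hτ.expSym _) (hSn n n.2).2.2
  choose z hzc hzρ using hz
  refine ⟨ρ, hρ0, hρf, hρ.trans Measure.restrict_le_self.absolutelyContinuous,
    z ∘ (S.equivFinOfCardEq hS).symm, IsCopies.comp ⟨hzρ, fun i j hij k => ?_⟩ _
      (Equiv.injective _)⟩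
  exact inner_eq_zero_of_mem_cyclicSubspace (inner_expSym_exp_zpow_of_ne
    (fun h => hij (Subtype.ext (Subtype.mk.inj h))) _ _) (hzc i) (hzc j) k

/-- A maximal family containing `x ⊗ ⋯ ⊗ x` is infinite, since a finite one would give a finite
spectral multiplicity. -/
theorem exists_infinite_copies [CompleteSpace H] {n : ℕ}
    (h : IsSpectralMeasure U x σ) (hx0 : x ≠ 0) (hn : spectralMultiplicities (symPow U n) = {⊤}) :
    ∃ z : ℕ → SymPower H n, IsCopies (symPow U n) (convPow σ n) z := by
  have := h.1
  have h1 := isSpectralMeasure_symTens (n := n) h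
  have hσ : convPow σ n ≠ 0 := convPow_ne_zero (fun h0 => hx0 (h.eq_zero_iff.1 h0)) n
  obtain ⟨S, hxS, hS, A, hA, hA0, x', hx', hx'e⟩ :=
    exists_maximal_copies (fun h0 => hσ (h1.eq_zero_iff.2 h0)) h1
  have : Nonempty S := ⟨⟨_, hxS⟩⟩
  by_cases hfin : Finite S
  · have := mem_spectralMultiplicities_card (fun h0 => hA0 (Measure.restrict_eq_zero.1 h0)) hx' hx'e
    rw [hn, Set.mem_singleton_iff] at this
    exact absurd this (ENat.natCast_ne_top _)
  · have : Infinite S := not_finite_iff_infinite.1 hfin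
    exact ⟨_, hS.comp (Infinite.natEmbedding S) (Infinite.natEmbedding S).injective⟩

/-- The map `symEmb q` carries copies for `U^{⊙n}`, rotated by the sum of the `θ (q i)`, into `Exp`;
they are then cut down to a common piece with `ν`. -/
theorem exists_copies_of_infinite_copies {n : ℕ} (hn0 : 0 < n) {z : ℕ → SymPower H n}
    [IsFiniteMeasure σ] (hz : IsCopies (symPow U n) (convPow σ n) z) (q : Fin n → P)
    {ν : Measure UnitAddCircle} [IsFiniteMeasure ν]
    (hν : ¬ translate (∑ i, θ (q i)) (convPow σ n) ⟂ₘ ν) (L : ℕ) :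
    ∃ ρ : Measure UnitAddCircle, ρ ≠ 0 ∧ IsFiniteMeasure ρ ∧ ρ ≪ ν ∧
      ∃ z : Fin L → lp (fun n : ℕ+ => SymPower (lp (fun _ : P => H) 2) n) 2,
        IsCopies (Exp (sumRotate U θ)) ρ z := by
  lift n to ℕ+ using hn0
  obtain ⟨C, hC, hCω, hC0⟩ :=
    exists_restrict_absolutelyContinuous (translate (∑ i, θ (q i)) (convPow σ n)) ν
  obtain ⟨c, hc, hcq⟩ := exists_inner_symEmb (H := H) q
  have h1 := ((hz.rotate (∑ i, θ (q i))).map (symPow_symEmb U θ q) hc.le hcq).expSingle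
  obtain ⟨z', hz'⟩ := h1.of_absolutelyContinuous (ρ := ν.restrict C)
    (hCω.trans (Measure.absolutelyContinuous_smul (by simpa using hc)))
  exact ⟨ν.restrict C, fun h0 => hν (hC0 (Measure.restrict_eq_zero.1 h0)), inferInstance,
    Measure.restrict_le_self.absolutelyContinuous, _, hz'.comp _ Fin.val_injective⟩

end Copies

section AlmostEverywhere

variable {σ : Measure UnitAddCircle}

/-! ### Almost every rotation -/

theorem translate_translate (s t : UnitAddCircle) (μ : Measure UnitAddCircle) :
    translate s (translate t μ) = translate (s + t) μ := by
  rw [translate, translate, Measure.map_map (measurable_const_add _) (measurable_const_add _)]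
  simp only [translate, Function.comp_def, add_assoc]

theorem AbsolutelyContinuous.translate {μ ν : Measure UnitAddCircle} (h : μ ≪ ν)
    (s : UnitAddCircle) : SpectralMult.translate s μ ≪ SpectralMult.translate s ν :=
  h.map (measurable_const_add s)

theorem ae_translate_sum_mutuallySingular [IsFiniteMeasure σ] (hσ : σ ⟂ₘ volume) {n : ℕ}
    (q : Fin n → ℕ+) (m : ℕ+) (hq : (∃ i, q i ≠ m) ∨ 2 ≤ n) :
    ∀ᵐ θ ∂(Measure.infinitePi fun _ : ℕ+ => (volume : Measure UnitAddCircle)),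
      translate (∑ i, θ (q i)) (convPow σ n) ⟂ₘ translate (θ m) σ := by
  let φ : (ℕ+ → UnitAddCircle) →+ UnitAddCircle :=
    (∑ i, Pi.evalAddMonoidHom (fun _ : ℕ+ => UnitAddCircle) (q i)) - Pi.evalAddMonoidHom _ m
  have hφ : ∀ θ, φ θ = ∑ i, θ (q i) - θ m := fun θ => by simp [φ]
  have hφm : Measurable φ := by
    rw [funext hφ]
    exact (Finset.measurable_fun_sum _ fun i _ => measurable_pi_apply (q i)).sub
      (measurable_pi_apply m)
  -- The coefficient of `θ r` in `∑ θ (q i) - θ m`. It is nonzero at `r = q i ≠ m`, or equals `n - 1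
  -- > 0` at `r = m` when all `q i` are `m`.
  let c : ℕ+ → ℤ := fun r => ((Finset.univ.filter fun i => q i = r).card : ℤ) -
    if m = r then 1 else 0
  have hc : ∃ r, c r ≠ 0 := by
    by_cases h : ∃ i, q i ≠ m
    · obtain ⟨i, hi⟩ := h
      refine ⟨q i, ?_⟩
      have : 0 < (Finset.univ.filter fun j => q j = q i).card :=
        Finset.card_pos.2 ⟨i, by simp⟩
      simp only [c, if_neg hi.symm]
      omega
    · have h2 := hq.resolve_left h
      push Not at h
      refine ⟨m, ?_⟩
      simp only [c, h, if_true, Finset.filter_true, Finset.card_univ, Fintype.card_fin]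
      omega
  obtain ⟨r, hr⟩ := hc
  have hcr : ∀ a, φ (Pi.single r a) = c r • a := fun a => by
    simp only [hφ, c, Pi.single_apply, sub_smul, Finset.sum_ite, Finset.sum_const_zero, add_zero,
      Finset.sum_const, natCast_zsmul]
    split_ifs <;> simp
  filter_upwards [ae_infinitePi_of_ae φ hφm r (c r) hr hcr
    (ae_translate_mutuallySingular (convPow σ n) hσ)] with θ hθ
  have := MutuallySingular.translate hθ (θ m)
  rwa [translate_translate, hφ, add_sub_cancel] at this

end AlmostEverywhere

section Disjointness

variable {H : Type*} [NormedAddCommGroup H] [InnerProductSpace ℂ H] [CompleteSpace H]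
variable {U : H ≃ₗᵢ[ℂ] H} {x : H} {σ : Measure UnitAddCircle}

/-- As `x` is cyclic, every spectral measure of the rotated operator is absolutely continuous with
respect to the translate of `σ`. -/
theorem spectrallyDisjoint_rotate (hx : cyclicSubspace U x = ⊤) (h : IsSpectralMeasure U x σ)
    {s t : UnitAddCircle} (hst : translate s σ ⟂ₘ translate t σ) :
    SpectrallyDisjoint (rotate (AddCircle.toCircle s) U) (rotate (AddCircle.toCircle t) U) := by
  have hac : ∀ (s : UnitAddCircle) (y : H) (μ : Measure UnitAddCircle),
      IsSpectralMeasure (rotate (AddCircle.toCircle s) U) y μ → μ ≪ translate s σ := by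
    intro s y μ hμ
    rw [← hμ.eq, ((isSpectralMeasure_spectralMeasure U y).rotate s).eq, ← h.eq]
    exact AbsolutelyContinuous.translate
      (spectralMeasure_absolutelyContinuous_of_mem (by rw [hx]; trivial)) s
  exact fun y z μ ν hμ hν => hst.mono_ac (hac s y μ hμ) (hac t z ν hν)

end Disjointness

section Main

variable {H : Type*} [NormedAddCommGroup H] [InnerProductSpace ℂ H]
variable {U : H ≃ₗᵢ[ℂ] H} {x : H} {σ : Measure UnitAddCircle}

/-! ### The multiplicities of `Exp V` -/

theorem ne_zero_of_cyclicSubspace_eq_top [Nontrivial H] (hx : cyclicSubspace U x = ⊤) : x ≠ 0 := by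
  rintro rfl
  have : cyclicSubspace U (0 : H) ≤ ⊥ := cyclicSubspace_le isClosed_singleton fun k => by simp
  exact bot_ne_top (α := Submodule ℂ H) (le_antisymm bot_le (hx ▸ this))

theorem multiplicities_of_absolutelyContinuous [Nontrivial H] (hx : cyclicSubspace U x = ⊤)
    (h : IsSpectralMeasure U x σ) (hatom : ∀ t, σ {t} = 0) (hσ : σ ⟂ₘ volume)
    (hac : HasAbsolutelyContinuousSpectrum (symPow U 2)) (z : ℕ+ → Circle)
    (hz : Pairwise fun m m' : ℕ+ => SpectrallyDisjoint (rotate (z m) U) (rotate (z m') U))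
    (M : Set ℕ+) (hM : M.Nonempty) :
    spectralMultiplicities (Exp (sumOfCopies U z M)) =
      (fun m : ℕ+ => ((m : ℕ) : ℕ∞)) '' M ∪ {⊤} := by
  have := h.1
  obtain ⟨θ, rfl⟩ : ∃ θ : ℕ+ → UnitAddCircle, z = fun m => AddCircle.toCircle (θ m) := by
    refine ⟨fun m => (AddCircle.homeomorphCircle one_ne_zero).symm (z m), funext fun m => ?_⟩
    rw [← AddCircle.homeomorphCircle_apply one_ne_zero, Homeomorph.apply_symm_apply]
  -- The convolution square is the spectral measure of `x ⊗ x`.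
  have hac2 : convPow σ 2 ≪ volume := hac _ _ (isSpectralMeasure_symTens h)
  have hω : ∀ n : ℕ, 2 ≤ n → ∀ s, translate s (convPow σ n) ≪ volume := fun n hn s =>
    translate_absolutelyContinuous (convPow_absolutelyContinuous hac2 hn)
  have hvol : ∀ s, translate s σ ⟂ₘ volume := fun s => by
    have := MutuallySingular.translate hσ s
    rwa [show translate s (volume : Measure UnitAddCircle) = volume from
      map_add_left_eq_self volume s] at this
  have hx0 := ne_zero_of_cyclicSubspace_eq_top hx
  refine spectralMultiplicities_exp_sumRotate hM hx hx0 h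
    (fun m m' hm => hz hm x x _ _ (h.rotate _) (h.rotate _))
    (fun n hn q m => ((hvol (θ m)).mono_ac .rfl (hω n hn _)).symm)
    (fun n hn q ν _ hν L => ?_)
  exact exists_copies_of_convPow_absolutelyContinuous (q ⟨0, by omega⟩) h hx0 hatom hac2
    (hω n hn _) hν L

variable [CompleteSpace H]

theorem ae_pairwise_mutuallySingular [IsFiniteMeasure σ] (hσ : σ ⟂ₘ volume) :
    ∀ᵐ θ ∂(Measure.infinitePi fun _ : ℕ+ => (volume : Measure UnitAddCircle)),
      Pairwise fun m m' : ℕ+ => translate (θ m) σ ⟂ₘ translate (θ m') σ := by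
  have h1 : ∀ m m' : ℕ+, m ≠ m' →
      ∀ᵐ θ ∂(Measure.infinitePi fun _ : ℕ+ => (volume : Measure UnitAddCircle)),
        translate (θ m) σ ⟂ₘ translate (θ m') σ := fun m m' hm => by
    have := ae_translate_sum_mutuallySingular hσ (fun _ : Fin 1 => m) m' (Or.inl ⟨0, hm⟩)
    simpa [convPow_one] using this
  filter_upwards [ae_all_iff.2 fun m => ae_all_iff.2 fun m' => ae_all_iff.2 (h1 m m')] with θ hθ
  exact hθ

theorem ae_pairwise_spectrallyDisjoint (hx : cyclicSubspace U x = ⊤) (h : IsSpectralMeasure U x σ)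
    (hσ : σ ⟂ₘ volume) :
    ∀ᵐ θ ∂(Measure.infinitePi fun _ : ℕ+ => (volume : Measure UnitAddCircle)),
      Pairwise fun m m' : ℕ+ => SpectrallyDisjoint (rotate (AddCircle.toCircle (θ m)) U)
        (rotate (AddCircle.toCircle (θ m')) U) := by
  have := h.1
  filter_upwards [ae_pairwise_mutuallySingular hσ] with θ hθ m m' hm
  exact spectrallyDisjoint_rotate hx h (hθ hm)

/-- The exceptional set is a union over the countably many triples `n`, `q`, `m`, with `q` ranging
over all tuples in `ℕ+`. It does not depend on `M`, so all `M` are treated simultaneously. -/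
theorem ae_multiplicities_of_infinite [Nontrivial H] (hx : cyclicSubspace U x = ⊤)
    (h : IsSpectralMeasure U x σ) (hσ : σ ⟂ₘ volume)
    (hn : ∀ n : ℕ, 1 < n → spectralMultiplicities (symPow U n) = {⊤}) :
    ∀ᵐ θ ∂(Measure.infinitePi fun _ : ℕ+ => (volume : Measure UnitAddCircle)),
      ∀ M : Set ℕ+, M.Nonempty →
        spectralMultiplicities (Exp (sumOfCopies U (fun m => AddCircle.toCircle (θ m)) M)) =
          (fun m : ℕ+ => ((m : ℕ) : ℕ∞)) '' M ∪ {⊤} := by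
  have := h.1
  have hx0 := ne_zero_of_cyclicSubspace_eq_top hx
  filter_upwards [ae_pairwise_mutuallySingular hσ,
    ae_all_iff.2 fun n : {n : ℕ // 2 ≤ n} => ae_all_iff.2 fun q : Fin n → ℕ+ =>
      ae_all_iff.2 fun m : ℕ+ => ae_translate_sum_mutuallySingular hσ q m (Or.inr n.2)]
    with θ h1 h2 M hM
  refine spectralMultiplicities_exp_sumRotate hM hx hx0 h h1 (fun n hn q m => h2 ⟨n, hn⟩ q m)
    (fun n hn2 q ν _ hν L => ?_)
  obtain ⟨z, hz⟩ := exists_infinite_copies h hx0 (hn n hn2)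
  exact exists_copies_of_infinite_copies (θ := fun p : (Σ m : M, Fin (m : ℕ+)) => θ p.1)
    (by omega) hz q hν L

end Main

end SpectralMult

end

theorem mainTheorem6 {H : Type*} [NormedAddCommGroup H] [InnerProductSpace ℂ H] [CompleteSpace H]
    [Nontrivial H] (U : H ≃ₗᵢ[ℂ] H)
    (hsimple : SpectralMult.HasSimpleSpectrum U)
    (hcont : SpectralMult.HasContinuousSpectrum U)
    (hsing : SpectralMult.HasSingularSpectrum U) :
    -- for almost every choice of the `z m = exp (2πi θ m)`, the `z m • U` are pairwise disjoint
    (∀ᵐ θ ∂(MeasureTheory.Measure.infinitePi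
        fun _ : ℕ+ => (MeasureTheory.volume : MeasureTheory.Measure UnitAddCircle)),
      Pairwise fun m m' : ℕ+ => SpectralMult.SpectrallyDisjoint
        (SpectralMult.rotate (AddCircle.toCircle (θ m)) U)
        (SpectralMult.rotate (AddCircle.toCircle (θ m')) U)) ∧
    -- case (a)
    (SpectralMult.HasAbsolutelyContinuousSpectrum (SpectralMult.symPow U 2) →
      ∀ z : ℕ+ → Circle,
        (Pairwise fun m m' : ℕ+ => SpectralMult.SpectrallyDisjoint
          (SpectralMult.rotate (z m) U) (SpectralMult.rotate (z m') U)) →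
        ∀ M : Set ℕ+, M.Nonempty →
          SpectralMult.spectralMultiplicities
              (SpectralMult.Exp (SpectralMult.sumOfCopies U z M)) =
            (fun m : ℕ+ => ((m : ℕ) : ℕ∞)) '' M ∪ {⊤}) ∧
    -- case (b)
    ((∀ n : ℕ, 1 < n →
        SpectralMult.spectralMultiplicities (SpectralMult.symPow U n) = {⊤}) →
      (∀ n k : ℕ, 1 ≤ n → 1 ≤ k → n ≠ k →
        SpectralMult.SpectrallyDisjoint (SpectralMult.symPow U n) (SpectralMult.symPow U k)) →
      ∀ᵐ θ ∂(MeasureTheory.Measure.infinitePi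
          fun _ : ℕ+ => (MeasureTheory.volume : MeasureTheory.Measure UnitAddCircle)),
        ∀ M : Set ℕ+, M.Nonempty →
          SpectralMult.spectralMultiplicities
              (SpectralMult.Exp
                (SpectralMult.sumOfCopies U (fun m => AddCircle.toCircle (θ m)) M)) =
            (fun m : ℕ+ => ((m : ℕ) : ℕ∞)) '' M ∪ {⊤}) := by
  obtain ⟨x, hx⟩ := hsimple
  change SpectralMult.cyclicSubspace U x = ⊤ at hx
  obtain ⟨σ, h⟩ := SpectralMult.exists_isSpectralMeasure U x
  exact ⟨SpectralMult.ae_pairwise_spectrallyDisjoint hx h (hsing x σ h),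
    SpectralMult.multiplicities_of_absolutelyContinuous hx h (hcont x σ h) (hsing x σ h),
    fun hn _ => SpectralMult.ae_multiplicities_of_infinite hx h (hsing x σ h) hn⟩
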